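/- A point set $P$ is a finite set of points in the plane $\mathbb{R}^2$. Two points $p, q \in P$ are \emph{visible} to each other if the segment $pq$ contains no point of $P$ other than $p$ and $q$. An \emph{independent set} of $P$ is a subset of $P$ no two distinct points of which are visible to each other. A \emph{triangle partition} of $P$ is a partition of $P$ into three-point sets, each consisting of the vertices of a non-degenerate triangle (the three points are not collinear), such that the closed triangles spanned by any two different sets of the partition are disjoint. \textbf{Theorem.} Let $n \ge 0$ and let $P$ be a set of $3n$ points in the plane. (i) If $P$ has no independent set of $n+1$ points, then $P$ has a triangle partition, consisting of $n$ triangles. (ii) Conversely, if $P$ has a triangle partition, then $P$ has no independent set of $n+1$ points. Moreover, triangle partitions can be constructed in polynomial time: there are a program for the real random access machine (a machine with arrays of natural numbers, with addition and truncated subtraction, and arrays of real numbers, with addition, subtraction and multiplication, with comparisons, indirect addressing and unit cost for each elementary operation) and a polynomial $q$ such that, for every $n$ and every list of $3n$ distinct points of the plane, given by their coordinates, the program halts after at most $q(n)$ steps, and outputs a triangle partition of the set of these points if there is one, and reports that there is none otherwise. -/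

import Mathlib

/-! # Planar point sets, visibility and triangle partitions -/

/-- The Euclidean plane. -/
abbrev Plane : Type := EuclideanSpace ℝ (Fin 2)

/-- Two points `p`, `q` of the point set `P` are visible to each other if the line segment `pq`
contains no point of `P` other than `p` and `q`. -/
def Visible (P : Set Plane) (p q : Plane) : Prop :=
  P ∩ segment ℝ p q = {p, q}

/-- An independent set of `P` is a subset of `P` no two distinct points of which are visible to
each other. -/
def IsIndependentSet (P S : Set Plane) : Prop :=
  S ⊆ P ∧ ∀ p ∈ S, ∀ q ∈ S, p ≠ q → ¬ Visible P p q

/-- A (disjoint) triangle partition of `P`: a partition of `P` into three-point sets, each of them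
the vertex set of a non-degenerate triangle, such that no two of the closed triangles have a common
point (so they share neither vertices, nor points of edges, nor area). -/
structure IsTrianglePartition (P : Set Plane) (𝒯 : Set (Set Plane)) : Prop where
  sUnion_eq : ⋃₀ 𝒯 = P
  encard_eq : ∀ T ∈ 𝒯, T.encard = 3
  not_collinear : ∀ T ∈ 𝒯, ¬ Collinear ℝ T
  disjoint : ∀ T ∈ 𝒯, ∀ U ∈ 𝒯, T ≠ U → Disjoint (convexHull ℝ T) (convexHull ℝ U)

/-! # A real random access machine

Programs are built from array assignments, sequencing, conditionals and while loops.  There are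
arrays of natural numbers and arrays of real numbers, both with computed indices (indirect
addressing).  The elementary operations are: addition and truncated subtraction of natural numbers,
addition, subtraction and multiplication of real numbers, comparisons, reading and writing an array
cell.  Each elementary operation costs one step.  There is no rounding of reals to integers. -/

namespace RealRAM

/-- The memory: array `a` of natural numbers has the entries `nat a 0, nat a 1, …`, and array `a`
of real numbers has the entries `real a 0, real a 1, …`. -/
structure Store where
  nat : ℕ → ℕ → ℕ
  real : ℕ → ℕ → ℝ

/-- Expressions of natural-number type. -/
inductive NatExpr : Type
  | const (k : ℕ) : NatExpr
  | read (a : ℕ) (i : NatExpr) : NatExpr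
  | add (e f : NatExpr) : NatExpr
  | sub (e f : NatExpr) : NatExpr

/-- Expressions of real-number type; the only constants are natural numbers. -/
inductive RealExpr : Type
  | const (k : ℕ) : RealExpr
  | read (a : ℕ) (i : NatExpr) : RealExpr
  | add (e f : RealExpr) : RealExpr
  | sub (e f : RealExpr) : RealExpr
  | mul (e f : RealExpr) : RealExpr

/-- Tests. -/
inductive Test : Type
  | natLT (e f : NatExpr) : Test
  | realLT (e f : RealExpr) : Test
  | not (b : Test) : Test
  | and (b c : Test) : Test

/-- Programs. -/
inductive Program : Type
  | skip : Program
  | writeNat (a : ℕ) (i e : NatExpr) : Program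
  | writeReal (a : ℕ) (i : NatExpr) (e : RealExpr) : Program
  | seq (c d : Program) : Program
  | ite (b : Test) (c d : Program) : Program
  | while (b : Test) (c : Program) : Program

def NatExpr.value (σ : Store) : NatExpr → ℕ
  | const k => k
  | read a i => σ.nat a (i.value σ)
  | add e f => e.value σ + f.value σ
  | sub e f => e.value σ - f.value σ

/-- The number of steps needed to evaluate an expression. -/
def NatExpr.cost : NatExpr → ℕ
  | const _ => 1
  | read _ i => i.cost + 1
  | add e f => e.cost + f.cost + 1
  | sub e f => e.cost + f.cost + 1

noncomputable def RealExpr.value (σ : Store) : RealExpr → ℝ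
  | const k => (k : ℝ)
  | read a i => σ.real a (i.value σ)
  | add e f => e.value σ + f.value σ
  | sub e f => e.value σ - f.value σ
  | mul e f => e.value σ * f.value σ

/-- The number of steps needed to evaluate an expression. -/
def RealExpr.cost : RealExpr → ℕ
  | const _ => 1
  | read _ i => i.cost + 1
  | add e f => e.cost + f.cost + 1
  | sub e f => e.cost + f.cost + 1
  | mul e f => e.cost + f.cost + 1

def Test.holds (σ : Store) : Test → Prop
  | natLT e f => e.value σ < f.value σ
  | realLT e f => e.value σ < f.value σ
  | not b => ¬ b.holds σ
  | and b c => b.holds σ ∧ c.holds σ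

/-- The number of steps needed to evaluate a test. -/
def Test.cost : Test → ℕ
  | natLT e f => e.cost + f.cost + 1
  | realLT e f => e.cost + f.cost + 1
  | not b => b.cost + 1
  | and b c => b.cost + c.cost + 1

/-- Write the natural number `v` into cell `i` of array `a`. -/
def Store.setNat (σ : Store) (a i v : ℕ) : Store :=
  { σ with nat := Function.update σ.nat a (Function.update (σ.nat a) i v) }

/-- Write the real number `v` into cell `i` of array `a`. -/
noncomputable def Store.setReal (σ : Store) (a i : ℕ) (v : ℝ) : Store :=
  { σ with real := Function.update σ.real a (Function.update (σ.real a) i v) }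

/-- `Runs c σ t τ`: started in memory `σ`, the program `c` halts after exactly `t` steps, in
memory `τ`. -/
inductive Runs : Program → Store → ℕ → Store → Prop
  | skip (σ : Store) : Runs .skip σ 1 σ
  | writeNat (σ : Store) (a : ℕ) (i e : NatExpr) :
      Runs (.writeNat a i e) σ (i.cost + e.cost + 1) (σ.setNat a (i.value σ) (e.value σ))
  | writeReal (σ : Store) (a : ℕ) (i : NatExpr) (e : RealExpr) :
      Runs (.writeReal a i e) σ (i.cost + e.cost + 1) (σ.setReal a (i.value σ) (e.value σ))
  | seq {c d : Program} {σ τ υ : Store} {s t : ℕ} (hc : Runs c σ s τ) (hd : Runs d τ t υ) :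
      Runs (.seq c d) σ (s + t) υ
  | ite_true {b : Test} {c d : Program} {σ τ : Store} {t : ℕ} (hb : b.holds σ)
      (hc : Runs c σ t τ) : Runs (.ite b c d) σ (b.cost + t) τ
  | ite_false {b : Test} {c d : Program} {σ τ : Store} {t : ℕ} (hb : ¬ b.holds σ)
      (hd : Runs d σ t τ) : Runs (.ite b c d) σ (b.cost + t) τ
  | while_true {b : Test} {c : Program} {σ τ υ : Store} {s t : ℕ} (hb : b.holds σ)
      (hc : Runs c σ s τ) (hw : Runs (.while b c) τ t υ) :
      Runs (.while b c) σ (b.cost + s + t) υ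
  | while_false {b : Test} {c : Program} {σ : Store} (hb : ¬ b.holds σ) :
      Runs (.while b c) σ b.cost σ

/-- The memory at the start, for a list `p` of `N` points as input: cell `0` of the natural-number
array `0` holds `N`, the real arrays `0` and `1` hold the first and the second coordinates of the
points, and all other cells are zero. -/
noncomputable def inputStore {N : ℕ} (p : Fin N → Plane) : Store where
  nat a i := if a = 0 ∧ i = 0 then N else 0
  real a i :=
    if h : i < N then (if a = 0 then p ⟨i, h⟩ 0 else if a = 1 then p ⟨i, h⟩ 1 else 0) else 0

/-- The memory `τ` holds a triangle partition of the set of the points `p 0, …, p (3 * n - 1)` as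
output: cells `3 * k`, `3 * k + 1`, `3 * k + 2` of the natural-number array `2` are the indices of
the three vertices of the `k`-th triangle, for `k < n`. -/
def OutputsTrianglePartition {n : ℕ} (p : Fin (3 * n) → Plane) (τ : Store) : Prop :=
  ∃ v : Fin n → Fin 3 → Fin (3 * n),
    (∀ (k : Fin n) (j : Fin 3), τ.nat 2 (3 * (k : ℕ) + (j : ℕ)) = (v k j : ℕ)) ∧
    IsTrianglePartition (Set.range p) (Set.range fun k => Set.range fun j => p (v k j))

/-- The program `c` constructs triangle partitions: run on any `3 * n` distinct points it halts,
after at most `time n` steps; if there is a triangle partition of these points, then cell `0` of the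
natural-number array `1` is `1` at the end and a triangle partition is output; otherwise this cell
is `0` at the end. -/
def ConstructsTrianglePartitions (c : Program) (time : ℕ → ℕ) : Prop :=
  ∀ (n : ℕ) (p : Fin (3 * n) → Plane), Function.Injective p →
    ∃ (t : ℕ) (τ : Store), Runs c (inputStore p) t τ ∧ t ≤ time n ∧
      ((∃ 𝒯, IsTrianglePartition (Set.range p) 𝒯) →
        τ.nat 1 0 = 1 ∧ OutputsTrianglePartition p τ) ∧
      ((¬ ∃ 𝒯, IsTrianglePartition (Set.range p) 𝒯) → τ.nat 1 0 = 0)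

end RealRAM

/-! A triangle of a partition contains at most one point of an independent set: a point of `P`
between two of its vertices lies in the closed triangle, hence in no other triangle of the
partition, so it is the third vertex, and the triangle would be degenerate (`card_of_partition`).
This is direction (ii).

For (i) more is shown: a set of `3n` points that is not `Bad` can be cut into triangles by
successive lines (`Guillotine`). The proof is by induction on `n`. If some line contains at least
`2n - 1` of the points, the cuts are found by turning a line about suitable points of it
(`guillotine_or_bad_of_line`); the only obstruction is a `Fan`, which is itself too large an
independent set.

Otherwise suppose that every triangle that a line cuts off leaves a bad set. A noncollinear
independent set `S` of `X` satisfies `3|S| ≤ |X| + 3` (`card_bound`), and since no line is rich the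
witnesses of badness are noncollinear, so they attain this bound (`Tight`). Such extremal sets are
rigid: they lie on the boundary of the hull, contain its corners and alternate with the other points
along each edge. Hence there is at most one of them (`Tight.eq_alternate`), and each edge has an odd
number of points (`Tight.odd_face`). Parity shows that a corner together with its two neighbours on
the hull can always be cut off (`CutsTight.corner_cutTriangle`). Let `u`, `v` be the ends of a hull
edge, and `S`, `S'` the tight sets that are left when the ears at `u` and at `v` are cut off. By
uniqueness `S` without `v` equals `S'` without `u` (`erase_eq_erase`); so `S` together with `u` is
independent, and it is too large for `X` (`CutsTight.bad`).

The algorithm rests on the same rigidity. Badness is tested by looking for a rich line through two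
of the points and by checking the single candidate `alternate X` (`badTest_iff`). A cut may be taken
along a line through two of the points (`Sep.exists_side`), so there are only polynomially many cuts
to try. The program labels the pieces and makes any cut that leaves two pieces which are not bad and
have sizes divisible by three; a piece of more than three points always admits one
(`exists_side_of_not_bad`). The running time is obtained compositionally: the predicates `Dcd` and
`Does` are closed under connectives, bounded counting, assignments and loops. -/

namespace TrianglePartition
open scoped Classical

/-! ### Linear functionals as coordinates, and open segments -/

/-- Linear functionals on the plane. -/
abbrev Functional : Type := Plane →ₗ[ℝ] ℝ

theorem functional_apply (g : Functional) (z : Plane) :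
    g z = z 0 * g (EuclideanSpace.single 0 1) + z 1 * g (EuclideanSpace.single 1 1) := by
  have h : z = z 0 • EuclideanSpace.single 0 1 + z 1 • EuclideanSpace.single 1 1 := by
    ext i; fin_cases i <;> simp
  conv_lhs => rw [h]
  simp

/-- The functional with the given coefficients. -/
def ofCoeffs (a b : ℝ) : Functional where
  toFun z := a * z 0 + b * z 1
  map_add' x y := by simp; ring
  map_smul' c x := by simp; ring

@[simp] theorem ofCoeffs_apply (a b : ℝ) (z : Plane) : ofCoeffs a b z = a * z 0 + b * z 1 := rfl

theorem functional_eq_ofCoeffs (g : Functional) : ∃ a b : ℝ, ∀ z, g z = a * z 0 + b * z 1 :=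
  ⟨g (EuclideanSpace.single 0 1), g (EuclideanSpace.single 1 1), fun z => by
    rw [functional_apply]; ring⟩

/-- Two functionals with no common nonzero zero. -/
def Independent (g f : Functional) : Prop := ∀ z, g z = 0 → f z = 0 → z = 0

theorem Independent.symm {g f : Functional} (h : Independent g f) : Independent f g :=
  fun z h1 h2 => h z h2 h1

theorem Independent.eq {g f : Functional} (h : Independent g f) {x y : Plane}
    (hg : g x = g y) (hf : f x = f y) : x = y :=
  sub_eq_zero.1 (h _ (by simp [hg]) (by simp [hf]))

theorem exists_ne_zero {g : Functional} (hg : g ≠ 0) : ∃ z, g z ≠ 0 := by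
  by_contra! h
  exact hg (LinearMap.ext h)

theorem plane_eq_zero {z : Plane} (h0 : z 0 = 0) (h1 : z 1 = 0) : z = 0 := by
  ext i; fin_cases i <;> simp [h0, h1]

/-- The kernel of a nonzero `g` is the line spanned by `d`, and `f` does not vanish on it. In
coordinates this is a nonzero determinant. -/
theorem independent_of {g f : Functional} (hg : g ≠ 0) {d : Plane} (hgd : g d = 0)
    (hfd : f d ≠ 0) : Independent g f := by
  intro z h1 h2
  obtain ⟨a, b, hab⟩ := functional_eq_ofCoeffs g
  obtain ⟨a', b', hab'⟩ := functional_eq_ofCoeffs f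
  obtain ⟨w, hw⟩ := exists_ne_zero hg
  rw [hab] at h1 hgd hw
  rw [hab'] at h2 hfd
  have hdet : a * b' - b * a' ≠ 0 := by
    intro h
    apply hfd
    by_cases ha : a = 0
    · have hb : b ≠ 0 := by rintro rfl; simp [ha] at hw
      have e1 : d 1 = 0 := by simpa [ha, hb] using hgd
      have e2 : a' = 0 := by simpa [ha, hb] using h
      simp [e1, e2]
    · have e : a * (a' * d 0 + b' * d 1) = 0 := by linear_combination a' * hgd + d 1 * h
      exact (mul_eq_zero.1 e).resolve_left ha
  apply plane_eq_zero
  · have : (a * b' - b * a') * z 0 = 0 := by linear_combination b' * h1 - b * h2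
    exact (mul_eq_zero.1 this).resolve_left hdet
  · have : (a * b' - b * a') * z 1 = 0 := by linear_combination a * h2 - a' * h1
    exact (mul_eq_zero.1 this).resolve_left hdet

theorem Independent.left_ne_zero {g f : Functional} (h : Independent g f) : g ≠ 0 := by
  rintro rfl
  obtain ⟨a, b, hab⟩ := functional_eq_ofCoeffs f
  have h1 := h (!₂[-b, a]) (by simp) (by rw [hab]; simp; ring)
  have h2 := h (!₂[1, 0]) (by simp)
  have ha : a = 0 := by simpa using congrArg (fun z : Plane => z 1) h1
  have h3 := h2 (by rw [hab]; simp [ha])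
  simpa using congrArg (fun z : Plane => z 0) h3

theorem Independent.right_ne_zero {g f : Functional} (h : Independent g f) : f ≠ 0 :=
  h.symm.left_ne_zero

theorem exists_independent {g : Functional} (hg : g ≠ 0) : ∃ f, Independent g f := by
  obtain ⟨a, b, hab⟩ := functional_eq_ofCoeffs g
  refine ⟨ofCoeffs (-b) a, independent_of hg (d := !₂[-b, a]) (by rw [hab]; simp; ring) ?_⟩
  intro h
  simp at h
  have ha : a = 0 := by nlinarith [sq_nonneg a, sq_nonneg b]
  have hb : b = 0 := by nlinarith [sq_nonneg a, sq_nonneg b]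
  exact hg (LinearMap.ext fun z => by rw [hab]; simp [ha, hb])

/-- Functionals which agree at two distinct points are proportional. -/
theorem proportional {g k : Functional} {a b : Plane} (hab : a ≠ b) (hg : g a = g b)
    (hk : k a = k b) (x y : Plane) :
    (g x - g a) * (k y - k a) = (g y - g a) * (k x - k a) := by
  by_cases hg0 : g = 0
  · simp [hg0]
  by_cases h : k y - k a = 0 ∧ k x - k a = 0
  · rw [h.1, h.2]; simp
  by_contra hne
  -- The chosen vector is in the kernel of `g`, and `k` vanishes on it exactly if the identity
  -- holds.
  have hi : Independent g k := by
    refine independent_of hg0 (d := (g x - g a) • (y - a) - (g y - g a) • (x - a)) ?_ ?_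
    · simp; ring
    · simp; intro h; apply hne; linarith
  exact hab (hi.eq hg hk)

/-- Only finitely many directions `(1, t)` take equal values at two points of `X`. Such a functional
orders the points along every line and breaks ties. -/
theorem exists_injOn (X : Finset Plane) : ∃ f : Functional, Set.InjOn f X := by
  obtain ⟨t, ht⟩ := Infinite.exists_notMem_finset
    ((X ×ˢ X).image fun p => -(p.1 0 - p.2 0) / (p.1 1 - p.2 1))
  refine ⟨ofCoeffs 1 t, fun p hp q hq h => ?_⟩
  simp at h
  by_cases h1 : p 1 - q 1 = 0
  · have : p 1 = q 1 := by linarith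
    have h0 : p 0 = q 0 := by rw [this] at h; linarith
    ext i; fin_cases i <;> simpa
  · exfalso
    apply ht
    simp only [Finset.mem_image, Finset.mem_product, Prod.exists]
    refine ⟨p, q, ⟨hp, hq⟩, ?_⟩
    rw [div_eq_iff h1]; linarith

theorem functional_openSegment {p q z : Plane} (hz : z ∈ openSegment ℝ p q) :
    ∃ a b : ℝ, 0 < a ∧ 0 < b ∧ a + b = 1 ∧ ∀ g : Functional, g z = a * g p + b * g q := by
  obtain ⟨a, b, ha, hb, hab, rfl⟩ := hz
  exact ⟨a, b, ha, hb, hab, fun g => by simp⟩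

/-- An average of two numbers `≥ c` with positive weights is `≤ c` only if both equal `c`: a
supporting line through an inner point of a segment contains its ends. Hence points on hull edges
only block pairs on the same edge. -/
theorem eq_of_mem_openSegment_of_le {p q z : Plane} (hz : z ∈ openSegment ℝ p q) {g : Functional}
    {c : ℝ} (hp : c ≤ g p) (hq : c ≤ g q) (h : g z ≤ c) : g p = c ∧ g q = c := by
  obtain ⟨a, b, ha, hb, hab, hg⟩ := functional_openSegment hz
  rw [hg] at h
  have h1 : a * (g p - c) + b * (g q - c) ≤ 0 := by
    have : a * (g p - c) + b * (g q - c) = a * g p + b * g q - (a + b) * c := by ring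
    rw [this, hab]; linarith
  have h2 := mul_nonneg ha.le (sub_nonneg.2 hp)
  have h3 := mul_nonneg hb.le (sub_nonneg.2 hq)
  constructor
  · have : a * (g p - c) = 0 := by linarith
    linarith [(mul_eq_zero.1 this).resolve_left ha.ne']
  · have : b * (g q - c) = 0 := by linarith
    linarith [(mul_eq_zero.1 this).resolve_left hb.ne']

theorem eq_of_mem_openSegment {p q z : Plane} (hz : z ∈ openSegment ℝ p q) {g : Functional}
    {c : ℝ} (hp : g p = c) (hq : g q = c) : g z = c := by
  obtain ⟨a, b, ha, hb, hab, hg⟩ := functional_openSegment hz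
  rw [hg, hp, hq, ← add_mul, hab, one_mul]

theorem lt_of_mem_openSegment {p q z : Plane} (hz : z ∈ openSegment ℝ p q) {g : Functional}
    (h : g p < g q) : g p < g z ∧ g z < g q := by
  obtain ⟨a, b, ha, hb, hab, hg⟩ := functional_openSegment hz
  rw [hg]
  obtain rfl : a = 1 - b := by linarith
  constructor <;> nlinarith

theorem lt_of_mem_openSegment_of_lt {p q z : Plane} (hz : z ∈ openSegment ℝ p q) {g : Functional}
    {c : ℝ} (hp : c < g p) (hq : c < g q) : c < g z := by
  obtain ⟨a, b, ha, hb, hab, hg⟩ := functional_openSegment hz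
  rw [hg]
  obtain rfl : a = 1 - b := by linarith
  nlinarith

theorem le_of_mem_openSegment_of_le {p q z : Plane} (hz : z ∈ openSegment ℝ p q) {g : Functional}
    {c : ℝ} (hp : c ≤ g p) (hq : c ≤ g q) : c ≤ g z := by
  obtain ⟨a, b, ha, hb, hab, hg⟩ := functional_openSegment hz
  rw [hg]
  obtain rfl : a = 1 - b := by linarith
  nlinarith

theorem mem_openSegment_swap {p q z : Plane} (hz : z ∈ openSegment ℝ p q) :
    z ∈ openSegment ℝ q p := by rwa [openSegment_symm]

theorem ne_of_mem_openSegment {p q z : Plane} (hz : z ∈ openSegment ℝ p q) (hpq : p ≠ q) :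
    z ≠ p ∧ z ≠ q := by
  obtain ⟨f, hf⟩ := exists_injOn {p, q}
  have hne : f p ≠ f q := fun h => hpq (hf (by simp) (by simp) h)
  rcases hne.lt_or_gt with h | h
  · have := lt_of_mem_openSegment hz h
    exact ⟨fun e => by rw [e] at this; exact lt_irrefl _ this.1,
      fun e => by rw [e] at this; exact lt_irrefl _ this.2⟩
  · have := lt_of_mem_openSegment (mem_openSegment_swap hz) h
    exact ⟨fun e => by rw [e] at this; exact lt_irrefl _ this.2,
      fun e => by rw [e] at this; exact lt_irrefl _ this.1⟩

/-- On a line a functional which is strictly between its values at two points is taken between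
them. -/
theorem mem_openSegment_of {g f : Functional} (hg : g ≠ 0) {a b y : Plane} (hab : g a = g b)
    (hy : g y = g a) (h1 : f a < f y) (h2 : f y < f b) : y ∈ openSegment ℝ a b := by
  have hi : Independent g f := independent_of hg (d := b - a) (by simp [hab])
    (by simp; linarith)
  have hd : f b - f a ≠ 0 := by linarith
  refine ⟨(f b - f y) / (f b - f a), (f y - f a) / (f b - f a), ?_, ?_, ?_, ?_⟩
  · exact div_pos (by linarith) (by linarith)
  · exact div_pos (by linarith) (by linarith)
  · field_simp; ring
  · apply hi.eq
    · simp [hy, ← hab]; field_simp; ring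
    · simp; field_simp; ring

/-! ### Collinear and separated sets -/

/-- The points of `S` lie on a line. -/
def Col (S : Finset Plane) : Prop :=
  ∃ g : Functional, g ≠ 0 ∧ ∃ c, ∀ p ∈ S, g p = c

theorem Col.mono {S T : Finset Plane} (h : Col T) (hST : S ⊆ T) : Col S := by
  obtain ⟨g, hg, c, hc⟩ := h
  exact ⟨g, hg, c, fun p hp => hc p (hST hp)⟩

theorem exists_functional_eq (a b : Plane) : ∃ g : Functional, g ≠ 0 ∧ g a = g b := by
  by_cases h : a = b
  · refine ⟨ofCoeffs 1 0, fun h0 => ?_, by rw [h]⟩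
    simpa using LinearMap.congr_fun h0 (!₂[1, 0])
  · refine ⟨ofCoeffs (b 1 - a 1) (a 0 - b 0), fun h0 => h ?_, by simp; ring⟩
    have h1 := LinearMap.congr_fun h0 (!₂[1, 0])
    have h2 := LinearMap.congr_fun h0 (!₂[0, 1])
    simp at h1 h2
    ext i; fin_cases i
    · simp; linarith
    · simp; linarith

theorem col_pair (a b : Plane) : Col {a, b} := by
  obtain ⟨g, hg, h⟩ := exists_functional_eq a b
  exact ⟨g, hg, g a, by simp [h]⟩

theorem col_of_card_le_two {S : Finset Plane} (h : S.card ≤ 2) : Col S := by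
  obtain h | h | h : S.card = 0 ∨ S.card = 1 ∨ S.card = 2 := by omega
  · rw [Finset.card_eq_zero.1 h]; exact (col_pair 0 0).mono (by simp)
  · obtain ⟨a, rfl⟩ := Finset.card_eq_one.1 h
    exact (col_pair a a).mono (by simp)
  · obtain ⟨a, b, -, rfl⟩ := Finset.card_eq_two.1 h
    exact col_pair a b

theorem not_col_triple {g : Functional} {a b u : Plane} (hab : a ≠ b)
    (hg : g a = g b) (hu : g u ≠ g a) : ¬ Col {u, a, b} := by
  rintro ⟨k, hk, c, hc⟩
  have ha := hc a (by simp)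
  have hb := hc b (by simp)
  have hu' := hc u (by simp)
  obtain ⟨w, hw⟩ := exists_ne_zero hk
  have := proportional hab hg (ha.trans hb.symm) u (a + w)
  simp [ha, hu', hw] at this
  exact hu (by linarith)

/-- Strict separation by a line. -/
def Sep (A B : Finset Plane) : Prop :=
  ∃ (f : Functional) (c : ℝ), (∀ a ∈ A, f a < c) ∧ ∀ b ∈ B, c < f b

theorem Sep.symm {A B : Finset Plane} (h : Sep A B) : Sep B A := by
  obtain ⟨f, c, h1, h2⟩ := h
  exact ⟨-f, -c, fun b hb => by simpa using h2 b hb, fun a ha => by simpa using h1 a ha⟩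

theorem Sep.disjoint {A B : Finset Plane} (h : Sep A B) : Disjoint A B := by
  obtain ⟨f, c, h1, h2⟩ := h
  exact Finset.disjoint_left.2 fun a ha hb => lt_asymm (h1 a ha) (h2 a hb)

theorem exists_between_finsets (A B : Finset Plane) (F : Plane → ℝ)
    (h : ∀ a ∈ A, ∀ b ∈ B, F a < F b) : ∃ c, (∀ a ∈ A, F a < c) ∧ ∀ b ∈ B, c < F b := by
  rcases A.eq_empty_or_nonempty with rfl | hA
  · rcases B.eq_empty_or_nonempty with rfl | hB
    · exact ⟨0, by simp⟩
    · obtain ⟨b, hb, hmin⟩ := B.exists_min_image F hB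
      exact ⟨F b - 1, by simp, fun b' hb' => by linarith [hmin b' hb']⟩
  · obtain ⟨a, ha, hmax⟩ := A.exists_max_image F hA
    rcases B.eq_empty_or_nonempty with rfl | hB
    · exact ⟨F a + 1, fun a' ha' => by linarith [hmax a' ha'], by simp⟩
    · obtain ⟨b, hb, hmin⟩ := B.exists_min_image F hB
      have := h a ha b hb
      exact ⟨(F a + F b) / 2, fun a' ha' => by linarith [hmax a' ha'],
        fun b' hb' => by linarith [hmin b' hb']⟩

/-- Separation by a line, with ties broken along the line, can be made strict. -/
theorem sep_of_lex {A B : Finset Plane} (k ψ : Functional)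
    (h : ∀ a ∈ A, ∀ b ∈ B, k a < k b ∨ (k a = k b ∧ ψ a < ψ b)) : Sep A B := by
  -- A strict inequality for `k` survives a small perturbation by `ψ`, and a tie is decided by `ψ`
  -- as soon as `ε > 0`.
  have key : ∀ᶠ ε in nhdsWithin (0 : ℝ) (Set.Ioi 0), ∀ p ∈ A ×ˢ B,
      (k + ε • ψ) p.1 < (k + ε • ψ) p.2 := by
    rw [Filter.eventually_all_finset]
    rintro ⟨a, b⟩ hp
    rw [Finset.mem_product] at hp
    rcases h a hp.1 b hp.2 with h1 | ⟨h1, h2⟩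
    · have hc : Filter.Tendsto (fun ε : ℝ => (k b + ε * ψ b) - (k a + ε * ψ a))
          (nhdsWithin 0 (Set.Ioi 0)) (nhds (k b - k a)) := by
        have : Continuous (fun ε : ℝ => (k b + ε * ψ b) - (k a + ε * ψ a)) := by fun_prop
        have := this.tendsto 0
        simp at this
        exact this.mono_left nhdsWithin_le_nhds
      filter_upwards [hc.eventually (lt_mem_nhds (sub_pos.2 h1))] with ε hε
      simpa using hε
    · filter_upwards [self_mem_nhdsWithin] with ε hε
      have : (0 : ℝ) < ε := hε
      simp [h1]; nlinarith
  obtain ⟨ε, hε⟩ := key.exists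
  obtain ⟨c, h1, h2⟩ := exists_between_finsets A B (fun x => (k + ε • ψ) x)
    (fun a ha b hb => hε (a, b) (Finset.mk_mem_product ha hb))
  exact ⟨k + ε • ψ, c, h1, h2⟩

/-! ### Independent sets -/

/-- `S` is a subset of `X` and any two of its points have a point of `X` between them. -/
def Indep (X S : Finset Plane) : Prop :=
  S ⊆ X ∧ ∀ p ∈ S, ∀ q ∈ S, p ≠ q → ∃ z ∈ X, z ∈ openSegment ℝ p q

/-- Too large an independent set. -/
def Bad (X : Finset Plane) : Prop :=
  ∃ S, Indep X S ∧ X.card + 3 ≤ 3 * S.card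

theorem Indep.mono {X S S' : Finset Plane} (h : Indep X S) (hS : S' ⊆ S) : Indep X S' :=
  ⟨hS.trans h.1, fun p hp q hq => h.2 p (hS hp) q (hS hq)⟩

theorem Indep.sdiff {X S S' D : Finset Plane} (h : Indep X S) (hS : S' ⊆ S)
    (hd : Disjoint S' D) (hb : ∀ d ∈ D, ∀ p ∈ S', ∀ q ∈ S', p ≠ q → d ∉ openSegment ℝ p q) :
    Indep (X \ D) S' := by
  refine ⟨fun p hp => Finset.mem_sdiff.2 ⟨h.1 (hS hp), Finset.disjoint_left.1 hd hp⟩, ?_⟩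
  intro p hp q hq hpq
  obtain ⟨z, hz, hzs⟩ := h.2 p (hS hp) q (hS hq) hpq
  exact ⟨z, Finset.mem_sdiff.2 ⟨hz, fun hzd => hb z hzd p hp q hq hpq hzs⟩, hzs⟩

/-- Walk along the line in the direction of a generic `f`. The first point `v` of `S` and a blocker
`q` between it and the next point `s` can be deleted, since the rest of `S` starts at `s`: each step
costs one point of `S` and two of the line. -/
theorem card_le_of_line {g : Functional} {c : ℝ} : ∀ (m : ℕ) (X S : Finset Plane), S.card = m →
    Indep X S → S.Nonempty → (∀ p ∈ S, g p = c) → 2 * S.card ≤ {x ∈ X | g x = c}.card + 1 := by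
  intro m
  induction m with
  | zero => intro X S h0 _ hne; simp at h0; simp [h0] at hne
  | succ m ih =>
    intro X S hm h hne hline
    obtain ⟨f, hf⟩ := exists_injOn X
    obtain ⟨v, hv, hmin⟩ := S.exists_min_image f hne
    have hvX : v ∈ {x ∈ X | g x = c} := by simp [h.1 hv, hline v hv]
    by_cases hm0 : m = 0
    · have : 0 < {x ∈ X | g x = c}.card := Finset.card_pos.2 ⟨v, hvX⟩
      omega
    have hcard : (S.erase v).card = m := by rw [Finset.card_erase_of_mem hv]; omega
    have hne' : (S.erase v).Nonempty := Finset.card_pos.1 (by omega)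
    obtain ⟨s, hs, hsmin⟩ := (S.erase v).exists_min_image f hne'
    have hs' := Finset.mem_erase.1 hs
    have hlt : ∀ y ∈ S.erase v, f v < f y := fun y hy => by
      have hy' := Finset.mem_erase.1 hy
      exact lt_of_le_of_ne (hmin y hy'.2) fun e => hy'.1 (hf (h.1 hy'.2) (h.1 hv) e.symm)
    obtain ⟨q, hq, hqs⟩ := h.2 v hv s hs'.2 hs'.1.symm
    have hqf := lt_of_mem_openSegment hqs (hlt s hs)
    have hqX : q ∈ {x ∈ X | g x = c} := by
      simp [hq, eq_of_mem_openSegment hqs (hline v hv) (hline s hs'.2)]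
    have hqS : q ∉ S.erase v := fun hh => absurd (hsmin q hh) (not_le.2 hqf.2)
    have hvq : v ≠ q := fun e => by rw [← e] at hqf; exact lt_irrefl _ hqf.1
    have key : Indep (X \ {v, q}) (S.erase v) := by
      refine h.sdiff (Finset.erase_subset _ _) ?_ ?_
      · rw [Finset.disjoint_right]; intro x hx
        simp at hx
        rcases hx with rfl | rfl
        · simp
        · exact hqS
      · intro d hd a ha b hb _ hdab
        have hd' : f d < f s := by
          simp at hd
          rcases hd with rfl | rfl
          · exact hlt s hs
          · exact hqf.2
        exact absurd (le_of_mem_openSegment_of_le hdab (hsmin a ha) (hsmin b hb)) (not_le.2 hd')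
    have := ih _ _ hcard key hne' (fun p hp => hline p (Finset.mem_of_mem_erase hp))
    have hsub : {x ∈ X \ {v, q} | g x = c} = {x ∈ X | g x = c} \ {v, q} := by
      ext x; simp; tauto
    rw [hsub, Finset.card_sdiff_of_subset (by
      intro x hx; simp only [Finset.mem_insert, Finset.mem_singleton] at hx
      rcases hx with rfl | rfl <;> assumption), Finset.card_pair hvq] at this
    have h2 : 2 ≤ {x ∈ X | g x = c}.card :=
      (Finset.card_pair hvq).symm.le.trans (Finset.card_le_card (by
        intro x hx; simp only [Finset.mem_insert, Finset.mem_singleton] at hx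
        rcases hx with rfl | rfl <;> assumption))
    omega

/-- The points of a line contain an independent set of at least half their number. -/
theorem exists_indep_of_line {g : Functional} (hg : g ≠ 0) {c : ℝ} {X : Finset Plane} :
    ∀ (m : ℕ) (L : Finset Plane), L.card = m → L ⊆ X → (∀ p ∈ L, g p = c) →
      ∃ S ⊆ L, Indep X S ∧ L.card ≤ 2 * S.card := by
  obtain ⟨f, hf⟩ := exists_injOn X
  intro m
  induction m using Nat.strong_induction_on with
  | _ m ih =>
    intro L hm hLX hline
    rcases L.eq_empty_or_nonempty with rfl | hne
    · exact ⟨∅, by simp, ⟨by simp, by simp⟩, by simp⟩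
    obtain ⟨v, hv, hmin⟩ := L.exists_min_image f hne
    have hlt : ∀ y ∈ L.erase v, f v < f y := fun y hy => by
      have hy' := Finset.mem_erase.1 hy
      exact lt_of_le_of_ne (hmin y hy'.2) fun e => hy'.1 (hf (hLX hy'.2) (hLX hv) e.symm)
    rcases (L.erase v).eq_empty_or_nonempty with he | hne'
    · refine ⟨{v}, by simpa using hv, ⟨by simpa using hLX hv, by simp⟩, ?_⟩
      have : (L.erase v).card = 0 := by rw [he]; rfl
      rw [Finset.card_erase_of_mem hv] at this
      simp; omega
    obtain ⟨w, hw, hwmin⟩ := (L.erase v).exists_min_image f hne'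
    have hw' := Finset.mem_erase.1 hw
    have hc1 : (L.erase v).card = m - 1 := by rw [Finset.card_erase_of_mem hv, hm]
    have hc2 : ((L.erase v).erase w).card = m - 2 := by
      rw [Finset.card_erase_of_mem hw, hc1]; omega
    have hm2 : 2 ≤ m := by
      have := Finset.card_pos.2 hne'; omega
    have hsub : (L.erase v).erase w ⊆ L :=
      (Finset.erase_subset _ _).trans (Finset.erase_subset _ _)
    obtain ⟨S, hSL, hS, hcard⟩ := ih (m - 2) (by omega) _ hc2 (hsub.trans hLX)
      (fun p hp => hline p (hsub hp))
    have hvS : v ∉ S := fun h => by simpa using hSL h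
    -- Every other point is chosen: the skipped point `w` separates `v` from all later ones.
    have hb : ∀ y ∈ S, w ∈ openSegment ℝ v y := by
      intro y hy
      have hy1 := Finset.mem_erase.1 (hSL hy)
      refine mem_openSegment_of hg ?_ ?_ (hlt w hw) ?_ (f := f)
      · rw [hline v hv, hline y (hsub (hSL hy))]
      · rw [hline v hv, hline w hw'.2]
      · exact lt_of_le_of_ne (hwmin y hy1.2) fun e =>
          hy1.1 (hf (hLX (hsub (hSL hy))) (hLX hw'.2) e.symm)
    refine ⟨insert v S, ?_, ⟨?_, ?_⟩, ?_⟩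
    · exact Finset.insert_subset hv (hSL.trans hsub)
    · exact Finset.insert_subset (hLX hv) hS.1
    · intro p hp q hq hpq
      rcases Finset.mem_insert.1 hp with hpv | hp <;> rcases Finset.mem_insert.1 hq with hqv | hq
      · exact absurd (hpv.trans hqv.symm) hpq
      · exact ⟨w, hLX hw'.2, hpv ▸ hb q hq⟩
      · exact ⟨w, hLX hw'.2, hqv ▸ mem_openSegment_swap (hb p hp)⟩
      · exact hS.2 p hp q hq hpq
    · rw [Finset.card_insert_of_notMem hvS]; omega

/-! ### Corners and edges of the convex hull -/

/-- `v` is the only point of `X` at which some functional is minimal. -/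
def Corner (X : Finset Plane) (v : Plane) : Prop :=
  v ∈ X ∧ ∃ f : Functional, ∀ y ∈ X, y ≠ v → f v < f y

/-- `g₁` and `g₂` are minimal at `v`, and constant on the two edges of the hull of `X` at `v`. -/
structure Frame (X : Finset Plane) (v : Plane) (g₁ g₂ : Functional) : Prop where
  mem : v ∈ X
  min₁ : ∀ y ∈ X, g₁ v ≤ g₁ y
  min₂ : ∀ y ∈ X, g₂ v ≤ g₂ y
  indep : Independent g₁ g₂
  ex₁ : ∃ y ∈ X, y ≠ v ∧ g₁ y = g₁ v
  ex₂ : ∃ y ∈ X, y ≠ v ∧ g₂ y = g₂ v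

/-- `p` is the neighbour of `v` on the edge on which `g₁` is constant. -/
structure Nearest (X : Finset Plane) (v : Plane) (g₁ g₂ : Functional) (p : Plane) : Prop where
  mem : p ∈ X
  ne : p ≠ v
  eq : g₁ p = g₁ v
  min : ∀ y ∈ X, y ≠ v → g₁ y = g₁ v → g₂ p ≤ g₂ y

theorem Frame.symm {X : Finset Plane} {v : Plane} {g₁ g₂ : Functional} (h : Frame X v g₁ g₂) :
    Frame X v g₂ g₁ := ⟨h.mem, h.min₂, h.min₁, h.indep.symm, h.ex₂, h.ex₁⟩

theorem Frame.lt {X : Finset Plane} {v : Plane} {g₁ g₂ : Functional} (h : Frame X v g₁ g₂)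
    {y : Plane} (hy : y ∈ X) (hne : y ≠ v) (heq : g₁ y = g₁ v) : g₂ v < g₂ y :=
  lt_of_le_of_ne (h.min₂ y hy) fun e => hne (h.indep.eq heq e.symm)

theorem Frame.exists_nearest {X : Finset Plane} {v : Plane} {g₁ g₂ : Functional}
    (h : Frame X v g₁ g₂) : ∃ p, Nearest X v g₁ g₂ p := by
  obtain ⟨y, hy, hne, heq⟩ := h.ex₁
  obtain ⟨p, hp, hmin⟩ := {x ∈ X | x ≠ v ∧ g₁ x = g₁ v}.exists_min_image g₂
    ⟨y, by simp [hy, hne, heq]⟩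
  simp only [Finset.mem_filter] at hp
  exact ⟨p, hp.1, hp.2.1, hp.2.2, fun y hy h1 h2 => hmin y (by simp [hy, h1, h2])⟩

theorem Frame.corner {X : Finset Plane} {v : Plane} {g₁ g₂ : Functional}
    (h : Frame X v g₁ g₂) : Corner X v := by
  refine ⟨h.mem, g₁ + g₂, fun y hy hne => ?_⟩
  have h1 := h.min₁ y hy
  have h2 := h.min₂ y hy
  rcases h1.lt_or_eq with h3 | h3
  · simp; linarith
  · have := h.lt hy hne h3.symm
    simp; linarith

theorem corner_of_lex {X : Finset Plane} {v : Plane} (hv : v ∈ X) (k ψ : Functional)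
    (h : ∀ y ∈ X, y ≠ v → k v < k y ∨ (k v = k y ∧ ψ v < ψ y)) : Corner X v := by
  obtain ⟨f, c, h1, h2⟩ := sep_of_lex (A := {v}) (B := X.erase v) k ψ (by
    intro a ha b hb
    rw [Finset.mem_singleton] at ha
    subst ha
    exact h b (Finset.mem_of_mem_erase hb) (Finset.ne_of_mem_erase hb))
  exact ⟨hv, f, fun y hy hne => (h1 v (by simp)).trans (h2 y (Finset.mem_erase.2 ⟨hne, hy⟩))⟩

theorem independent_sub_smul {g φ : Functional} (h : Independent g φ) (s : ℝ) :
    Independent g (φ - s • g) := fun z h1 h2 => h z h1 (by simpa [h1] using h2)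

/-- Rotating a supporting line about the end of a face gives the next edge. -/
theorem exists_next_edge {X : Finset Plane} {v : Plane} {g φ : Functional}
    (hmin : ∀ y ∈ X, g v ≤ g y) (hφ : ∀ y ∈ X, y ≠ v → g y = g v → φ v < φ y)
    (hoff : ∃ y ∈ X, g v < g y) :
    ∃ s : ℝ, (∀ y ∈ X, (φ - s • g) v ≤ (φ - s • g) y) ∧
      ∃ y ∈ X, y ≠ v ∧ (φ - s • g) y = (φ - s • g) v := by
  obtain ⟨y₁, hy₁, hlt₁⟩ := hoff
  -- The least quotient belongs to the first point met by the turning line, so `φ - s • g` is still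
  -- minimal at `v`.
  obtain ⟨y₀, hy₀, hmin₀⟩ := {x ∈ X | g v < g x}.exists_min_image
    (fun y => (φ y - φ v) / (g y - g v)) ⟨y₁, by simp [hy₁, hlt₁]⟩
  simp only [Finset.mem_filter] at hy₀ hmin₀
  refine ⟨(φ y₀ - φ v) / (g y₀ - g v), fun y hy => ?_, y₀, hy₀.1, ?_, ?_⟩
  · rcases (hmin y hy).lt_or_eq with h | h
    · have h1 := hmin₀ y ⟨hy, h⟩
      rw [le_div_iff₀ (sub_pos.2 h)] at h1
      simp; linarith
    · by_cases hyv : y = v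
      · rw [hyv]
      · have := hφ y hy hyv h.symm
        simp [← h]; exact this.le
  · rintro rfl; exact lt_irrefl _ hy₀.2
  · have := sub_pos.2 hy₀.2
    simp; field_simp; ring

theorem exists_frame {X : Finset Plane} {v : Plane} (hv : Corner X v) (hX : ¬ Col X) :
    ∃ g₁ g₂, Frame X v g₁ g₂ := by
  obtain ⟨hvX, f, hf⟩ := hv
  obtain ⟨y, hy, hyv⟩ : ∃ y ∈ X, y ≠ v := by
    by_contra! h
    exact hX ((col_pair v v).mono fun y hy => by simp [h y hy])
  have hf0 : f ≠ 0 := by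
    rintro rfl
    simpa using hf y hy hyv
  obtain ⟨φ, hφ⟩ := exists_independent hf0
  have hminf : ∀ y ∈ X, f v ≤ f y := fun y hy => by
    by_cases h : y = v
    · rw [h]
    · exact (hf y hy h).le
  -- Turning a line that touches `X` only in `v` gives one edge; turning on from this edge, with `f`
  -- to break ties on it, gives the other.
  obtain ⟨s, hs1, hs2⟩ := exists_next_edge (φ := φ) hminf
    (fun y hy hne he => absurd he (hf y hy hne).ne') ⟨y, hy, hf y hy hyv⟩
  have hi := independent_sub_smul hφ s
  have hoff : ∃ y ∈ X, (φ - s • f) v < (φ - s • f) y := by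
    by_contra! h
    exact hX ⟨_, hi.right_ne_zero, _, fun p hp => le_antisymm (h p hp) (hs1 p hp)⟩
  obtain ⟨t, ht1, ht2⟩ := exists_next_edge (φ := f) hs1
    (fun y hy hne he => hf y hy hne) hoff
  exact ⟨_, _, hvX, hs1, ht1, independent_sub_smul hi.symm t, hs2, ht2⟩

theorem exists_corner {X : Finset Plane} (hX : X.Nonempty) : ∃ v, Corner X v := by
  obtain ⟨f, hf⟩ := exists_injOn X
  obtain ⟨v, hv, hmin⟩ := X.exists_min_image f hX
  exact ⟨v, hv, f, fun y hy hne => lt_of_le_of_ne (hmin y hy) fun e => hne (hf hy hv e.symm)⟩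

theorem exists_corner_ne {X : Finset Plane} (hX : 2 ≤ X.card) (s : Plane) :
    ∃ v, Corner X v ∧ v ≠ s := by
  obtain ⟨f, hf⟩ := exists_injOn X
  have hne : X.Nonempty := Finset.card_pos.1 (by omega)
  obtain ⟨v, hv, hmin⟩ := X.exists_min_image f hne
  obtain ⟨w, hw, hmax⟩ := X.exists_max_image f hne
  by_cases hvs : v = s
  · refine ⟨w, ⟨hw, -f, fun y hy hne => ?_⟩, ?_⟩
    · simpa using lt_of_le_of_ne (hmax y hy) fun e => hne (hf hy hw e)
    · rintro rfl
      obtain ⟨a, ha, b, hb, hab⟩ := Finset.one_lt_card.1 (show 1 < X.card by omega)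
      apply hab
      rw [hvs] at hmin
      exact hf ha hb ((le_antisymm (hmax a ha) (hmin a ha)).trans
        (le_antisymm (hmax b hb) (hmin b hb)).symm)
  · exact ⟨v, ⟨hv, f, fun y hy hne => lt_of_le_of_ne (hmin y hy) fun e =>
      hne (hf hy hv e.symm)⟩, hvs⟩

theorem Corner.not_mem_openSegment {X : Finset Plane} {v a b : Plane} (hv : Corner X v)
    (ha : a ∈ X) (hb : b ∈ X) (hav : a ≠ v) (hbv : b ≠ v) : v ∉ openSegment ℝ a b := by
  obtain ⟨-, f, hf⟩ := hv
  exact fun h => lt_irrefl _ (lt_of_mem_openSegment_of_lt h (hf a ha hav) (hf b hb hbv))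

/-- A point of an edge which lies before the neighbour of the corner is not between two points. -/
theorem Nearest.not_mem_openSegment {X : Finset Plane} {v p q a b : Plane} {g₁ g₂ : Functional}
    (h : Frame X v g₁ g₂) (hp : Nearest X v g₁ g₂ p) (hq : g₁ q = g₁ v) (hqp : g₂ q ≤ g₂ p)
    (ha : a ∈ X) (hb : b ∈ X) (hav : a ≠ v) (hbv : b ≠ v) (hab : a ≠ b) :
    q ∉ openSegment ℝ a b := by
  intro hs
  obtain ⟨h1, h2⟩ := eq_of_mem_openSegment_of_le hs (h.min₁ a ha) (h.min₁ b hb) hq.le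
  obtain ⟨h3, h4⟩ := eq_of_mem_openSegment_of_le hs (hp.min a ha hav h1) (hp.min b hb hbv h2) hqp
  exact hab (h.indep.eq (h1.trans h2.symm) (h3.trans h4.symm))

/-! ### The bound for independent sets -/

/-- The blockers between a point and the points of a line are distinct. -/
theorem card_line_add_le {X S : Finset Plane} (h : Indep X S) {v : Plane} (hvS : v ∈ S)
    {g : Functional} {c : ℝ} (hgc : ∀ p ∈ S.erase v, g p = c) (hgv : g v ≠ c) :
    {x ∈ X | g x = c}.card + 1 + (S.erase v).card ≤ X.card := by
  have hz : ∀ s ∈ S.erase v, ∃ z ∈ X, z ∈ openSegment ℝ v s := fun s hs =>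
    h.2 v hvS s (Finset.mem_of_mem_erase hs) (Finset.ne_of_mem_erase hs).symm
  choose! z hzX hzs using hz
  have hzg : ∀ s ∈ S.erase v, g (z s) ≠ c ∧ g (z s) ≠ g v := by
    intro s hs
    rcases lt_or_gt_of_ne hgv with hlt | hlt
    · have := lt_of_mem_openSegment (hzs s hs) (g := g) (by rwa [hgc s hs])
      rw [hgc s hs] at this
      exact ⟨this.2.ne, this.1.ne'⟩
    · have := lt_of_mem_openSegment (mem_openSegment_swap (hzs s hs)) (g := g)
        (by rwa [hgc s hs])
      rw [hgc s hs] at this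
      exact ⟨this.1.ne', this.2.ne⟩
  -- The value of `g` at a blocker determines its weights on `v` and `s`, and then the blocker
  -- determines `s`.
  have hinj : Set.InjOn z (S.erase v) := by
    intro s hs s' hs' he
    obtain ⟨a, b, ha, hb, hab, h1⟩ := functional_openSegment (hzs s hs)
    obtain ⟨a', b', ha', hb', hab', h2⟩ := functional_openSegment (hzs s' hs')
    have e1 := h1 g
    have e2 := h2 g
    rw [hgc s hs] at e1
    rw [hgc s' hs'] at e2
    have haa : a = a' := by
      have h3 : (a - a') * (g v - c) = 0 := by
        have : b = 1 - a := by linarith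
        have : b' = 1 - a' := by linarith
        subst b; subst b'; rw [he] at e1; linarith
      linarith [(mul_eq_zero.1 h3).resolve_right (sub_ne_zero.2 hgv)]
    have hbb : b = b' := by linarith
    obtain ⟨f, hf⟩ := exists_injOn {s, s'}
    apply hf (by simp) (by simp)
    have e3 := h1 f
    rw [he, h2 f, ← haa, ← hbb] at e3
    have : b * (f s - f s') = 0 := by linarith
    linarith [(mul_eq_zero.1 this).resolve_left hb.ne']
  have himg : ((S.erase v).image z).card = (S.erase v).card := Finset.card_image_of_injOn hinj
  have hsub : ({x ∈ X | g x = c} ∪ {v}) ∪ (S.erase v).image z ⊆ X := by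
    intro x hx
    simp only [Finset.mem_union, Finset.mem_filter, Finset.mem_singleton,
      Finset.mem_image] at hx
    rcases hx with (hx | rfl) | ⟨s, hs, rfl⟩
    · exact hx.1
    · exact h.1 hvS
    · exact hzX s hs
  have hd1 : Disjoint {x ∈ X | g x = c} {v} := by
    simp [hgv]
  have hd2 : Disjoint ({x ∈ X | g x = c} ∪ {v}) ((S.erase v).image z) := by
    rw [Finset.disjoint_right]
    intro x hx hx'
    obtain ⟨s, hs, rfl⟩ := Finset.mem_image.1 hx
    simp only [Finset.mem_union, Finset.mem_filter, Finset.mem_singleton] at hx'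
    rcases hx' with hx' | hx'
    · exact (hzg s hs).1 hx'.2
    · exact (hzg s hs).2 (by rw [hx'])
  have := Finset.card_le_card hsub
  rw [Finset.card_union_of_disjoint hd2, Finset.card_union_of_disjoint hd1, himg,
    Finset.card_singleton] at this
  exact this

/-- Peel off a corner `v` of `S`. On each of the two edges of the hull of `S` at `v` there is a
blocker between `v` and the nearest point of `S`, and these blockers are not needed by other pairs,
so one point of `S` costs three of `X`. The peeling stops when the rest of `S` lies on a line. -/
theorem card_bound : ∀ (m : ℕ) (X S : Finset Plane), S.card = m → Indep X S → ¬ Col S →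
    3 * S.card ≤ X.card + 3 := by
  intro m
  induction m with
  | zero =>
    intro X S h0 _ _; omega
  | succ m ih =>
    intro X S hm h hcol
    have hne : S.Nonempty := Finset.card_pos.1 (by omega)
    obtain ⟨v, hv⟩ := exists_corner hne
    have hvS := hv.1
    have hcard : (S.erase v).card = m := by rw [Finset.card_erase_of_mem hvS]; omega
    by_cases hc : Col (S.erase v)
    · obtain ⟨g, hg, c, hgc⟩ := hc
      have hgv : g v ≠ c := fun e => hcol ⟨g, hg, c, fun p hp => by
        by_cases hpv : p = v
        · rw [hpv, e]
        · exact hgc p (Finset.mem_erase.2 ⟨hpv, hp⟩)⟩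
      by_cases hm0 : m = 0
      · exact absurd (col_of_card_le_two (by omega)) hcol
      -- The `m` points on the line force `2m - 1` points of `X` there; `v` and `m` distinct
      -- blockers off the line make `3m` in all.
      have hline := card_le_of_line m X (S.erase v) hcard
        (h.mono (Finset.erase_subset _ _)) (Finset.card_pos.1 (by omega)) hgc
      have := card_line_add_le h hvS hgc hgv
      omega
    · obtain ⟨g₁, g₂, hF⟩ := exists_frame hv hcol
      obtain ⟨s₁, hs₁⟩ := hF.exists_nearest
      obtain ⟨s₂, hs₂⟩ := hF.symm.exists_nearest
      obtain ⟨q₁, hq₁, hq₁s⟩ := h.2 v hvS s₁ hs₁.mem hs₁.ne.symm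
      obtain ⟨q₂, hq₂, hq₂s⟩ := h.2 v hvS s₂ hs₂.mem hs₂.ne.symm
      have e1 := eq_of_mem_openSegment hq₁s rfl hs₁.eq
      have e2 := eq_of_mem_openSegment hq₂s rfl hs₂.eq
      have l1 := lt_of_mem_openSegment hq₁s (hF.lt hs₁.mem hs₁.ne hs₁.eq)
      have l2 := lt_of_mem_openSegment hq₂s (hF.symm.lt hs₂.mem hs₂.ne hs₂.eq)
      have hvq₁ : v ≠ q₁ := fun e => by rw [← e] at l1; exact lt_irrefl _ l1.1
      have hvq₂ : v ≠ q₂ := fun e => by rw [← e] at l2; exact lt_irrefl _ l2.1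
      have hq₁₂ : q₁ ≠ q₂ := fun e => by rw [← e] at l2; rw [e1] at l2; exact lt_irrefl _ l2.1
      have hq₁S : q₁ ∉ S := fun hh => absurd (hs₁.min q₁ hh hvq₁.symm e1) (not_le.2 l1.2)
      have hq₂S : q₂ ∉ S := fun hh => absurd (hs₂.min q₂ hh hvq₂.symm e2) (not_le.2 l2.2)
      have hD : ({v, q₁, q₂} : Finset Plane) ⊆ X := by
        intro x hx
        simp only [Finset.mem_insert, Finset.mem_singleton] at hx
        rcases hx with rfl | rfl | rfl
        · exact h.1 hvS
        · exact hq₁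
        · exact hq₂
      have hDc : ({v, q₁, q₂} : Finset Plane).card = 3 :=
        Finset.card_eq_three.2 ⟨v, q₁, q₂, hvq₁, hvq₂, hq₁₂, rfl⟩
      have key : Indep (X \ {v, q₁, q₂}) (S.erase v) := by
        refine h.sdiff (Finset.erase_subset _ _) ?_ ?_
        · rw [Finset.disjoint_right]; intro x hx hxS
          simp only [Finset.mem_insert, Finset.mem_singleton] at hx
          rcases hx with rfl | rfl | rfl
          · simp at hxS
          · exact hq₁S (Finset.mem_of_mem_erase hxS)
          · exact hq₂S (Finset.mem_of_mem_erase hxS)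
        · intro d hd a ha b hb hab
          have ha' := Finset.mem_erase.1 ha
          have hb' := Finset.mem_erase.1 hb
          simp only [Finset.mem_insert, Finset.mem_singleton] at hd
          rcases hd with rfl | rfl | rfl
          · exact hv.not_mem_openSegment ha'.2 hb'.2 ha'.1 hb'.1
          · exact hs₁.not_mem_openSegment hF e1 l1.2.le ha'.2 hb'.2 ha'.1 hb'.1 hab
          · exact hs₂.not_mem_openSegment hF.symm e2 l2.2.le ha'.2 hb'.2 ha'.1 hb'.1 hab
      have := ih _ _ hcard key hc
      rw [Finset.card_sdiff_of_subset hD, hDc] at this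
      have h3 := Finset.card_le_card hD
      omega

/-! ### Tight sets -/

/-- `S` is an independent set of `X` which attains the bound. -/
structure Tight (X S : Finset Plane) : Prop where
  indep : Indep X S
  not_col : ¬ Col S
  card : X.card + 3 ≤ 3 * S.card

theorem Tight.card_eq {X S : Finset Plane} (h : Tight X S) : 3 * S.card = X.card + 3 :=
  le_antisymm (card_bound _ _ _ rfl h.indep h.not_col) h.card

/-- Each other point of `X` is the only one between some two points of a tight set. -/
theorem Tight.critical {X S : Finset Plane} (h : Tight X S) {q : Plane} (hq : q ∈ X)
    (hqS : q ∉ S) : ∃ a ∈ S, ∃ b ∈ S, a ≠ b ∧ q ∈ openSegment ℝ a b ∧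
      ∀ z ∈ X, z ∈ openSegment ℝ a b → z = q := by
  by_contra! hcon
  -- If every pair blocked by `q` had another blocker, `S` would survive the deletion of `q` and
  -- exceed the bound by one.
  have : Indep (X.erase q) S := by
    refine ⟨fun s hs => Finset.mem_erase.2 ⟨fun e => hqS (e ▸ hs), h.indep.1 hs⟩, ?_⟩
    intro a ha b hb hab
    obtain ⟨z, hz, hzs⟩ := h.indep.2 a ha b hb hab
    by_cases hzq : z = q
    · obtain ⟨z', hz', hzs', hne⟩ := hcon a ha b hb hab (hzq ▸ hzs)
      exact ⟨z', Finset.mem_erase.2 ⟨hne, hz'⟩, hzs'⟩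
    · exact ⟨z, Finset.mem_erase.2 ⟨hzq, hz⟩, hzs⟩
  have h1 := card_bound _ _ _ rfl this h.not_col
  rw [Finset.card_erase_of_mem hq] at h1
  have h2 := h.card
  have h3 := Finset.card_pos.2 ⟨q, hq⟩
  omega

/-- Points outside a tight set are blockers, and a corner blocks nothing. -/
theorem Tight.corner_mem {X S : Finset Plane} (h : Tight X S) {v : Plane} (hv : Corner X v) :
    v ∈ S := by
  by_contra hvS
  obtain ⟨a, ha, b, hb, hab, hvab, -⟩ := h.critical hv.1 hvS
  exact hv.not_mem_openSegment (h.indep.1 ha) (h.indep.1 hb) (fun e => hvS (e ▸ ha))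
    (fun e => hvS (e ▸ hb)) hvab

/-- Along a face of the hull the points alternate between a tight set and its complement. -/
theorem Tight.mem_iff_even {X S : Finset Plane} (h : Tight X S) {f g : Functional} (hg : g ≠ 0)
    {c : ℝ} (hf : Set.InjOn f {y | y ∈ X ∧ g y = c}) (hmin : ∀ y ∈ X, c ≤ g y) :
    ∀ (m : ℕ) (x : Plane), {y ∈ X | g y = c ∧ f y < f x}.card = m → x ∈ X → g x = c →
      (x ∈ S ↔ Even {y ∈ X | g y = c ∧ f y < f x}.card) := by
  -- The pair for which `q` is the only blocker lies on the face too, because the face is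
  -- supporting.
  have hcrit : ∀ q ∈ X, g q = c → q ∉ S → ∃ a ∈ S, ∃ b ∈ S, a ∈ X ∧ b ∈ X ∧ g a = c ∧ g b = c ∧
      f a < f q ∧ f q < f b ∧ ∀ z ∈ X, z ∈ openSegment ℝ a b → z = q := by
    intro q hq hqc hqS
    obtain ⟨a, ha, b, hb, hab, hqab, huniq⟩ := h.critical hq hqS
    have haX := h.indep.1 ha
    have hbX := h.indep.1 hb
    obtain ⟨h1, h2⟩ := eq_of_mem_openSegment_of_le hqab (hmin a haX) (hmin b hbX) hqc.le
    have hne : f a ≠ f b := fun e => hab (hf ⟨haX, h1⟩ ⟨hbX, h2⟩ e)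
    rcases hne.lt_or_gt with hlt | hlt
    · have := lt_of_mem_openSegment hqab hlt
      exact ⟨a, ha, b, hb, haX, hbX, h1, h2, this.1, this.2, huniq⟩
    · have := lt_of_mem_openSegment (mem_openSegment_swap hqab) hlt
      exact ⟨b, hb, a, ha, hbX, haX, h2, h1, this.1, this.2, fun z hz hzs =>
        huniq z hz (mem_openSegment_swap hzs)⟩
  intro m
  induction m with
  | zero =>
    intro x hm hx hxc
    rw [hm]
    simp only [Even.zero, iff_true]
    by_contra hxS
    obtain ⟨a, ha, b, hb, haX, hbX, h1, h2, h3, h4, -⟩ := hcrit x hx hxc hxS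
    rw [Finset.card_eq_zero] at hm
    have : a ∈ ({y ∈ X | g y = c ∧ f y < f x} : Finset Plane) := by simp [haX, h1, h3]
    rw [hm] at this
    simp at this
  | succ m ih =>
    intro x hm hx hxc
    obtain ⟨y, hy, hmax⟩ := ({y ∈ X | g y = c ∧ f y < f x} : Finset Plane).exists_max_image f
      (Finset.card_pos.1 (by omega))
    have hy' := hy
    simp only [Finset.mem_filter] at hy' hmax
    obtain ⟨hyX, hyc, hyx⟩ := hy'
    have hbelow : ({z ∈ X | g z = c ∧ f z < f y} : Finset Plane) =
        ({z ∈ X | g z = c ∧ f z < f x} : Finset Plane).erase y := by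
      ext z
      simp only [Finset.mem_filter, Finset.mem_erase]
      constructor
      · rintro ⟨h1, h2, h3⟩
        exact ⟨fun e => by rw [e] at h3; exact lt_irrefl _ h3, h1, h2, h3.trans hyx⟩
      · rintro ⟨h0, h1, h2, h3⟩
        exact ⟨h1, h2, lt_of_le_of_ne (hmax z ⟨h1, h2, h3⟩) fun e =>
          h0 (hf ⟨h1, h2⟩ ⟨hyX, hyc⟩ e)⟩
    have hcard : {z ∈ X | g z = c ∧ f z < f y}.card = m := by
      rw [hbelow, Finset.card_erase_of_mem hy, hm]; rfl
    have hiy := ih y hcard hyX hyc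
    rw [hcard] at hiy
    rw [hm, Nat.even_add_one, ← hiy]
    constructor
    · intro hxS hyS
      obtain ⟨z, hz, hzs⟩ := h.indep.2 y hyS x hxS fun e => by
        rw [e] at hyx; exact lt_irrefl _ hyx
      have hzf := lt_of_mem_openSegment hzs hyx
      exact absurd (hmax z ⟨hz, eq_of_mem_openSegment hzs hyc hxc, hzf.2⟩) (not_le.2 hzf.1)
    -- If `y` and its successor `x` were both outside `S`, the pair whose only blocker is `y` would
    -- be blocked by `x` too.
    · intro hyS
      by_contra hxS
      obtain ⟨a, ha, b, hb, haX, hbX, h1, h2, h3, h4, huniq⟩ := hcrit y hyX hyc hyS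
      have hxb : f x < f b := by
        by_contra hle
        rcases (not_lt.1 hle).lt_or_eq with h5 | h5
        · exact absurd (hmax b ⟨hbX, h2, h5⟩) (not_le.2 h4)
        · exact hxS (hf ⟨hbX, h2⟩ ⟨hx, hxc⟩ h5 ▸ hb)
      have := huniq x hx (mem_openSegment_of hg (h1.trans h2.symm) (hxc.trans h1.symm)
        (h3.trans hyx) hxb)
      rw [this] at hyx
      exact lt_irrefl _ hyx

/-- Faces of the hull of a set which has a tight subset have an odd number of points. -/
theorem Tight.odd_face {X S : Finset Plane} (h : Tight X S) {g : Functional} (hg : g ≠ 0) {c : ℝ}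
    (hmin : ∀ y ∈ X, c ≤ g y) (hne : ∃ x ∈ X, g x = c) : Odd {y ∈ X | g y = c}.card := by
  obtain ⟨f, hf⟩ := exists_injOn X
  obtain ⟨x₀, hx₀, hx₀c⟩ := hne
  obtain ⟨x, hx, hmax⟩ := {y ∈ X | g y = c}.exists_max_image f ⟨x₀, by simp [hx₀, hx₀c]⟩
  have hx' := hx
  simp only [Finset.mem_filter] at hx' hmax
  have hf1 : Set.InjOn f {y | y ∈ X ∧ g y = c} := fun a ha b hb e => hf ha.1 hb.1 e
  have hf2 : Set.InjOn (-f : Functional) {y | y ∈ X ∧ g y = c} := fun a ha b hb e =>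
    hf ha.1 hb.1 (by simpa using e)
  -- In the opposite order `x` is the first point of the face.
  have hxS : x ∈ S := by
    rw [h.mem_iff_even hg hf2 hmin _ x rfl hx'.1 hx'.2]
    have : ({y ∈ X | g y = c ∧ (-f : Functional) y < (-f : Functional) x} : Finset Plane) = ∅ := by
      rw [Finset.filter_eq_empty_iff]
      rintro y hy ⟨h1, h2⟩
      simp at h2
      exact absurd (hmax y ⟨hy, h1⟩) (not_le.2 h2)
    rw [this]; simp
  rw [h.mem_iff_even hg hf1 hmin _ x rfl hx'.1 hx'.2] at hxS
  have : ({y ∈ X | g y = c} : Finset Plane) = insert x {y ∈ X | g y = c ∧ f y < f x} := by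
    ext y
    simp only [Finset.mem_filter, Finset.mem_insert]
    constructor
    · rintro ⟨h1, h2⟩
      rcases (hmax y ⟨h1, h2⟩).lt_or_eq with h3 | h3
      · exact Or.inr ⟨h1, h2, h3⟩
      · exact Or.inl (hf h1 hx'.1 h3)
    · rintro (rfl | h1)
      · exact hx'
      · exact ⟨h1.1, h1.2.1⟩
  rw [this, Finset.card_insert_of_notMem (by simp)]
  exact hxS.add_one

/-- A blocker between `v` and `p` would be a nearer point of the edge. -/
theorem Nearest.notMem_of_indep {X S : Finset Plane} {v p : Plane} {g₁ g₂ : Functional}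
    (hF : Frame X v g₁ g₂) (hp : Nearest X v g₁ g₂ p) {Y : Finset Plane} (hYX : Y ⊆ X)
    (h : Indep Y S) (hv : v ∈ S) : p ∉ S := by
  intro hpS
  obtain ⟨z, hz, hzs⟩ := h.2 v hv p hpS hp.ne.symm
  have h1 := lt_of_mem_openSegment hzs (hF.lt hp.mem hp.ne hp.eq)
  exact absurd (hp.min z (hYX hz) (fun e => by rw [e] at h1; exact lt_irrefl _ h1.1)
    (eq_of_mem_openSegment hzs rfl hp.eq)) (not_le.2 h1.2)

theorem Nearest.ne_nearest {X : Finset Plane} {v p q : Plane} {g₁ g₂ : Functional}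
    (hF : Frame X v g₁ g₂) (hp : Nearest X v g₁ g₂ p) (hq : Nearest X v g₂ g₁ q) : p ≠ q :=
  fun e => hp.ne (hF.indep.eq hp.eq (by rw [e]; exact hq.eq))

/-- Deleting a corner and its neighbours on the hull. -/
theorem Indep.ear {Y S : Finset Plane} {v p q : Plane} {g₁ g₂ : Functional} (h : Indep Y S)
    (hF : Frame Y v g₁ g₂) (hp : Nearest Y v g₁ g₂ p) (hq : Nearest Y v g₂ g₁ q) (hv : v ∈ S) :
    Indep (Y \ {v, p, q}) (S.erase v) := by
  refine h.sdiff (Finset.erase_subset _ _) ?_ ?_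
  · rw [Finset.disjoint_right]; intro x hx hxS
    simp only [Finset.mem_insert, Finset.mem_singleton] at hx
    rcases hx with rfl | rfl | rfl
    · simp at hxS
    · exact hp.notMem_of_indep hF subset_rfl h hv (Finset.mem_of_mem_erase hxS)
    · exact hq.notMem_of_indep hF.symm subset_rfl h hv (Finset.mem_of_mem_erase hxS)
  · intro d hd a ha b hb hab
    have ha' := Finset.mem_erase.1 ha
    have hb' := Finset.mem_erase.1 hb
    simp only [Finset.mem_insert, Finset.mem_singleton] at hd
    rcases hd with rfl | rfl | rfl
    · exact hF.corner.not_mem_openSegment (h.1 ha'.2) (h.1 hb'.2) ha'.1 hb'.1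
    · exact hp.not_mem_openSegment hF hp.eq le_rfl (h.1 ha'.2) (h.1 hb'.2) ha'.1 hb'.1 hab
    · exact hq.not_mem_openSegment hF.symm hq.eq le_rfl (h.1 ha'.2) (h.1 hb'.2) ha'.1 hb'.1 hab

theorem card_sdiff_triple {X : Finset Plane} {a b c : Plane} (ha : a ∈ X) (hb : b ∈ X)
    (hc : c ∈ X) (hab : a ≠ b) (hac : a ≠ c) (hbc : b ≠ c) :
    (X \ {a, b, c}).card + 3 = X.card := by
  have hD : ({a, b, c} : Finset Plane) ⊆ X := by
    intro x hx
    simp only [Finset.mem_insert, Finset.mem_singleton] at hx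
    rcases hx with rfl | rfl | rfl <;> assumption
  have h3 := Finset.card_le_card hD
  have hc : ({a, b, c} : Finset Plane).card = 3 :=
    Finset.card_eq_three.2 ⟨a, b, c, hab, hac, hbc, rfl⟩
  rw [Finset.card_sdiff_of_subset hD]
  omega

theorem card_sdiff_ear {Y : Finset Plane} {v p q : Plane} {g₁ g₂ : Functional}
    (hF : Frame Y v g₁ g₂) (hp : Nearest Y v g₁ g₂ p) (hq : Nearest Y v g₂ g₁ q) :
    (Y \ {v, p, q}).card + 3 = Y.card :=
  card_sdiff_triple hF.mem hp.mem hq.mem hp.ne.symm hq.ne.symm (hp.ne_nearest hF hq)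

/-- An ear takes three points of `Y` and one of `S`, so equality in the bound persists. This drives
the induction in `Tight.exists_support`. -/
theorem Tight.ear {Y S : Finset Plane} {v p q : Plane} {g₁ g₂ : Functional} (h : Tight Y S)
    (hF : Frame Y v g₁ g₂) (hp : Nearest Y v g₁ g₂ p) (hq : Nearest Y v g₂ g₁ q)
    (hc : ¬ Col (S.erase v)) : Tight (Y \ {v, p, q}) (S.erase v) := by
  have hv := h.corner_mem hF.corner
  refine ⟨h.indep.ear hF hp hq hv, hc, ?_⟩
  have h1 := card_sdiff_ear hF hp hq
  have h2 := h.card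
  rw [Finset.card_erase_of_mem hv]
  omega

theorem Tight.not_col' {X S : Finset Plane} (h : Tight X S) : ¬ Col X :=
  fun hc => h.not_col (hc.mono h.indep.1)

theorem Tight.three_le {X S : Finset Plane} (h : Tight X S) : 3 ≤ S.card := by
  by_contra hlt
  exact h.not_col (col_of_card_le_two (by omega))

/-- If all but one point of a tight set lie on a line then this line bounds `X`. -/
theorem Tight.line_supports {X S : Finset Plane} (h : Tight X S) {v : Plane} {g : Functional}
    {c : ℝ} (hgc : ∀ p ∈ S.erase v, g p = c) (hlt : c < g v) : ∀ x ∈ X, c ≤ g x := by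
  intro x hx
  obtain ⟨f, hf⟩ := exists_injOn X
  obtain ⟨y, hy, hmin⟩ := X.exists_min_image g ⟨x, hx⟩
  obtain ⟨w, hw, hwmin⟩ := {z ∈ X | g z = g y}.exists_min_image f ⟨y, by simp [hy]⟩
  simp only [Finset.mem_filter] at hw hwmin
  -- The points of `X` with the least value of `g` include a corner; it belongs to `S`, where `g` is
  -- at least `c`.
  have hcorner : Corner X w := by
    refine corner_of_lex hw.1 g f fun z hz hzw => ?_
    rcases (hmin z hz).lt_or_eq with h1 | h1
    · left; rw [hw.2]; exact h1
    · right
      exact ⟨hw.2.trans h1, lt_of_le_of_ne (hwmin z ⟨hz, h1.symm⟩) fun e =>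
        hzw (hf hz hw.1 e.symm)⟩
  have hwS := h.corner_mem hcorner
  have : c ≤ g w := by
    by_cases hwv : w = v
    · rw [hwv]; exact hlt.le
    · rw [hgc w (Finset.mem_erase.2 ⟨hwv, hwS⟩)]
  rw [hw.2] at this
  exact this.trans (hmin x hx)

theorem Tight.exists_line {X S : Finset Plane} (h : Tight X S) {v : Plane}
    (hc : Col (S.erase v)) : ∃ g : Functional, g ≠ 0 ∧ ∃ c, (∀ p ∈ S.erase v, g p = c) ∧
      c < g v ∧ ∀ x ∈ X, c ≤ g x := by
  obtain ⟨g, hg, c, hgc⟩ := hc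
  have hgv : g v ≠ c := fun e => h.not_col ⟨g, hg, c, fun p hp => by
    by_cases hpv : p = v
    · rw [hpv, e]
    · exact hgc p (Finset.mem_erase.2 ⟨hpv, hp⟩)⟩
  rcases hgv.lt_or_gt with hlt | hlt
  · have h1 : ∀ p ∈ S.erase v, (-g : Functional) p = -c := fun p hp => by simp [hgc p hp]
    have h2 : -c < (-g : Functional) v := by simpa using hlt
    exact ⟨-g, by simpa using hg, -c, h1, h2, h.line_supports h1 h2⟩
  · exact ⟨g, hg, c, hgc, hlt, h.line_supports hgc hlt⟩

/-- The points of a tight set are on the boundary of the hull. -/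
theorem Tight.exists_support : ∀ (m : ℕ) (X S : Finset Plane), S.card = m → Tight X S →
    ∀ s ∈ S, ∃ g : Functional, g ≠ 0 ∧ ∀ y ∈ X, g s ≤ g y := by
  intro m
  induction m with
  | zero =>
    intro X S hm h
    exact absurd h.three_le (by omega)
  | succ m ih =>
    intro X S hm h s hs
    have h3 := h.three_le
    have h4 := Finset.card_le_card h.indep.1
    obtain ⟨v, hv, hvs⟩ := exists_corner_ne (X := X) (by omega) s
    have hvS := h.corner_mem hv
    have hsv : s ∈ S.erase v := Finset.mem_erase.2 ⟨hvs.symm, hs⟩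
    by_cases hc : Col (S.erase v)
    · obtain ⟨g, hg, c, hgc, -, hsup⟩ := h.exists_line hc
      exact ⟨g, hg, by rw [hgc s hsv]; exact hsup⟩
    · obtain ⟨g₁, g₂, hF⟩ := exists_frame hv h.not_col'
      obtain ⟨p, hp⟩ := hF.exists_nearest
      obtain ⟨q, hq⟩ := hF.symm.exists_nearest
      have hT := h.ear hF hp hq hc
      obtain ⟨g, hg, hsup⟩ := ih _ _ (by rw [Finset.card_erase_of_mem hvS]; omega) hT s hsv
      have hSsup : ∀ b ∈ S, b ≠ v → g s ≤ g b := fun b hb hbv =>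
        hsup b (hT.indep.1 (Finset.mem_erase.2 ⟨hbv, hb⟩))
      by_cases hmin : ∀ y ∈ X, g s ≤ g y
      · exact ⟨g, hg, hmin⟩
      -- Otherwise `g` is at least `g s` on all of `S`, hence also on the points outside `S`, each
      -- of which lies between two points of `S`.
      have hgv : g v < g s := by
        by_contra hle
        rw [not_lt] at hle
        apply hmin
        have haux : ∀ y ∈ X, y ∉ S → g s ≤ g y := by
          intro y hy hyS
          obtain ⟨a, ha, b, hb, hab, hyab, -⟩ := h.critical hy hyS
          have hall : ∀ b ∈ S, g s ≤ g b := fun b hb => by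
            by_cases hbv : b = v
            · rw [hbv]; exact hle
            · exact hSsup b hb hbv
          exact le_of_mem_openSegment_of_le hyab (hall a ha) (hall b hb)
        intro y hy
        by_cases hyS : y ∈ S
        · by_cases hyv : y = v
          · rw [hyv]; exact hle
          · exact hSsup y hyS hyv
        · exact haux y hy hyS
      obtain ⟨z, hz, hzs⟩ := h.indep.2 v hvS s hs hvs
      have hzg := lt_of_mem_openSegment hzs hgv
      have hzv : z ≠ v := (ne_of_mem_openSegment hzs hvs).1
      have hface : ∀ g' : Functional, g' z = g' v → g' s = g' v := by
        intro g' he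
        obtain ⟨a, b, ha, hb, hab, hgz⟩ := functional_openSegment hzs
        have e := hgz g'
        obtain rfl : a = 1 - b := by linarith
        have : b * (g' s - g' v) = 0 := by linarith
        linarith [(mul_eq_zero.1 this).resolve_left hb.ne']
      -- The blocker of `v` and `s` is on the wrong side of the line, so it is one of the deleted
      -- points; then `s` is on a hull edge at `v`.
      have hzmem : z = p ∨ z = q := by
        by_contra! hne
        have := hsup z (by simp [hz, hzv, hne.1, hne.2])
        linarith
      rcases hzmem with rfl | rfl
      · exact ⟨g₁, hF.indep.left_ne_zero, by rw [hface g₁ hp.eq]; exact hF.min₁⟩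
      · exact ⟨g₂, hF.indep.right_ne_zero, by rw [hface g₂ hq.eq]; exact hF.min₂⟩

/-- Twice the signed area of the triangle `s z y`. -/
noncomputable def cross (s z y : Plane) : ℝ := (z 0 - s 0) * (y 1 - s 1) - (z 1 - s 1) * (y 0 - s 0)

/-- The inner product of `z - s` and `y - s`. -/
noncomputable def dot (s z y : Plane) : ℝ := (z 0 - s 0) * (y 0 - s 0) + (z 1 - s 1) * (y 1 - s 1)

theorem cross_eq (s z y : Plane) : cross s z y =
    ofCoeffs (-(z 1 - s 1)) (z 0 - s 0) y - ofCoeffs (-(z 1 - s 1)) (z 0 - s 0) s := by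
  simp [cross]; ring

theorem dot_eq (s z y : Plane) : dot s z y =
    ofCoeffs (z 0 - s 0) (z 1 - s 1) y - ofCoeffs (z 0 - s 0) (z 1 - s 1) s := by
  simp [dot]; ring

theorem cross_dot_independent {s z : Plane} (h : z ≠ s) :
    Independent (ofCoeffs (-(z 1 - s 1)) (z 0 - s 0)) (ofCoeffs (z 0 - s 0) (z 1 - s 1)) := by
  have hdot : (z 0 - s 0) * (z 0 - s 0) + (z 1 - s 1) * (z 1 - s 1) ≠ 0 := by
    intro e
    have h0 : z 0 - s 0 = 0 := by nlinarith [sq_nonneg (z 0 - s 0), sq_nonneg (z 1 - s 1)]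
    have h1 : z 1 - s 1 = 0 := by nlinarith [sq_nonneg (z 0 - s 0), sq_nonneg (z 1 - s 1)]
    apply h
    rw [← sub_eq_zero]
    exact plane_eq_zero (by simpa using h0) (by simpa using h1)
  refine independent_of ?_ (d := z - s) (by simp; ring) (by simpa using hdot)
  intro h0
  have h1 := LinearMap.congr_fun h0 (!₂[1, 0])
  have h2 := LinearMap.congr_fun h0 (!₂[0, 1])
  simp at h1 h2
  apply hdot
  rw [h2, show z 1 - s 1 = 0 by linarith]; ring

/-- The points at even positions on the boundary of the hull. -/
noncomputable def alternate (X : Finset Plane) : Finset Plane :=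
  {s ∈ X | ∃ z ∈ X, z ≠ s ∧ ((∀ y ∈ X, 0 ≤ cross s z y) ∨ ∀ y ∈ X, cross s z y ≤ 0) ∧
    Even {y ∈ X | cross s z y = 0 ∧ dot s z y < 0}.card}

/-- The count runs over the points of the face beyond `s` as seen from `z`. Any choice of `z` gives
the right parity, since `Tight.mem_iff_even` applies to both orders along a face. -/
theorem Tight.mem_iff_even_cross {X S : Finset Plane} (h : Tight X S) {s z : Plane} (hs : s ∈ X)
    (hzs : z ≠ s) (hsup : (∀ y ∈ X, 0 ≤ cross s z y) ∨ ∀ y ∈ X, cross s z y ≤ 0) :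
    s ∈ S ↔ Even {y ∈ X | cross s z y = 0 ∧ dot s z y < 0}.card := by
  have hi := cross_dot_independent hzs
  set g := ofCoeffs (-(z 1 - s 1)) (z 0 - s 0) with hgdef
  set f := ofCoeffs (z 0 - s 0) (z 1 - s 1) with hfdef
  have hcr : ∀ y, cross s z y = g y - g s := fun y => cross_eq s z y
  have hdt : ∀ y, dot s z y = f y - f s := fun y => dot_eq s z y
  have hf : ∀ g' : Functional, (∀ y, g' y = g' s → g y = g s) →
      Set.InjOn f {y | y ∈ X ∧ g' y = g' s} := fun g' hg' a ha b hb e =>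
    hi.eq ((hg' a ha.2).trans (hg' b hb.2).symm) e
  rcases hsup with hsup | hsup
  · rw [h.mem_iff_even hi.left_ne_zero (hf g fun _ => id)
      (fun y hy => by have := hsup y hy; rw [hcr] at this; linarith) _ s rfl hs rfl]
    simp [hcr, hdt, sub_eq_zero]
  · rw [h.mem_iff_even (neg_ne_zero.2 hi.left_ne_zero) (hf (-g) (by simp))
      (fun y hy => by have := hsup y hy; rw [hcr] at this; simp; linarith) _ s rfl hs rfl]
    simp [hcr, hdt, sub_eq_zero]

/-- There is only one tight set. -/
theorem Tight.eq_alternate {X S : Finset Plane} (h : Tight X S) : S = alternate X := by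
  ext s
  simp only [alternate, Finset.mem_filter]
  constructor
  · intro hs
    have hsX := h.indep.1 hs
    have hsup : ∃ g : Functional, g ≠ 0 ∧ (∀ y ∈ X, g s ≤ g y) ∧ ∃ z ∈ X, z ≠ s ∧ g z = g s := by
      obtain ⟨g, hg, hmin⟩ := Tight.exists_support _ X S rfl h s hs
      by_cases hz : ∃ z ∈ X, z ≠ s ∧ g z = g s
      · exact ⟨g, hg, hmin, hz⟩
      · push Not at hz
        obtain ⟨φ, hφ⟩ := exists_independent hg
        -- A supporting line that touches `X` only in `s` is turned until it meets a second point.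
        obtain ⟨t, ht1, ht2⟩ := exists_next_edge (φ := φ) hmin
          (fun y hy hne he => absurd he (hz y hy hne)) (by
            by_contra! hcon
            exact h.not_col' ⟨g, hg, g s, fun p hp => le_antisymm (hcon p hp) (hmin p hp)⟩)
        exact ⟨_, (independent_sub_smul hφ t).right_ne_zero, ht1, ht2⟩
    obtain ⟨g, hg, hmin, z, hz, hzs, hgz⟩ := hsup
    -- As a function of the third point, `cross s z` is a multiple of `g - g s`, both being zero at
    -- `s` and `z`.
    have hsup : (∀ y ∈ X, 0 ≤ cross s z y) ∨ ∀ y ∈ X, cross s z y ≤ 0 := by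
      obtain ⟨w, hw⟩ := exists_ne_zero hg
      have hp : ∀ y, g w * cross s z y = (g y - g s) * cross s z (s + w) := by
        intro y
        have := proportional (g := g) (k := ofCoeffs (-(z 1 - s 1)) (z 0 - s 0)) hzs.symm hgz.symm
          (by simp; ring) (s + w) y
        rw [← cross_eq, ← cross_eq] at this
        simpa using this
      have hp' : ∀ y, cross s z y = (g y - g s) * (cross s z (s + w) / g w) := fun y => by
        field_simp; linarith [hp y]
      rcases le_total 0 (cross s z (s + w) / g w) with h0 | h0
      · exact Or.inl fun y hy => by
          rw [hp']; exact mul_nonneg (sub_nonneg.2 (hmin y hy)) h0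
      · exact Or.inr fun y hy => by
          rw [hp']; exact mul_nonpos_of_nonneg_of_nonpos (sub_nonneg.2 (hmin y hy)) h0
    exact ⟨hsX, z, hz, hzs, hsup, (h.mem_iff_even_cross hsX hzs hsup).1 hs⟩
  · rintro ⟨hs, z, hz, hzs, hsup, hev⟩
    exact (h.mem_iff_even_cross hs hzs hsup).2 hev

/-! ### Triangles which can be cut off by a line -/

/-- A triangle with vertices in `X` which a line separates from the other points. -/
structure CutTriangle (X T : Finset Plane) : Prop where
  subset : T ⊆ X
  card : T.card = 3
  not_col : ¬ Col T
  sep : Sep T (X \ T)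

/-- Cutting off any triangle leaves a set with a tight subset. -/
def CutsTight (X : Finset Plane) : Prop :=
  ∀ T, CutTriangle X T → ∃ S, Tight (X \ T) S

/-- From the supporting line `g = g p` of `W` one deletion takes exactly `p` and the other nothing,
so the two faces have consecutive sizes, although both must be odd. The point `y₀` keeps them
nonempty. -/
theorem Tight.parity_contradiction {W D₁ D₂ S₁ S₂ : Finset Plane} (h₁ : Tight (W \ D₁) S₁)
    (h₂ : Tight (W \ D₂) S₂) {g : Functional} (hg : g ≠ 0) {p y₀ : Plane}
    (hmin : ∀ y ∈ W, g p ≤ g y) (hp : p ∈ W)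
    (hD₁ : ∀ y ∈ W, g y = g p → (y ∈ D₁ ↔ y = p)) (hD₂ : ∀ y ∈ W, g y = g p → y ∉ D₂)
    (hy₀ : y₀ ∈ W) (hne : y₀ ≠ p) (heq : g y₀ = g p) : False := by
  have o₁ := h₁.odd_face hg (c := g p) (fun y hy => hmin y (Finset.mem_sdiff.1 hy).1)
    ⟨y₀, Finset.mem_sdiff.2 ⟨hy₀, fun h => hne ((hD₁ y₀ hy₀ heq).1 h)⟩, heq⟩
  have o₂ := h₂.odd_face hg (c := g p) (fun y hy => hmin y (Finset.mem_sdiff.1 hy).1)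
    ⟨y₀, Finset.mem_sdiff.2 ⟨hy₀, hD₂ y₀ hy₀ heq⟩, heq⟩
  have e₂ : ({y ∈ W \ D₂ | g y = g p} : Finset Plane) =
      insert p {y ∈ W \ D₁ | g y = g p} := by
    ext y
    simp only [Finset.mem_filter, Finset.mem_sdiff, Finset.mem_insert]
    constructor
    · rintro ⟨⟨h1, h2⟩, h3⟩
      by_cases hyp : y = p
      · exact Or.inl hyp
      · exact Or.inr ⟨⟨h1, fun h => hyp ((hD₁ y h1 h3).1 h)⟩, h3⟩
    · rintro (rfl | ⟨⟨h1, h2⟩, h3⟩)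
      · exact ⟨⟨hp, hD₂ _ hp rfl⟩, rfl⟩
      · exact ⟨⟨h1, hD₂ y h1 h3⟩, h3⟩
  rw [e₂, Finset.card_insert_of_notMem (by
    simp only [Finset.mem_filter, Finset.mem_sdiff, not_and]
    rintro ⟨h1, h2⟩
    exact absurd ((hD₁ p hp rfl).2 rfl) h2)] at o₂
  exact (Nat.not_odd_iff_even.2 o₁.add_one) o₂

/-- The lines of the two hull edges at `p` meet only in `p`, so one of them avoids `q`; along this
edge the parities conflict. -/
theorem Tight.corner_contradiction {W S₁ S₂ : Finset Plane} {p q : Plane} (hp : Corner W p)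
    (hpq : p ≠ q) (h₁ : Tight (W \ {p}) S₁) (h₂ : Tight (W \ {q}) S₂) : False := by
  obtain ⟨g₁, g₂, hF⟩ := exists_frame hp fun h => h₁.not_col' (h.mono Finset.sdiff_subset)
  obtain ⟨g, hg, hmin, ⟨y, hy, hyp, hgy⟩, hgq⟩ : ∃ g : Functional, g ≠ 0 ∧
      (∀ y ∈ W, g p ≤ g y) ∧ (∃ y ∈ W, y ≠ p ∧ g y = g p) ∧ g q ≠ g p := by
    by_cases hq : g₁ q = g₁ p
    · exact ⟨g₂, hF.indep.right_ne_zero, hF.min₂, hF.ex₂, fun h => hpq (hF.indep.eq hq h).symm⟩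
    · exact ⟨g₁, hF.indep.left_ne_zero, hF.min₁, hF.ex₁, hq⟩
  refine h₁.parity_contradiction h₂ hg hmin hp.1 (by simp) ?_ hy hyp hgy
  intro z _ hz hzq
  rw [Finset.mem_singleton] at hzq
  exact hgq (hzq ▸ hz)

theorem sdiff_triple {X : Finset Plane} (a b c : Plane) : X \ {a, b, c} = (X \ {a, b}) \ {c} := by
  ext x; simp; tauto

theorem CutTriangle.ne {X : Finset Plane} {a b c : Plane} (h : CutTriangle X {a, b, c}) :
    a ≠ b ∧ a ≠ c ∧ b ≠ c := by
  have h3 := h.card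
  refine ⟨?_, ?_, ?_⟩ <;> rintro rfl
  · have := Finset.card_le_two (a := a) (b := c); simp at h3; omega
  · have := Finset.card_le_two (a := b) (b := a)
    rw [show ({a, b, a} : Finset Plane) = {b, a} by ext; simp] at h3; omega
  · have := Finset.card_le_two (a := a) (b := b); simp at h3; omega

/-- Two cut triangles do not have exactly two common vertices. -/
theorem CutsTight.eq_of_cut {X : Finset Plane} (H : CutsTight X) {a b p q : Plane}
    (hp : CutTriangle X {a, b, p}) (hq : CutTriangle X {a, b, q}) : p = q := by
  by_contra hpq
  obtain ⟨S₁, h₁⟩ := H _ hp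
  obtain ⟨S₂, h₂⟩ := H _ hq
  rw [sdiff_triple] at h₁ h₂
  -- Once `a` and `b` are deleted, the line that cuts off the first triangle cuts off `p` alone.
  refine Tight.corner_contradiction ?_ hpq h₁ h₂
  have hn := hp.ne
  obtain ⟨f, c, hf1, hf2⟩ := hp.sep
  refine ⟨Finset.mem_sdiff.2 ⟨hp.subset (by simp), by simp [hn.2.1.symm, hn.2.2.symm]⟩,
    f, fun y hy hyp => ?_⟩
  refine (hf1 p (by simp)).trans (hf2 y ?_)
  simp at hy ⊢
  tauto

/-- Rotating about a point just after a separable pair. -/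
theorem exists_cut_of_pair {X : Finset Plane} {a b : Plane} (hab : a ≠ b) (ha : a ∈ X)
    (hb : b ∈ X) {f m : Functional} {c : ℝ} (hfa : f a < c) (hfb : f b < c)
    (hf : ∀ y ∈ X, y ≠ a → y ≠ b → c < f y) (hi : Independent m f) (hm : m a = m b)
    (hy : ∃ y ∈ X, m y < m a) : ∃ e ∈ X, m e < m a ∧ CutTriangle X {a, b, e} := by
  obtain ⟨y₁, hy₁, hlt₁⟩ := hy
  -- The lines `f + t m = c + t m(a)` all pass through the point where `f = c` and `m = m a`, and
  -- keep `a` and `b` on the same side; `τ y` is the parameter at which `y` is met.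
  set τ : Plane → ℝ := fun y => (f y - c) / (m a - m y) with hτ
  have hne : ∀ y, m y < m a → y ≠ a ∧ y ≠ b := fun y hy =>
    ⟨fun e => by rw [e] at hy; exact lt_irrefl _ hy,
      fun e => by rw [e, hm] at hy; exact lt_irrefl _ hy⟩
  obtain ⟨e₀, he₀, hmin₀⟩ := {y ∈ X | m y < m a}.exists_min_image τ ⟨y₁, by simp [hy₁, hlt₁]⟩
  simp only [Finset.mem_filter] at he₀ hmin₀
  -- Of the points met simultaneously, the one nearest to the pivot can be cut off.
  obtain ⟨e, he, hmax⟩ := {y ∈ X | m y < m a ∧ τ y = τ e₀}.exists_max_image m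
    ⟨e₀, by simp [he₀]⟩
  simp only [Finset.mem_filter] at he hmax
  have hpos : 0 < τ e₀ := by
    have := hne e₀ he₀.2
    exact div_pos (sub_pos.2 (hf e₀ he₀.1 this.1 this.2)) (sub_pos.2 he₀.2)
  set t := τ e₀ with ht
  have hk : ∀ y, m y < m a → (f y + t * m y - (c + t * m a) = (τ y - t) * (m a - m y)) := by
    intro y hy
    have : m a - m y ≠ 0 := (sub_pos.2 hy).ne'
    simp only [hτ]; field_simp; ring
  have hke : f e + t * m e = c + t * m a := by
    have := hk e he.2.1; rw [he.2.2, sub_self, zero_mul] at this; linarith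
  refine ⟨e, he.1, he.2.1, ?_, ?_, ?_, ?_⟩
  · intro x hx
    simp only [Finset.mem_insert, Finset.mem_singleton] at hx
    rcases hx with rfl | rfl | rfl
    exacts [ha, hb, he.1]
  · have := hne e he.2.1
    exact Finset.card_eq_three.2 ⟨a, b, e, hab, this.1.symm, this.2.symm, rfl⟩
  · rw [show ({a, b, e} : Finset Plane) = {e, a, b} by ext; simp; tauto]
    exact not_col_triple hab hm he.2.1.ne
  · refine sep_of_lex (f + t • m) (-m) fun x hx y hy => ?_
    simp only [Finset.mem_sdiff, Finset.mem_insert, Finset.mem_singleton, not_or] at hy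
    obtain ⟨hyX, hya, hyb, hye⟩ := hy
    have hfy := hf y hyX hya hyb
    simp only [LinearMap.add_apply, LinearMap.smul_apply, smul_eq_mul, LinearMap.neg_apply,
      neg_lt_neg_iff]
    have hky : c + t * m a ≤ f y + t * m y := by
      rcases lt_or_ge (m y) (m a) with h | h
      · have h1 := hmin₀ y ⟨hyX, h⟩
        have := hk y h
        have := mul_nonneg (sub_nonneg.2 h1) (sub_pos.2 h).le
        linarith
      · have := mul_le_mul_of_nonneg_left h hpos.le
        linarith
    simp only [Finset.mem_insert, Finset.mem_singleton] at hx
    rcases hx with rfl | rfl | rfl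
    · left; linarith
    · left; rw [hm] at hky; linarith
    · rcases hky.lt_or_eq with h1 | h1
      · left; linarith
      · right
        refine ⟨by linarith, ?_⟩
        have hlt : m y < m a := by
          by_contra hge
          have := mul_le_mul_of_nonneg_left (not_lt.1 hge) hpos.le
          linarith
        have hτy : τ y = t := by
          have := hk y hlt
          have h2 : (τ y - t) * (m a - m y) = 0 := by linarith
          linarith [(mul_eq_zero.1 h2).resolve_right (sub_pos.2 hlt).ne']
        refine lt_of_le_of_ne (hmax y ⟨hyX, hlt, hτy⟩) fun hmm => hye ?_
        refine hi.eq hmm ?_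
        rw [hmm] at h1
        linarith

/-- A pair which can be cut off by a line spans a supporting line. -/
theorem CutsTight.pair_supports {X : Finset Plane} (H : CutsTight X) {a b : Plane} (hab : a ≠ b)
    (ha : a ∈ X) (hb : b ∈ X) (hs : Sep {a, b} (X \ {a, b})) {m : Functional} (hm : m a = m b)
    {y z : Plane} (hy : y ∈ X) (hya : m y < m a) (hz : z ∈ X) (hza : m a < m z) : False := by
  obtain ⟨f, c, hf1, hf2⟩ := hs
  have hfa := hf1 a (by simp)
  have hfb := hf1 b (by simp)
  have hf : ∀ y ∈ X, y ≠ a → y ≠ b → c < f y := fun y hy h1 h2 => hf2 y (by simp [hy, h1, h2])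
  have hm0 : m ≠ 0 := by rintro rfl; simp at hya
  have hne : ∀ x, m x ≠ m a → x ≠ a ∧ x ≠ b := fun x hx =>
    ⟨fun e => hx (by rw [e]), fun e => hx (by rw [e, hm])⟩
  -- If `f` were constant on the line `ab`, then `y` and `z`, both beyond `f = c`, would be on the
  -- same side of that line.
  have hi : Independent m f := by
    refine independent_of hm0 (d := b - a) (by simp [hm]) fun h0 => ?_
    have hfab : f a = f b := by
      have : f b - f a = 0 := by simpa using h0
      linarith
    have h1 := proportional hab hfab hm y z
    have h2 := hf y hy (hne y hya.ne).1 (hne y hya.ne).2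
    have h3 := hf z hz (hne z hza.ne').1 (hne z hza.ne').2
    have h4 : 0 < (f y - f a) * (m z - m a) := mul_pos (by linarith) (by linarith)
    have h5 : (f z - f a) * (m y - m a) < 0 := mul_neg_of_pos_of_neg (by linarith) (by linarith)
    linarith
  -- Turning both ways gives third vertices on different sides of the line `ab`.
  obtain ⟨e, he, hea, hcut⟩ := exists_cut_of_pair hab ha hb hfa hfb hf hi hm ⟨y, hy, hya⟩
  have hi' : Independent (-m : Functional) f := fun z h1 h2 => hi z (by simpa using h1) h2
  obtain ⟨e', he', hea', hcut'⟩ := exists_cut_of_pair hab ha hb hfa hfb hf hi'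
    (by simp [hm]) ⟨z, hz, by simpa using hza⟩
  have := H.eq_of_cut hcut hcut'
  rw [← this] at hea'
  simp at hea'
  linarith

/-! ### Ears of the convex hull -/

theorem Frame.weight {X : Finset Plane} {u p q : Plane} {g₁ g₂ : Functional}
    (hF : Frame X u g₁ g₂) (hp : Nearest X u g₁ g₂ p) (hq : Nearest X u g₂ g₁ q) :
    ∃ k : Functional, ∃ α β : ℝ, 0 < α ∧ 0 < β ∧ k = α • g₁ + β • g₂ ∧
      α * (g₁ q - g₁ u) = 1 ∧ β * (g₂ p - g₂ u) = 1 := by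
  have h1 := sub_pos.2 (hF.lt hp.mem hp.ne hp.eq)
  have h2 := sub_pos.2 (hF.symm.lt hq.mem hq.ne hq.eq)
  exact ⟨_, (g₁ q - g₁ u)⁻¹, (g₂ p - g₂ u)⁻¹, inv_pos.2 h2, inv_pos.2 h1, rfl,
    inv_mul_cancel₀ h2.ne', inv_mul_cancel₀ h1.ne'⟩

/-- A corner and its neighbours on the hull can be cut off. -/
theorem CutsTight.corner_cut {X : Finset Plane} (H : CutsTight X) {u p q : Plane}
    {g₁ g₂ : Functional} (hF : Frame X u g₁ g₂) (hp : Nearest X u g₁ g₂ p)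
    (hq : Nearest X u g₂ g₁ q) : ∃ k : Functional, k p = k q ∧ k u < k p ∧
      ∀ y ∈ X, y ≠ u → y ≠ p → y ≠ q → k p < k y := by
  obtain ⟨k, α, β, hα, hβ, rfl, hαq, hβp⟩ := hF.weight hp hq
  set k := α • g₁ + β • g₂ with hk
  have hkx : ∀ x, k x - k u = α * (g₁ x - g₁ u) + β * (g₂ x - g₂ u) := fun x => by
    simp [hk]; ring
  have hpq := hp.ne_nearest hF hq
  have hkp : k p - k u = 1 := by rw [hkx, hp.eq, hβp]; ring
  have hkq : k q - k u = 1 := by rw [hkx, hq.eq, hαq]; ring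
  have hi : Independent k g₁ := fun z h1 h2 => hF.indep z h2 (by
    simp [hk, h2] at h1; exact h1.resolve_left hβ.ne')
  have hku : ∀ y ∈ X, y ≠ u → k u < k y := by
    intro y hy hyu
    have h1 := mul_nonneg hα.le (sub_nonneg.2 (hF.min₁ y hy))
    have h2 := mul_nonneg hβ.le (sub_nonneg.2 (hF.min₂ y hy))
    have := hkx y
    rcases (hF.min₁ y hy).lt_or_eq with h | h
    · have := mul_pos hα (sub_pos.2 h); linarith
    · have := mul_pos hβ (sub_pos.2 (hF.lt hy hyu h.symm)); linarith
  refine ⟨k, by linarith, by linarith, ?_⟩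
  by_contra! hcon
  obtain ⟨y₀, hy₀, hy₀u, hy₀p, hy₀q, hky₀⟩ := hcon
  -- no point lies below the line through `p` and `q`
  have hlow : ∀ y ∈ X, y ≠ u → k p ≤ k y := by
    by_contra! hcon
    obtain ⟨y₁, hy₁, hy₁u, hky₁⟩ := hcon
    obtain ⟨a₀, ha₀, hmin₀⟩ := (X.erase u).exists_min_image k
      ⟨y₁, Finset.mem_erase.2 ⟨hy₁u, hy₁⟩⟩
    obtain ⟨a, ha, hmin⟩ := {x ∈ X.erase u | k x = k a₀}.exists_min_image g₁
      ⟨a₀, Finset.mem_filter.2 ⟨ha₀, rfl⟩⟩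
    simp only [Finset.mem_filter, Finset.mem_erase] at ha hmin hmin₀
    obtain ⟨⟨hau, haX⟩, hka⟩ := ha
    have hkap : k a < k p := by
      rw [hka]; exact (hmin₀ y₁ ⟨hy₁u, hy₁⟩).trans_lt hky₁
    -- A lowest point `a` can be cut off together with `u`. Inside the angle at `u` it would have
    -- `p` and `q` on different sides of the line `ua`, against `pair_supports`; on an edge it
    -- cannot be lower than the neighbour of `u`.
    have hsep : Sep {u, a} (X \ {u, a}) := by
      refine sep_of_lex k g₁ fun x hx y hy => ?_
      simp only [Finset.mem_sdiff, Finset.mem_insert, Finset.mem_singleton, not_or] at hx hy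
      rcases hx with rfl | rfl
      · exact Or.inl (hku y hy.1 hy.2.1)
      · rcases (hmin₀ y ⟨hy.2.1, hy.1⟩).lt_or_eq with h | h
        · left; rwa [hka]
        · right
          refine ⟨hka.trans h, lt_of_le_of_ne (hmin y ⟨⟨hy.2.1, hy.1⟩, h.symm⟩) fun e => ?_⟩
          exact hy.2.2 (hi.eq (h.symm.trans hka.symm) e.symm)
    have h1 := hF.min₁ a haX
    have h2 := hF.min₂ a haX
    have hka' := hkx a
    rcases h1.lt_or_eq with h1 | h1
    · rcases h2.lt_or_eq with h2 | h2
      · have h3 := hF.lt hp.mem hp.ne hp.eq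
        have h4 := hF.symm.lt hq.mem hq.ne hq.eq
        have hm : ∀ x, ((g₂ a - g₂ u) • g₁ - (g₁ a - g₁ u) • g₂) x -
            ((g₂ a - g₂ u) • g₁ - (g₁ a - g₁ u) • g₂) u =
            (g₂ a - g₂ u) * (g₁ x - g₁ u) - (g₁ a - g₁ u) * (g₂ x - g₂ u) := fun x => by
          simp; ring
        refine H.pair_supports hau.symm hF.mem haX hsep
          (m := (g₂ a - g₂ u) • g₁ - (g₁ a - g₁ u) • g₂) ?_ hp.mem ?_ hq.mem ?_
        · have := hm a; linarith
        · have := hm p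
          have := mul_pos (sub_pos.2 h1) (sub_pos.2 h3)
          rw [hp.eq] at *
          linarith
        · have := hm q
          have := mul_pos (sub_pos.2 h2) (sub_pos.2 h4)
          rw [hq.eq] at *
          linarith
      · have h5 := hq.min a haX hau h2.symm
        have := mul_le_mul_of_nonneg_left (sub_le_sub_right h5 (g₁ u)) hα.le
        rw [← h2] at hka'
        linarith
    · have h5 := hp.min a haX hau h1.symm
      have := mul_le_mul_of_nonneg_left (sub_le_sub_right h5 (g₂ u)) hβ.le
      rw [← h1] at hka'
      linarith
  -- With a further point on the line `pq` two different triangles can be cut off: `u` with the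
  -- first two points of this line, and `u` with the last two.
  have hky₀ : k y₀ = k p := le_antisymm hky₀ (hlow y₀ hy₀ hy₀u)
  obtain ⟨e₁, he₁, hmin₁⟩ := {x ∈ X | k x = k p ∧ x ≠ p}.exists_min_image g₁
    ⟨y₀, by simp [hy₀, hky₀, hy₀p]⟩
  obtain ⟨e₂, he₂, hmax₂⟩ := {x ∈ X | k x = k p ∧ x ≠ q}.exists_max_image g₁
    ⟨y₀, by simp [hy₀, hky₀, hy₀q]⟩
  simp only [Finset.mem_filter] at he₁ he₂ hmin₁ hmax₂
  have hne_u : ∀ x, k x = k p → x ≠ u := fun x hx e => by rw [e] at hx; linarith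
  have he₂p : e₂ ≠ p := by
    rintro rfl
    have := hmax₂ y₀ ⟨hy₀, hky₀, hy₀q⟩
    rw [hp.eq] at this
    have h1 := le_antisymm this (hF.min₁ y₀ hy₀)
    exact hy₀p (hi.eq hky₀ (h1.trans hp.eq.symm))
  have hcut₁ : CutTriangle X {u, p, e₁} := by
    refine ⟨?_, ?_, ?_, ?_⟩
    · intro x hx
      simp only [Finset.mem_insert, Finset.mem_singleton] at hx
      rcases hx with rfl | rfl | rfl
      exacts [hF.mem, hp.mem, he₁.1]
    · exact Finset.card_eq_three.2 ⟨u, p, e₁, hp.ne.symm, (hne_u _ he₁.2.1).symm,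
        he₁.2.2.symm, rfl⟩
    · exact not_col_triple (g := k) he₁.2.2.symm he₁.2.1.symm (by linarith)
    · refine sep_of_lex k g₁ fun x hx y hy => ?_
      simp only [Finset.mem_sdiff, Finset.mem_insert, Finset.mem_singleton, not_or] at hx hy
      obtain ⟨hyX, hyu, hyp, hye⟩ := hy
      have hl := hlow y hyX hyu
      rcases hx with rfl | rfl | rfl
      · exact Or.inl (hku y hyX hyu)
      · rcases hl.lt_or_eq with h | h
        · exact Or.inl h
        · exact Or.inr ⟨h, by
            rw [hp.eq]
            exact lt_of_le_of_ne (hF.min₁ y hyX) fun e => hyp (hi.eq h.symm (by rw [← e, hp.eq]))⟩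
      · rcases hl.lt_or_eq with h | h
        · left; rw [he₁.2.1]; exact h
        · exact Or.inr ⟨he₁.2.1.trans h, lt_of_le_of_ne (hmin₁ y ⟨hyX, h.symm, hyp⟩)
            fun e => hye (hi.eq (h.symm.trans he₁.2.1.symm) e.symm)⟩
  have hcut₂ : CutTriangle X {u, q, e₂} := by
    refine ⟨?_, ?_, ?_, ?_⟩
    · intro x hx
      simp only [Finset.mem_insert, Finset.mem_singleton] at hx
      rcases hx with rfl | rfl | rfl
      exacts [hF.mem, hq.mem, he₂.1]
    · exact Finset.card_eq_three.2 ⟨u, q, e₂, hq.ne.symm, (hne_u _ he₂.2.1).symm,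
        he₂.2.2.symm, rfl⟩
    · exact not_col_triple (g := k) he₂.2.2.symm (by linarith [he₂.2.1]) (by linarith)
    · refine sep_of_lex k (-g₁) fun x hx y hy => ?_
      simp only [Finset.mem_sdiff, Finset.mem_insert, Finset.mem_singleton, not_or] at hx hy
      obtain ⟨hyX, hyu, hyq, hye⟩ := hy
      have hl := hlow y hyX hyu
      simp only [LinearMap.neg_apply, neg_lt_neg_iff]
      rcases hx with rfl | rfl | rfl
      · exact Or.inl (hku y hyX hyu)
      · rcases hl.lt_or_eq with h | h
        · left; linarith
        · right
          refine ⟨by linarith, ?_⟩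
          -- On a line where `k` is constant `g₁` is largest where `g₂` is least, and that is at
          -- `q`.
          have h1 := hkx y
          have h2 := mul_nonneg hβ.le (sub_nonneg.2 (hF.min₂ y hyX))
          have h3 : α * (g₁ y - g₁ x) ≤ 0 := by linarith
          have h4 : g₁ y ≤ g₁ x := by
            by_contra hlt
            have := mul_pos hα (sub_pos.2 (not_le.1 hlt))
            linarith
          exact lt_of_le_of_ne h4 fun e => hyq (hi.eq (by linarith) e)
      · rcases hl.lt_or_eq with h | h
        · left; rw [he₂.2.1]; exact h
        · exact Or.inr ⟨he₂.2.1.trans h, lt_of_le_of_ne (hmax₂ y ⟨hyX, h.symm, hyq⟩)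
            fun e => hye (hi.eq (h.symm.trans he₂.2.1.symm) e)⟩
  obtain ⟨S₁, hS₁⟩ := H _ hcut₁
  obtain ⟨S₂, hS₂⟩ := H _ hcut₂
  have hset : ∀ a b : Plane, X \ {u, a, b} = X.erase u \ {a, b} := fun a b => by
    ext x; simp; tauto
  rw [hset] at hS₁ hS₂
  -- Without `u` the point `p` is a corner, and one of its edges leaves the line `pq`. The first
  -- deletion takes only `p` from that edge and the second takes nothing, which parity forbids.
  have hpc : Corner (X.erase u) p := by
    refine corner_of_lex (Finset.mem_erase.2 ⟨hp.ne, hp.mem⟩) k g₁ fun y hy hyp => ?_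
    have hy' := Finset.mem_erase.1 hy
    rcases (hlow y hy'.2 hy'.1).lt_or_eq with h | h
    · exact Or.inl h
    · exact Or.inr ⟨h, by
        rw [hp.eq]
        exact lt_of_le_of_ne (hF.min₁ y hy'.2) fun e => hyp (hi.eq h.symm (by rw [← e, hp.eq]))⟩
  obtain ⟨h₁, h₂, hW⟩ := exists_frame hpc fun h => hS₁.not_col' (h.mono Finset.sdiff_subset)
  obtain ⟨g, hg, hmin, ⟨y, hy, hyp, hgy⟩, hge⟩ : ∃ g : Functional, g ≠ 0 ∧
      (∀ y ∈ X.erase u, g p ≤ g y) ∧ (∃ y ∈ X.erase u, y ≠ p ∧ g y = g p) ∧ g e₁ ≠ g p := by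
    by_cases he : h₁ e₁ = h₁ p
    · exact ⟨h₂, hW.indep.right_ne_zero, hW.min₂, hW.ex₂, fun h => he₁.2.2 (hW.indep.eq he h)⟩
    · exact ⟨h₁, hW.indep.left_ne_zero, hW.min₁, hW.ex₁, he⟩
  have honly : ∀ x, k x = k p → g x = g p → x = p := by
    intro x hx hgx
    by_contra hne
    have := proportional (Ne.symm hne) hgx.symm hx.symm e₁ u
    rw [he₁.2.1, sub_self, mul_zero, mul_eq_zero] at this
    rcases this with h | h
    · exact hge (sub_eq_zero.1 h)
    · linarith
  refine hS₁.parity_contradiction hS₂ hg hmin (Finset.mem_erase.2 ⟨hp.ne, hp.mem⟩) ?_ ?_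
    hy hyp hgy
  · intro x hx hgx
    simp only [Finset.mem_insert, Finset.mem_singleton, or_iff_left_iff_imp]
    rintro rfl
    exact absurd hgx hge
  · intro x hx hgx hxm
    simp only [Finset.mem_insert, Finset.mem_singleton] at hxm
    rcases hxm with rfl | rfl
    · exact hpq (honly x (by linarith) hgx).symm
    · exact he₂p (honly x he₂.2.1 hgx)

theorem CutsTight.corner_cutTriangle {X : Finset Plane} (H : CutsTight X) {u p q : Plane}
    {g₁ g₂ : Functional} (hF : Frame X u g₁ g₂) (hp : Nearest X u g₁ g₂ p)
    (hq : Nearest X u g₂ g₁ q) : CutTriangle X {u, p, q} := by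
  obtain ⟨k, h1, h2, h3⟩ := H.corner_cut hF hp hq
  have hpq := hp.ne_nearest hF hq
  refine ⟨?_, ?_, ?_, ?_⟩
  · intro x hx
    simp only [Finset.mem_insert, Finset.mem_singleton] at hx
    rcases hx with rfl | rfl | rfl
    exacts [hF.mem, hp.mem, hq.mem]
  · exact Finset.card_eq_three.2 ⟨u, p, q, hp.ne.symm, hq.ne.symm, hpq, rfl⟩
  · exact not_col_triple hpq h1 h2.ne
  · refine sep_of_lex k 0 fun x hx y hy => Or.inl ?_
    simp only [Finset.mem_sdiff, Finset.mem_insert, Finset.mem_singleton, not_or] at hx hy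
    have := h3 y hy.1 hy.2.1 hy.2.2.1 hy.2.2.2
    rcases hx with rfl | rfl | rfl <;> linarith

/-- The other end of an edge of the hull. -/
theorem Frame.exists_other_end {X : Finset Plane} {u : Plane} {g₁ g₂ : Functional}
    (hF : Frame X u g₁ g₂) : ∃ (v : Plane) (s : ℝ), v ≠ u ∧ g₁ v = g₁ u ∧
      (∀ y ∈ X, g₁ y = g₁ u → g₂ y ≤ g₂ v) ∧ Frame X v g₁ (-g₂ - s • g₁) := by
  obtain ⟨y, hy, hyu, hgy⟩ := hF.ex₁
  obtain ⟨v, hv, hmax⟩ := {x ∈ X | g₁ x = g₁ u}.exists_max_image g₂ ⟨y, by simp [hy, hgy]⟩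
  simp only [Finset.mem_filter] at hv hmax
  have hvu : v ≠ u := by
    rintro rfl
    exact absurd (hmax y ⟨hy, hgy⟩) (not_le.2 (hF.lt hy hyu hgy))
  have hi : Independent g₁ (-g₂) := fun z h1 h2 => hF.indep z h1 (by simpa using h2)
  obtain ⟨z, hz, hzu, hgz⟩ := hF.ex₂
  obtain ⟨s, hs1, hs2⟩ := exists_next_edge (X := X) (v := v) (g := g₁) (φ := -g₂)
    (by rw [hv.2]; exact hF.min₁) (fun y hy hyv he => by
      simpa using lt_of_le_of_ne (hmax y ⟨hy, he.trans hv.2⟩) fun e => hyv (hF.indep.eq he e))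
    ⟨z, hz, by rw [hv.2]; exact hF.symm.lt hz hzu hgz⟩
  exact ⟨v, s, hvu, hv.2, fun y hy he => hmax y ⟨hy, he⟩, hv.1, by rw [hv.2]; exact hF.min₁, hs1,
    independent_sub_smul hi s, ⟨u, hF.mem, hvu.symm, hv.2.symm⟩, hs2⟩

/-- Each edge of the hull contains at least three points. -/
theorem CutsTight.exists_third {X : Finset Plane} (H : CutsTight X) (hX : 4 ≤ X.card)
    {u p : Plane} {g₁ g₂ : Functional} (hF : Frame X u g₁ g₂) (hp : Nearest X u g₁ g₂ p) :
    ∃ y ∈ X, y ≠ u ∧ y ≠ p ∧ g₁ y = g₁ u := by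
  by_contra! hcon
  obtain ⟨v, s, hvu, hgv, -, hF'⟩ := hF.exists_other_end
  obtain rfl : v = p := by
    by_contra hne
    exact hcon v hF'.mem hvu hne hgv
  obtain ⟨q, hq⟩ := hF.symm.exists_nearest
  obtain ⟨q', hq'⟩ := hF'.symm.exists_nearest
  have hu : Nearest X v g₁ (-g₂ - s • g₁) u := by
    refine ⟨hF.mem, hvu.symm, hgv.symm, fun y hy hyv he => ?_⟩
    have : y = u := by
      by_contra hne
      exact hcon y hy hne hyv (he.trans hgv)
    rw [this]
  -- If the edge consists of `u` and `v` only, the ears at both ends share these two vertices, so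
  -- they are the same triangle.
  have hc := H.corner_cutTriangle hF hp hq
  have hc' := H.corner_cutTriangle hF' hu hq'
  rw [show ({v, u, q'} : Finset Plane) = {u, v, q'} by ext; simp; tauto] at hc'
  obtain rfl := H.eq_of_cut hc hc'
  obtain ⟨k, h1, h2, h3⟩ := H.corner_cut hF hp hq
  obtain ⟨y, hy, hym⟩ : ∃ y ∈ X, y ∉ ({u, v, q} : Finset Plane) := by
    by_contra! hsub
    have := Finset.card_le_card (show X ⊆ {u, v, q} from hsub)
    have := hc.card
    omega
  simp only [Finset.mem_insert, Finset.mem_singleton, not_or] at hym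
  have h4 := h3 y hy hym.1 hym.2.1 hym.2.2
  have h5 := hF'.lt hF.mem hvu.symm hgv.symm
  have h6 := hF'.min₂ y hy
  -- The line `vq` would support `X`, although `u` and the fourth point `y` are strictly on
  -- different sides of it.
  have h7 := proportional (hp.ne_nearest hF hq) hq'.eq.symm h1 u y
  have h8 := mul_pos (sub_pos.2 h5) (sub_pos.2 h4)
  have h9 := mul_nonneg (sub_nonneg.2 h6) (sub_pos.2 h2).le
  linarith

/-! ### Comparing the tight sets left by two ears -/

theorem Corner.mono {X Y : Finset Plane} {v : Plane} (h : Corner X v) (hYX : Y ⊆ X)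
    (hv : v ∈ Y) : Corner Y v := by
  obtain ⟨-, f, hf⟩ := h
  exact ⟨hv, f, fun y hy => hf y (hYX hy)⟩

theorem Nearest.mono {X Y : Finset Plane} {v p : Plane} {g₁ g₂ : Functional}
    (h : Nearest X v g₁ g₂ p) (hYX : Y ⊆ X) (hp : p ∈ Y) : Nearest Y v g₁ g₂ p :=
  ⟨hp, h.ne, h.eq, fun y hy => h.min y (hYX hy)⟩

theorem Frame.mono {X Y : Finset Plane} {v p q : Plane} {g₁ g₂ : Functional}
    (h : Frame X v g₁ g₂) (hYX : Y ⊆ X) (hv : v ∈ Y) (hp : Nearest X v g₁ g₂ p) (hpY : p ∈ Y)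
    (hq : Nearest X v g₂ g₁ q) (hqY : q ∈ Y) : Frame Y v g₁ g₂ :=
  ⟨hv, fun y hy => h.min₁ y (hYX hy), fun y hy => h.min₂ y (hYX hy), h.indep,
    ⟨p, hpY, hp.ne, hp.eq⟩, ⟨q, hqY, hq.ne, hq.eq⟩⟩

/-- The line through all but one point of a tight set. -/
theorem Tight.exists_line_face {X S Y : Finset Plane} (h : Tight X S) {v : Plane} (hv : v ∈ S)
    (hYX : Y ⊆ X) (hY : Indep Y (S.erase v)) (hc : Col (S.erase v)) :
    ∃ g : Functional, g ≠ 0 ∧ ∃ c, (∀ x ∈ X, c ≤ g x) ∧ {x ∈ X | g x = c} ⊆ Y ∧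
      2 * S.card = {x ∈ X | g x = c}.card + 3 ∧
      ∀ x, x ∈ S.erase v ↔ x ∈ S ∧ x ∈ X ∧ g x = c := by
  obtain ⟨g, hg, c, hgc, hgv, hsup⟩ := h.exists_line hc
  have h3 := h.three_le
  have hce : (S.erase v).card = S.card - 1 := Finset.card_erase_of_mem hv
  -- The distinct blockers next to `v` leave room for at most `2|S| - 3` points of `X` on the line,
  -- and the independence of `S.erase v` in `Y` already needs that many in `Y`.
  have h1 := card_line_add_le h.indep hv hgc hgv.ne'
  have h2 := card_le_of_line _ Y (S.erase v) rfl hY (Finset.card_pos.1 (by omega)) hgc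
  have hsub : ({x ∈ Y | g x = c} : Finset Plane) ⊆ {x ∈ X | g x = c} :=
    Finset.filter_subset_filter _ hYX
  have h4 := Finset.card_le_card hsub
  have h5 := h.card_eq
  have heq := Finset.eq_of_subset_of_card_le hsub (by omega)
  refine ⟨g, hg, c, hsup, ?_, by omega, fun x => ⟨fun hx => ?_, fun hx => ?_⟩⟩
  · rw [← heq]; exact Finset.filter_subset _ _
  · exact ⟨Finset.mem_of_mem_erase hx, h.indep.1 (Finset.mem_of_mem_erase hx), hgc x hx⟩
  · refine Finset.mem_erase.2 ⟨?_, hx.1⟩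
    rintro rfl
    exact hgv.ne' hx.2.2

/-- The points of `X₁` on the line through `S₁.erase v` are also a face of `Y₂`: they all belong to
`C`, and parity excludes the loss of a single one. Both sets alternate along this face from the same
end, so the first is contained in the second, and they have equally many points. -/
theorem erase_eq_of_col_left {X₁ S₁ S₂ Y₁ Y₂ C : Finset Plane} {u v : Plane}
    (h₁ : Tight X₁ S₁) (hv : v ∈ S₁) (hu : u ∈ S₂) (hcard : S₁.card = S₂.card)
    (hC : C ⊆ X₁) (hY₁ : Indep Y₁ (S₁.erase v)) (hYC : Y₁ ⊆ C)
    (hY₂ : Y₂ = C ∨ ∃ q, Y₂ = C \ {q}) (hT : Tight Y₂ (S₂.erase u)) (hc : Col (S₁.erase v)) :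
    S₁.erase v = S₂.erase u := by
  obtain ⟨g, hg, c, hsup, hLY, hL, hmem⟩ := h₁.exists_line_face hv (hYC.trans hC) hY₁ hc
  have hY₂C : Y₂ ⊆ C := by
    rcases hY₂ with rfl | ⟨q, rfl⟩
    · exact subset_rfl
    · exact Finset.sdiff_subset
  have h3 := h₁.three_le
  have hface : {x ∈ Y₂ | g x = c} = {x ∈ X₁ | g x = c} := by
    refine Finset.Subset.antisymm (Finset.filter_subset_filter _ (hY₂C.trans hC)) fun x hx => ?_
    have hx' := Finset.mem_filter.1 hx
    refine Finset.mem_filter.2 ⟨?_, hx'.2⟩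
    rcases hY₂ with rfl | ⟨q, rfl⟩
    · exact hYC (hLY hx)
    · refine Finset.mem_sdiff.2 ⟨hYC (hLY hx), fun hxq => ?_⟩
      rw [Finset.mem_singleton] at hxq
      subst hxq
      have e : ({y ∈ C \ {x} | g y = c} : Finset Plane) = {y ∈ X₁ | g y = c}.erase x := by
        ext y
        simp only [Finset.mem_filter, Finset.mem_sdiff, Finset.mem_singleton, Finset.mem_erase]
        constructor
        · rintro ⟨⟨h1, h2⟩, h3⟩; exact ⟨h2, hC h1, h3⟩
        · rintro ⟨h1, h2, h3⟩
          exact ⟨⟨hYC (hLY (Finset.mem_filter.2 ⟨h2, h3⟩)), h1⟩, h3⟩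
      have hce : ({y ∈ C \ {x} | g y = c} : Finset Plane).card + 1 =
          ({y ∈ X₁ | g y = c} : Finset Plane).card := by
        rw [e, Finset.card_erase_add_one hx]
      obtain ⟨y, hy⟩ := Finset.card_pos.1
        (show 0 < ({y ∈ C \ {x} | g y = c} : Finset Plane).card by omega)
      have hy' := Finset.mem_filter.1 hy
      have ho := hT.odd_face hg (c := c) (fun y hy => hsup y (hC (hY₂C hy))) ⟨y, hy'⟩
      obtain ⟨a, ha⟩ := ho
      omega
  obtain ⟨f, hf⟩ := exists_injOn X₁
  apply Finset.eq_of_subset_of_card_le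
  · intro x hx
    have hx' := (hmem x).1 hx
    have hxY : x ∈ ({x ∈ Y₂ | g x = c} : Finset Plane) := by
      rw [hface]; exact Finset.mem_filter.2 hx'.2
    have hxY' := Finset.mem_filter.1 hxY
    rw [hT.mem_iff_even hg (f := f)
      (fun a ha b hb e => hf (hC (hY₂C ha.1)) (hC (hY₂C hb.1)) e)
      (fun y hy => hsup y (hC (hY₂C hy))) _ x rfl hxY'.1 hxY'.2, ← Finset.filter_filter, hface,
      Finset.filter_filter]
    exact (h₁.mem_iff_even hg (fun a ha b hb e => hf ha.1 hb.1 e) hsup _ x rfl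
      hx'.2.1 hx'.2.2).1 hx'.1
  · rw [Finset.card_erase_of_mem hv, Finset.card_erase_of_mem hu, hcard]

/-- If neither remainder is collinear, both are tight in `Y₁` and `Y₂`; these sets are equal,
distinct deleted points being excluded by `Tight.corner_contradiction`, and uniqueness applies. A
collinear remainder is compared along its line, which is a face. -/
theorem erase_eq_erase {X₁ X₂ S₁ S₂ Y₁ Y₂ C : Finset Plane} {u v : Plane}
    (h₁ : Tight X₁ S₁) (h₂ : Tight X₂ S₂) (hv : v ∈ S₁) (hu : u ∈ S₂)
    (hX : X₁.card = X₂.card) (hC₁ : C ⊆ X₁) (hC₂ : C ⊆ X₂)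
    (hY₁ : Indep Y₁ (S₁.erase v)) (hY₂ : Indep Y₂ (S₂.erase u))
    (hc₁ : Y₁.card + 3 = X₁.card) (hc₂ : Y₂.card + 3 = X₂.card)
    (hY : (Y₁ = C ∧ Y₂ = C) ∨
      ∃ q₁ q₂, Corner C q₁ ∧ Y₁ = C \ {q₁} ∧ Y₂ = C \ {q₂}) :
    S₁.erase v = S₂.erase u := by
  have e₁ := h₁.card_eq
  have e₂ := h₂.card_eq
  have hcard : S₁.card = S₂.card := by omega
  have ce₁ := Finset.card_erase_of_mem hv
  have ce₂ := Finset.card_erase_of_mem hu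
  have t₁ := h₁.three_le
  have hY₁C : Y₁ ⊆ C := by
    rcases hY with ⟨rfl, -⟩ | ⟨q, _, _, rfl, -⟩
    exacts [subset_rfl, Finset.sdiff_subset]
  have hY₂C : Y₂ ⊆ C := by
    rcases hY with ⟨-, rfl⟩ | ⟨_, q, _, -, rfl⟩
    exacts [subset_rfl, Finset.sdiff_subset]
  by_cases hcol₁ : Col (S₁.erase v) <;> by_cases hcol₂ : Col (S₂.erase u)
  · obtain ⟨g, hg, c, hsup, hLY, hL, hmem⟩ :=
      h₁.exists_line_face hv (hY₁C.trans hC₁) hY₁ hcol₁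
    obtain ⟨g', hg', c', hsup', hLY', hL', hmem'⟩ :=
      h₂.exists_line_face hu (hY₂C.trans hC₂) hY₂ hcol₂
    set L := ({x ∈ X₁ | g x = c} : Finset Plane) with hLdef
    set L' := ({x ∈ X₂ | g' x = c'} : Finset Plane) with hLdef'
    -- With `k = |S₁|`, two lines with `2k - 3` points each inside a set of at most `3k - 5` points
    -- share at least `k - 1 ≥ 2` points, so they coincide.
    have hCc : C.card ≤ Y₁.card + 1 := by
      rcases hY with ⟨rfl, -⟩ | ⟨q, _, _, rfl, -⟩
      · omega
      · have := Finset.le_card_sdiff {q} C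
        simp at this ⊢; omega
    have hun := Finset.card_le_card
      (Finset.union_subset (hLY.trans hY₁C) (hLY'.trans hY₂C))
    have hui := Finset.card_union_add_card_inter L L'
    obtain ⟨a, ha, b, hb, hab⟩ := Finset.one_lt_card.1 (show 1 < (L ∩ L').card by omega)
    simp only [hLdef, hLdef', Finset.mem_inter, Finset.mem_filter] at ha hb
    have hline : ∀ x, g x = c ↔ g' x = c' := by
      obtain ⟨w, hw⟩ := exists_ne_zero hg
      obtain ⟨w', hw'⟩ := exists_ne_zero hg'
      have hga : g a = g b := ha.1.2.trans hb.1.2.symm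
      have hga' : g' a = g' b := ha.2.2.trans hb.2.2.symm
      intro x
      constructor
      · intro hx
        have := proportional hab hga hga' x (a + w)
        rw [hx, ha.1.2, ha.2.2] at this
        simp [ha.1.2, hw] at this
        linarith
      · intro hx
        have := proportional hab hga hga' x (a + w')
        rw [hx, ha.1.2, ha.2.2] at this
        simp [ha.2.2, hw'] at this
        linarith
    have hLL : L = L' := by
      ext x
      constructor
      · intro hx
        exact Finset.mem_filter.2 ⟨hC₂ (hY₁C (hLY hx)), (hline x).1 (Finset.mem_filter.1 hx).2⟩
      · intro hx
        exact Finset.mem_filter.2 ⟨hC₁ (hY₂C (hLY' hx)), (hline x).2 (Finset.mem_filter.1 hx).2⟩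
    obtain ⟨f, hf⟩ := exists_injOn (X₁ ∪ X₂)
    have hinj₁ : Set.InjOn f {y | y ∈ X₁ ∧ g y = c} := fun a ha b hb e =>
      hf (by simp [ha.1]) (by simp [hb.1]) e
    have hinj₂ : Set.InjOn f {y | y ∈ X₂ ∧ g' y = c'} := fun a ha b hb e =>
      hf (by simp [ha.1]) (by simp [hb.1]) e
    ext x
    have key : x ∈ X₁ ∧ g x = c ↔ x ∈ X₂ ∧ g' x = c' := by
      have := congrArg (x ∈ ·) hLL
      simpa [hLdef, hLdef'] using this
    rw [hmem, hmem', ← key, and_congr_left_iff]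
    intro hx
    rw [h₁.mem_iff_even hg hinj₁ hsup _ x rfl hx.1 hx.2,
      h₂.mem_iff_even hg' hinj₂ hsup' _ x rfl (key.1 hx).1 (key.1 hx).2,
      ← Finset.filter_filter, ← Finset.filter_filter, ← hLdef, ← hLdef', hLL]
  · refine erase_eq_of_col_left h₁ hv hu hcard hC₁ hY₁ hY₁C ?_ ⟨hY₂, hcol₂, by omega⟩ hcol₁
    rcases hY with ⟨-, h⟩ | ⟨_, q, _, -, h⟩
    exacts [Or.inl h, Or.inr ⟨q, h⟩]
  · refine (erase_eq_of_col_left h₂ hu hv hcard.symm hC₂ hY₂ hY₂C ?_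
      ⟨hY₁, hcol₁, by omega⟩ hcol₂).symm
    rcases hY with ⟨h, -⟩ | ⟨q, _, _, h, -⟩
    exacts [Or.inl h, Or.inr ⟨q, h⟩]
  · have T₁ : Tight Y₁ (S₁.erase v) := ⟨hY₁, hcol₁, by omega⟩
    have T₂ : Tight Y₂ (S₂.erase u) := ⟨hY₂, hcol₂, by omega⟩
    rcases hY with ⟨rfl, rfl⟩ | ⟨q₁, q₂, hq₁, rfl, rfl⟩
    · rw [T₁.eq_alternate, T₂.eq_alternate]
    · by_cases hq : q₁ = q₂
      · subst hq
        rw [T₁.eq_alternate, T₂.eq_alternate]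
      · exact (Tight.corner_contradiction hq₁ hq T₁ T₂).elim

/-- The next edge at a corner, after the other neighbour has been cut off. -/
theorem Tight.exists_second_ear {Y S : Finset Plane} (h : Tight Y S) {v q : Plane}
    {g₁ g₃ : Functional} (hv : v ∈ Y) (hmin : ∀ y ∈ Y, g₃ v ≤ g₃ y) (hi : Independent g₃ g₁)
    (hlt : ∀ y ∈ Y, y ≠ v → g₃ y = g₃ v → g₁ v < g₁ y) (hq : Nearest Y v g₃ g₁ q) :
    ∃ r, r ∈ Y ∧ r ≠ v ∧ r ≠ q ∧ (Y \ {v, q, r}).card + 3 = Y.card ∧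
      Indep (Y \ {v, q, r}) (S.erase v) ∧ Corner (Y \ {v, q}) r := by
  obtain ⟨t, ht1, ht2⟩ := exists_next_edge (φ := g₁) hmin hlt (by
    by_contra! hcon
    exact h.not_col' ⟨g₃, hi.left_ne_zero, _, fun y hy => le_antisymm (hcon y hy) (hmin y hy)⟩)
  have hF : Frame Y v g₃ (g₁ - t • g₃) := ⟨hv, hmin, ht1, independent_sub_smul hi t,
    ⟨q, hq.mem, hq.ne, hq.eq⟩, ht2⟩
  have hq' : Nearest Y v g₃ (g₁ - t • g₃) q := ⟨hq.mem, hq.ne, hq.eq, fun y hy hyv he => by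
    have := hq.min y hy hyv he
    simp [he, hq.eq, this]⟩
  obtain ⟨r, hr⟩ := hF.symm.exists_nearest
  refine ⟨r, hr.mem, hr.ne, (hq'.ne_nearest hF hr).symm, card_sdiff_ear hF hq' hr,
    h.indep.ear hF hq' hr (h.corner_mem hF.corner), ?_⟩
  refine corner_of_lex (by simp [hr.mem, hr.ne, (hq'.ne_nearest hF hr).symm]) (g₁ - t • g₃) g₃
    fun y hy hyr => ?_
  simp only [Finset.mem_sdiff, Finset.mem_insert, Finset.mem_singleton, not_or] at hy
  rw [hr.eq]
  rcases (hF.min₂ y hy.1).lt_or_eq with h1 | h1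
  · exact Or.inl h1
  · refine Or.inr ⟨h1, lt_of_le_of_ne (hr.min y hy.1 hy.2.1 h1.symm) fun e => hyr ?_⟩
    exact hF.indep.eq e.symm (by rw [← h1, hr.eq])

/-- If every cut triangle leaves a set with a tight subset then the whole set has too large an
independent set. -/
theorem CutsTight.bad {X : Finset Plane} (H : CutsTight X) (hX : 4 ≤ X.card) (hcol : ¬ Col X) :
    Bad X := by
  obtain ⟨u, hu⟩ := exists_corner (X := X) (Finset.card_pos.1 (by omega))
  obtain ⟨g₁, g₂, hF⟩ := exists_frame hu hcol
  obtain ⟨p, hp⟩ := hF.exists_nearest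
  obtain ⟨q, hq⟩ := hF.symm.exists_nearest
  obtain ⟨v, s, hvu, hgv, hvmax, hF'⟩ := hF.exists_other_end
  set g₃ := -g₂ - s • g₁ with hg₃
  obtain ⟨p', hp'⟩ := hF'.exists_nearest
  obtain ⟨q', hq'⟩ := hF'.symm.exists_nearest
  have hT := H.corner_cutTriangle hF hp hq
  have hT' := H.corner_cutTriangle hF' hp' hq'
  obtain ⟨S, hS⟩ := H _ hT
  obtain ⟨S', hS'⟩ := H _ hT'
  obtain ⟨y, hy, hyu, hyp, hgy⟩ := H.exists_third hX hF hp
  have hg₁q := hF.symm.lt hq.mem hq.ne hq.eq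
  have hg₁q' := hF'.symm.lt hq'.mem hq'.ne hq'.eq
  have hg₃u := hF'.lt hF.mem hvu.symm hgv.symm
  -- The edge `uv` has a third point, so neither end is the neighbour of the other.
  have hvp : v ≠ p := by
    rintro rfl
    exact hyp (hF.indep.eq (hgy.trans hgv.symm)
      (le_antisymm (hvmax y hy hgy) (hp.min y hy hyu hgy)))
  have hup' : u ≠ p' := by
    rintro rfl
    have hyv : y ≠ v := by
      rintro rfl
      obtain ⟨-, hx, -⟩ := hT.ne
      have h1 := hp'.min p hp.mem hvp.symm (hp.eq.trans hgv.symm)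
      have h2 := hF.lt hp.mem hp.ne hp.eq
      simp [hg₃, hp.eq] at h1
      linarith
    have h1 := hp'.min y hy hyv (hgy.trans hgv.symm)
    have h2 := hF.lt hy hyu hgy
    simp [hg₃, hgy] at h1
    linarith
  have hne_q : ∀ x, g₁ x = g₁ u → x ≠ q := fun x hx e => by rw [e] at hx; linarith
  have hne_q' : ∀ x, g₁ x = g₁ u → x ≠ q' := fun x hx e => by rw [e] at hx; linarith
  have hp'e : g₁ p' = g₁ u := hp'.eq.trans hgv
  -- The other edge at `u` has a third point `z` as well, so a common neighbour would lie between
  -- `u` and `z`; the supporting line through it and `v` would then contain `u`.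
  have hqq' : q ≠ q' := by
    obtain ⟨z, hz, hzu, hzq, hgz⟩ := H.exists_third hX hF.symm hq
    rintro rfl
    have h1 := lt_of_le_of_ne (hq.min z hz hzu hgz) fun e =>
      hzq (hF.indep.eq e.symm (hgz.trans hq.eq.symm))
    have h2 := mem_openSegment_of hF.indep.right_ne_zero hgz.symm hq.eq hg₁q h1
    have h3 := eq_of_mem_openSegment_of_le h2 (hF'.min₂ u hF.mem) (hF'.min₂ z hz) hq'.eq.le
    linarith [h3.1]
  set P := X \ {u, p, q} with hP
  set P' := X \ {v, p', q'} with hP'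
  have hvP : v ∈ P := by simp [hP, hF'.mem, hvu, hvp, hne_q v hgv]
  have huP' : u ∈ P' := by simp [hP', hF.mem, hvu.symm, hup', hne_q' u rfl]
  have hPX : P ⊆ X := Finset.sdiff_subset
  have hP'X : P' ⊆ X := Finset.sdiff_subset
  have hvS : v ∈ S := hS.corner_mem (hF'.corner.mono hPX hvP)
  have huS' : u ∈ S' := hS'.corner_mem (hF.corner.mono hP'X huP')
  have hcP : P.card + 3 = X.card := card_sdiff_ear hF hp hq
  have hcP' : P'.card + 3 = X.card := card_sdiff_ear hF' hp' hq'
  have hq'P : q' ∈ P := by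
    simp [hP, hq'.mem, (hne_q' u rfl).symm, (hne_q' p hp.eq).symm, hqq'.symm]
  have hqP' : q ∈ P' := by
    simp [hP', hq.mem, (hne_q v hgv).symm, (hne_q p' hp'e).symm, hqq']
  -- Deleting a second ear, at `v` from `P` and at `u` from `P'`, leaves the same set, except for
  -- one point in the case `p = p'`.
  have hmatch : S.erase v = S'.erase u := by
    by_cases hpp : p = p'
    -- If `p = p'`, the only inner point of the edge has gone with the first ear, and the second ear
    -- takes its third point from a new hull edge.
    · have hface : ∀ x ∈ P, x ≠ v → g₁ v < g₁ x := by
        intro x hx hxv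
        simp only [hP, Finset.mem_sdiff, Finset.mem_insert, Finset.mem_singleton, not_or] at hx
        refine lt_of_le_of_ne (hF'.min₁ x hx.1) fun e => hx.2.2.1 ?_
        have h1 := hp'.min x hx.1 hxv e.symm
        have h2 := hp.min x hx.1 hx.2.1 (e.symm.trans hgv)
        have h3 : g₁ x = g₁ p := by rw [← e, hgv, hp.eq]
        rw [← hpp] at h1
        simp [hg₃, h3] at h1
        exact hF.indep.eq h3 (le_antisymm h1 h2)
      have hface' : ∀ x ∈ P', x ≠ u → g₁ u < g₁ x := by
        intro x hx hxu
        simp only [hP', Finset.mem_sdiff, Finset.mem_insert, Finset.mem_singleton, not_or] at hx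
        refine lt_of_le_of_ne (hF.min₁ x hx.1) fun e => hx.2.2.1 ?_
        have h1 := hp'.min x hx.1 hx.2.1 (e.symm.trans hgv.symm)
        have h2 := hp.min x hx.1 hxu e.symm
        have h3 : g₁ x = g₁ p := by rw [← e, hp.eq]
        rw [← hpp] at h1
        simp [hg₃, h3] at h1
        rw [← hpp]
        exact hF.indep.eq h3 (le_antisymm h1 h2)
      obtain ⟨r, hr, hrv, hrq, hcr, hir, hrc⟩ := hS.exists_second_ear hvP
        (fun y hy => hF'.min₂ y (hPX hy)) hF'.indep.symm (fun y hy hyv _ => hface y hy hyv)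
        (hq'.mono hPX hq'P)
      obtain ⟨r', hr', hru, hrq', hcr', hir', hrc'⟩ := hS'.exists_second_ear huP'
        (fun y hy => hF.min₂ y (hP'X hy)) hF.indep.symm (fun y hy hyv _ => hface' y hy hyv)
        (hq.mono hP'X hqP')
      have e₁ : P \ {v, q'} = P' \ {u, q} := by
        ext x; simp only [hP, hP', hpp, Finset.mem_sdiff, Finset.mem_insert,
          Finset.mem_singleton]; tauto
      exact erase_eq_erase (C := P \ {v, q'}) hS hS' hvS huS' (by omega) Finset.sdiff_subset
        (e₁ ▸ Finset.sdiff_subset) hir hir' hcr hcr'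
        (Or.inr ⟨r, r', hrc, sdiff_triple _ _ _, by rw [e₁, sdiff_triple]⟩)
    · have hp'P : p' ∈ P := by
        simp [hP, hp'.mem, hup'.symm, Ne.symm hpp, hne_q p' hp'e]
      have hpP' : p ∈ P' := by
        simp [hP', hp.mem, hvp.symm, hpp, hne_q' p hp.eq]
      have hFP := hF'.mono hPX hvP hp' hp'P hq' hq'P
      have hFP' := hF.mono hP'X huP' hp hpP' hq hqP'
      have e₁ : P \ {v, p', q'} = P' \ {u, p, q} := by
        ext x; simp only [hP, hP', Finset.mem_sdiff, Finset.mem_insert,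
          Finset.mem_singleton]; tauto
      exact erase_eq_erase (C := P \ {v, p', q'}) hS hS' hvS huS' (by omega) Finset.sdiff_subset
        (e₁ ▸ Finset.sdiff_subset)
        (hS.indep.ear hFP (hp'.mono hPX hp'P) (hq'.mono hPX hq'P) hvS)
        (hS'.indep.ear hFP' (hp.mono hP'X hpP') (hq.mono hP'X hqP') huS')
        (card_sdiff_ear hFP (hp'.mono hPX hp'P) (hq'.mono hPX hq'P))
        (card_sdiff_ear hFP' (hp.mono hP'X hpP') (hq.mono hP'X hqP'))
        (Or.inl ⟨rfl, e₁.symm⟩)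
  have huS : u ∉ S := fun h => by
    have := hS.indep.1 h
    simp [hP] at this
  have hpuv : p ∈ openSegment ℝ u v := by
    refine mem_openSegment_of hF.indep.left_ne_zero hgv.symm hp.eq (hF.lt hp.mem hp.ne hp.eq) ?_
    exact lt_of_le_of_ne (hvmax p hp.mem hp.eq) fun e =>
      hvp (hF.indep.eq (hgv.trans hp.eq.symm) e.symm)
  -- The point `p` blocks `u` from `v`; the other points of `S` belong to `S'`, which contains `u`.
  have hblock : ∀ x ∈ S, ∃ z ∈ X, z ∈ openSegment ℝ u x := by
    intro x hx
    by_cases hxv : x = v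
    · exact ⟨p, hp.mem, hxv ▸ hpuv⟩
    · have hx' : x ∈ S'.erase u := hmatch ▸ Finset.mem_erase.2 ⟨hxv, hx⟩
      obtain ⟨z, hz, hzs⟩ := hS'.indep.2 u huS' x (Finset.mem_of_mem_erase hx')
        (Finset.ne_of_mem_erase hx').symm
      exact ⟨z, hP'X hz, hzs⟩
  refine ⟨insert u S, ⟨Finset.insert_subset hF.mem (hS.indep.1.trans hPX), ?_⟩, ?_⟩
  · intro a ha b hb hab
    rcases Finset.mem_insert.1 ha with hau | ha <;> rcases Finset.mem_insert.1 hb with hbu | hb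
    · exact absurd (hau.trans hbu.symm) hab
    · rw [hau]; exact hblock b hb
    · obtain ⟨z, hz, hzs⟩ := hblock a ha
      exact ⟨z, hz, hbu ▸ mem_openSegment_swap hzs⟩
    · obtain ⟨z, hz, hzs⟩ := hS.indep.2 a ha b hb hab
      exact ⟨z, hPX hz, hzs⟩
  · rw [Finset.card_insert_of_notMem huS]
    have := hS.card
    omega

/-! ### Partitions into triangles by successive cuts -/

/-- Sets which are cut into triangles by successive lines. -/
inductive Guillotine : Finset Plane → Prop
  | empty : Guillotine ∅
  | triangle {T : Finset Plane} : T.card = 3 → ¬ Col T → Guillotine T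
  | join {A B : Finset Plane} : Sep A B → Guillotine A → Guillotine B → Guillotine (A ∪ B)

theorem Guillotine.cut {A B X : Finset Plane} (hA : Guillotine A) (hB : Guillotine B)
    (h : Sep A B) (hX : X = A ∪ B) : Guillotine X := hX ▸ .join h hA hB

/-! ### Cuts by a line turning about a point of a rich line -/

/-- For a point above the line `h = c`, the inclination of the line joining it to the point of
this line with `φ = γ`. -/
noncomputable def incl (h φ : Functional) (c γ : ℝ) (y : Plane) : ℝ := (γ - φ y) / (h y - c)

theorem incl_mul {h φ : Functional} {c γ : ℝ} {y : Plane} (hy : c < h y) :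
    incl h φ c γ y * (h y - c) = γ - φ y := by
  have : h y - c ≠ 0 := by linarith
  rw [incl]; field_simp

/-- The cut is made along the line from the pivot to a point of `D` of least inclination. Points of
`D` and `E` on this line are told apart by height, those of `D` being nearer to the pivot. -/
theorem sep_of_incl {h φ : Functional} {c γ : ℝ} {A B D E : Finset Plane} (hne : D.Nonempty)
    (hA : ∀ a ∈ A, h a = c ∧ φ a < γ) (hB : ∀ b ∈ B, h b = c ∧ γ < φ b)
    (hD : ∀ y ∈ D, c < h y) (hE : ∀ y ∈ E, c < h y)
    (H : ∀ a ∈ D, ∀ b ∈ E, incl h φ c γ b < incl h φ c γ a ∨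
      (incl h φ c γ b = incl h φ c γ a ∧ h a < h b)) : Sep (A ∪ D) (B ∪ E) := by
  obtain ⟨u, hu, hmin⟩ := D.exists_min_image (incl h φ c γ) hne
  have hk : ∀ y, c < h y → φ y + incl h φ c γ u * h y = γ + incl h φ c γ u * c +
      (incl h φ c γ u - incl h φ c γ y) * (h y - c) := fun y hy => by
    linear_combination incl_mul (φ := φ) (γ := γ) hy
  have hkA : ∀ a ∈ A, (φ + incl h φ c γ u • h) a < γ + incl h φ c γ u * c := fun a ha => by
    simp [(hA a ha).1, (hA a ha).2]
  have hkB : ∀ b ∈ B, γ + incl h φ c γ u * c < (φ + incl h φ c γ u • h) b := fun b hb => by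
    simp [(hB b hb).1, (hB b hb).2]
  have hkD : ∀ a ∈ D, (φ + incl h φ c γ u • h) a ≤ γ + incl h φ c γ u * c := fun a ha => by
    simp [hk a (hD a ha)]
    exact mul_nonpos_of_nonpos_of_nonneg (by linarith [hmin a ha]) (by linarith [hD a ha])
  have hkE : ∀ b ∈ E, γ + incl h φ c γ u * c ≤ (φ + incl h φ c γ u • h) b := fun b hb => by
    simp [hk b (hE b hb)]
    refine mul_nonneg ?_ (by linarith [hE b hb])
    rcases H u hu b hb with h1 | h1 <;> linarith
  refine sep_of_lex (φ + incl h φ c γ u • h) h fun a ha b hb => ?_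
  rcases Finset.mem_union.1 ha with ha | ha <;> rcases Finset.mem_union.1 hb with hb | hb
  · exact Or.inl ((hkA a ha).trans (hkB b hb))
  · exact Or.inl ((hkA a ha).trans_le (hkE b hb))
  · exact Or.inl ((hkD a ha).trans_lt (hkB b hb))
  · rcases ((hkD a ha).trans (hkE b hb)).lt_or_eq with h1 | h1
    · exact Or.inl h1
    · right
      refine ⟨h1, ?_⟩
      have e1 := le_antisymm (hkD a ha) (h1 ▸ hkE b hb)
      have e2 := le_antisymm (h1 ▸ hkD a ha) (hkE b hb)
      simp [hk a (hD a ha)] at e1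
      simp [hk b (hE b hb)] at e2
      have f1 : incl h φ c γ u - incl h φ c γ a = 0 := e1.resolve_right (by linarith [hD a ha])
      have f2 : incl h φ c γ u - incl h φ c γ b = 0 := e2.resolve_right (by linarith [hE b hb])
      rcases H a ha b hb with h2 | h2
      · linarith
      · exact h2.2

/-- The point of `U` met first by a line turning about the point of the line `h = c` with
`φ = γ`. -/
structure First (h φ : Functional) (c γ : ℝ) (U : Finset Plane) (u : Plane) : Prop where
  mem : u ∈ U
  lt : ∀ y ∈ U, y ≠ u → incl h φ c γ y < incl h φ c γ u ∨
    (incl h φ c γ y = incl h φ c γ u ∧ h u < h y)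

theorem exists_first {h φ : Functional} (hi : Independent h φ) {c : ℝ} (γ : ℝ) {U : Finset Plane}
    (hU : ∀ y ∈ U, c < h y) (hne : U.Nonempty) : ∃ u, First h φ c γ U u := by
  obtain ⟨u₀, hu₀, hmax⟩ := U.exists_max_image (incl h φ c γ) hne
  obtain ⟨u, hu, hmin⟩ := {y ∈ U | incl h φ c γ y = incl h φ c γ u₀}.exists_min_image h
    ⟨u₀, by simp [hu₀]⟩
  simp only [Finset.mem_filter, and_imp] at hu hmin
  refine ⟨u, hu.1, fun y hy hyu => ?_⟩
  rw [hu.2]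
  rcases (hmax y hy).lt_or_eq with h1 | h1
  · exact Or.inl h1
  · refine Or.inr ⟨h1, lt_of_le_of_ne (hmin y hy h1) fun e => hyu (hi.eq e.symm ?_)⟩
    have e1 := incl_mul (φ := φ) (γ := γ) (hU y hy)
    have e2 := incl_mul (φ := φ) (γ := γ) (hU u hu.1)
    rw [h1] at e1; rw [hu.2, e] at e2
    linarith

/-- A point moving from `v` straight down to `x` turns monotonically as seen from the pivot, in the
direction given by the side of the pivot on which `x` lies. -/
theorem incl_of_mem_openSegment {h φ : Functional} {c γ : ℝ} {v x y : Plane}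
    (hy : y ∈ openSegment ℝ v x) (hx : h x = c) (hv : c < h v) :
    (γ < φ x → incl h φ c γ y < incl h φ c γ v) ∧ (φ x < γ → incl h φ c γ v < incl h φ c γ y) ∧
      c < h y ∧ h y < h v := by
  have hyv := lt_of_mem_openSegment (mem_openSegment_swap hy) (hx ▸ hv)
  rw [hx] at hyv
  obtain ⟨a, b, ha, hb, hab, hg⟩ := functional_openSegment hy
  have e1 := incl_mul (φ := φ) (γ := γ) hyv.1
  have e2 := incl_mul (φ := φ) (γ := γ) hv
  have key : (incl h φ c γ y - incl h φ c γ v) * (h y - c) = b * (γ - φ x) := by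
    rw [sub_mul, e1, hg φ]
    have : h y - c = a * (h v - c) := by
      rw [hg h, hx]; linear_combination c * hab
    rw [this]
    linear_combination (-a) * e2 - γ * hab
  refine ⟨fun hγ => ?_, fun hγ => ?_, hyv⟩
  · have : b * (γ - φ x) < 0 := mul_neg_of_pos_of_neg hb (by linarith)
    nlinarith [hyv.1]
  · have : 0 < b * (γ - φ x) := mul_pos hb (by linarith)
    nlinarith [hyv.1]

theorem card_triple {a b c : Plane} (hab : a ≠ b) (hac : a ≠ c) (hbc : b ≠ c) :
    ({a, b, c} : Finset Plane).card = 3 := by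
  rw [Finset.card_eq_three]; exact ⟨a, b, c, hab, hac, hbc, rfl⟩

/-- The first element of a finite subset of a line. -/
theorem exists_first_of_line {h φ : Functional} (hi : Independent h φ) {c : ℝ} {L : Finset Plane}
    (hL : ∀ x ∈ L, h x = c) (hne : L.Nonempty) : ∃ x ∈ L, ∀ y ∈ L.erase x, φ x < φ y := by
  obtain ⟨x, hx, hmin⟩ := L.exists_min_image φ hne
  refine ⟨x, hx, fun y hy => ?_⟩
  have hy' := Finset.mem_erase.1 hy
  exact lt_of_le_of_ne (hmin y hy'.2) fun e =>
    hy'.1 (hi.eq ((hL y hy'.2).trans (hL x hx).symm) e.symm)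

/-- With the pivot just after the first two points of the line, these two form a triangle with the
first point met above, and the turning line cuts this triangle off. -/
theorem Guillotine.of_line_of_above {h φ : Functional} (hi : Independent h φ) {c : ℝ} :
    ∀ (m : ℕ) (L U : Finset Plane), U.card = m → (∀ x ∈ L, h x = c) → (∀ y ∈ U, c < h y) →
      L.card = 2 * U.card → Guillotine (L ∪ U) := by
  intro m
  induction m with
  | zero =>
    intro L U hm hL hU hc
    rw [hm] at hc
    rw [Finset.card_eq_zero.1 hm, Finset.card_eq_zero.1 hc]
    exact .empty
  | succ m ih =>
    intro L U hm hL hU hc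
    obtain ⟨x₁, hx₁, hlt₁⟩ := exists_first_of_line hi hL (Finset.card_pos.1 (by omega))
    have hc₁ : (L.erase x₁).card = 2 * m + 1 := by rw [Finset.card_erase_of_mem hx₁]; omega
    obtain ⟨x₂, hx₂, hlt₂⟩ := exists_first_of_line hi (L := L.erase x₁)
      (fun x hx => hL x (Finset.mem_of_mem_erase hx)) (Finset.card_pos.1 (by omega))
    have hc₂ : ((L.erase x₁).erase x₂).card = 2 * m := by
      rw [Finset.card_erase_of_mem hx₂]; omega
    have hx₂' := Finset.mem_erase.1 hx₂
    obtain ⟨γ, hγ₁, hγ₂⟩ := exists_between_finsets {x₁, x₂} ((L.erase x₁).erase x₂) φ (by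
      intro a ha b hb
      simp only [Finset.mem_insert, Finset.mem_singleton] at ha
      rcases ha with rfl | rfl
      · exact hlt₁ b (Finset.mem_of_mem_erase hb)
      · exact hlt₂ b hb)
    obtain ⟨u, hu⟩ := exists_first hi γ hU (Finset.card_pos.1 (by omega))
    have hsub : ∀ x ∈ (L.erase x₁).erase x₂, x ∈ L := fun x hx =>
      Finset.mem_of_mem_erase (Finset.mem_of_mem_erase hx)
    have hrest := ih ((L.erase x₁).erase x₂) (U.erase u)
      (by rw [Finset.card_erase_of_mem hu.mem]; omega) (fun x hx => hL x (hsub x hx))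
      (fun y hy => hU y (Finset.mem_of_mem_erase hy))
      (by rw [Finset.card_erase_of_mem hu.mem]; omega)
    have hux : ∀ x ∈ L, u ≠ x := fun x hx e => by
      have := hU u hu.mem; rw [e, hL x hx] at this; exact lt_irrefl _ this
    refine Guillotine.cut (A := {x₁, x₂} ∪ {u}) (.triangle ?_ ?_) hrest ?_ ?_
    · rw [Finset.union_comm]
      exact card_triple (hux _ hx₁) (hux _ hx₂'.2) hx₂'.1.symm
    · rw [Finset.union_comm]
      exact not_col_triple hx₂'.1.symm (g := h) (by rw [hL _ hx₁, hL _ hx₂'.2])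
        (by rw [hL _ hx₁]; exact (hU u hu.mem).ne')
    · refine sep_of_incl (h := h) (φ := φ) (c := c) (γ := γ) (by simp) ?_ ?_ ?_ ?_ ?_
      · intro a ha
        refine ⟨?_, hγ₁ a ha⟩
        simp only [Finset.mem_insert, Finset.mem_singleton] at ha
        rcases ha with rfl | rfl
        exacts [hL _ hx₁, hL _ hx₂'.2]
      · exact fun b hb => ⟨hL b (hsub b hb), hγ₂ b hb⟩
      · simpa using hU u hu.mem
      · exact fun y hy => hU y (Finset.mem_of_mem_erase hy)
      · intro a ha b hb
        rw [Finset.mem_singleton] at ha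
        subst ha
        exact hu.lt b (Finset.mem_of_mem_erase hb) (Finset.ne_of_mem_erase hb)
    · ext z
      simp only [Finset.mem_union, Finset.mem_insert, Finset.mem_singleton, Finset.mem_erase]
      have := hu.mem
      have := hx₂'.2
      by_cases z = u <;> by_cases z = x₁ <;> by_cases z = x₂ <;> simp_all

theorem exists_initial {h φ : Functional} (hi : Independent h φ) {c : ℝ} :
    ∀ (m : ℕ) (L : Finset Plane), (∀ x ∈ L, h x = c) → m ≤ L.card →
      ∃ A ⊆ L, A.card = m ∧ ∀ a ∈ A, ∀ b ∈ L \ A, φ a < φ b := by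
  intro m
  induction m with
  | zero => exact fun L _ _ => ⟨∅, by simp, by simp, by simp⟩
  | succ m ih =>
    intro L hL hm
    obtain ⟨A, hA, hc, hlt⟩ := ih L hL (by omega)
    have hcard : (L \ A).card = L.card - m := by rw [Finset.card_sdiff_of_subset hA, hc]
    obtain ⟨x, hx, hx'⟩ := exists_first_of_line hi (L := L \ A)
      (fun x hx => hL x (Finset.mem_sdiff.1 hx).1) (Finset.card_pos.1 (by omega))
    have hx1 := Finset.mem_sdiff.1 hx
    refine ⟨insert x A, Finset.insert_subset hx1.1 hA, ?_, ?_⟩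
    · rw [Finset.card_insert_of_notMem hx1.2, hc]
    · intro a ha b hb
      simp only [Finset.mem_sdiff, Finset.mem_insert, not_or] at hb
      rcases Finset.mem_insert.1 ha with rfl | ha
      · exact hx' b (by simp [hb])
      · exact hlt a ha b (by simp [hb])

/-- The line `h = c` is turned slightly about a point between `A` and `B`. -/
theorem sep_above_below {h φ : Functional} {c : ℝ} {A B U D : Finset Plane}
    (hA : ∀ x ∈ A, h x = c) (hB : ∀ x ∈ B, h x = c) (hU : ∀ y ∈ U, c < h y)
    (hD : ∀ y ∈ D, h y < c) (hlt : ∀ a ∈ A, ∀ b ∈ B, φ a < φ b) : Sep (A ∪ U) (B ∪ D) := by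
  refine sep_of_lex (-h) φ fun a ha b hb => ?_
  rcases Finset.mem_union.1 ha with ha | ha <;> rcases Finset.mem_union.1 hb with hb | hb
  · exact Or.inr ⟨by simp [hA a ha, hB b hb], hlt a ha b hb⟩
  · left; simpa [hA a ha] using hD b hb
  · left; simpa [hB b hb] using hU a ha
  · left; simpa using (hD b hb).trans (hU a ha)

theorem Independent.neg_left {h φ : Functional} (hi : Independent h φ) : Independent (-h) φ :=
  fun z h1 h2 => hi z (by simpa using h1) h2

theorem Independent.neg_right {h φ : Functional} (hi : Independent h φ) : Independent h (-φ) :=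
  hi.symm.neg_left.symm

theorem Guillotine.of_line_of_below {h φ : Functional} (hi : Independent h φ) {c : ℝ}
    {L D : Finset Plane} (hL : ∀ x ∈ L, h x = c) (hD : ∀ y ∈ D, h y < c)
    (hc : L.card = 2 * D.card) : Guillotine (L ∪ D) :=
  .of_line_of_above hi.neg_left (c := -c) _ L D rfl (fun x hx => by simp [hL x hx])
    (fun y hy => by simpa using hD y hy) hc

/-- The first `2|U|` points of the line serve the points above it, and the others those below. -/
theorem Guillotine.of_line {h φ : Functional} (hi : Independent h φ) {c : ℝ}
    {L U D : Finset Plane} (hL : ∀ x ∈ L, h x = c) (hU : ∀ y ∈ U, c < h y)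
    (hD : ∀ y ∈ D, h y < c) (hc : L.card = 2 * (U.card + D.card)) :
    Guillotine (L ∪ (U ∪ D)) := by
  obtain ⟨A, hA, hAc, hlt⟩ := exists_initial hi (2 * U.card) L hL (by omega)
  refine Guillotine.cut (.of_line_of_above hi _ A U rfl (fun x hx => hL x (hA hx)) hU hAc)
    (.of_line_of_below hi (L := L \ A) (fun x hx => hL x (Finset.mem_sdiff.1 hx).1) hD
      (by rw [Finset.card_sdiff_of_subset hA]; omega))
    (sep_above_below (h := h) (φ := φ) (c := c) (fun x hx => hL x (hA hx))
      (fun x hx => hL x (Finset.mem_sdiff.1 hx).1) hU hD hlt) ?_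
  ext z
  have := @hA z
  simp only [Finset.mem_union, Finset.mem_sdiff]
  tauto

/-! ### Fans -/

/-- The obstruction to a partition when the line `h = c` contains `2n - 1` of `3n` points. -/
structure Fan (h φ : Functional) (c : ℝ) (L U : Finset Plane) (v : Plane) (E : Finset Plane) :
    Prop where
  mem : v ∈ U
  subset : E ⊆ L
  indep : Indep L E
  card : L.card + 1 = 2 * E.card
  first : ∃ x ∈ E, ∀ z ∈ L, φ x ≤ φ z
  blocked : ∀ x ∈ E, ∃ y ∈ U, y ∈ openSegment ℝ v x
  cover : ∀ y ∈ U, y ≠ v → ∃ x ∈ E, y ∈ openSegment ℝ v x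

/-- The apex joins `E`. As `|L| = 2|U| - 3`, this gives `|U|` points in a set of at most `3|U| - 3`,
one too many. -/
theorem Fan.bad {h φ : Functional} {c : ℝ} {L U E : Finset Plane} {v : Plane}
    (hF : Fan h φ c L U v E) (hL : ∀ x ∈ L, h x = c) (hU : ∀ y ∈ U, c < h y)
    (hc : L.card + 3 = 2 * U.card) : Bad (L ∪ U) := by
  have hvE : v ∉ E := fun hv => by
    have := hL v (hF.subset hv)
    exact absurd (hU v hF.mem) (by rw [this]; exact lt_irrefl _)
  refine ⟨insert v E, ⟨?_, ?_⟩, ?_⟩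
  · exact Finset.insert_subset (Finset.mem_union_right _ hF.mem)
      (hF.subset.trans Finset.subset_union_left)
  · intro p hp q hq hpq
    rcases Finset.mem_insert.1 hp with hpv | hp <;> rcases Finset.mem_insert.1 hq with hqv | hq
    · exact absurd (hpv.trans hqv.symm) hpq
    · obtain ⟨y, hy, hys⟩ := hF.blocked q hq
      exact ⟨y, Finset.mem_union_right _ hy, hpv ▸ hys⟩
    · obtain ⟨y, hy, hys⟩ := hF.blocked p hp
      exact ⟨y, Finset.mem_union_right _ hy, hqv ▸ mem_openSegment_swap hys⟩
    · obtain ⟨z, hz, hzs⟩ := hF.indep.2 p hp q hq hpq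
      exact ⟨z, Finset.mem_union_left _ hz, hzs⟩
  · rw [Finset.card_insert_of_notMem hvE]
    have := hF.card
    have := Finset.card_union_le L U
    omega

theorem Col.eq_of_eq {S : Finset Plane} (hS : Col S) {h : Functional} {x u v : Plane} (hx : x ∈ S)
    (hu : u ∈ S) (hv : v ∈ S) (hxu : h x ≠ h u) (huv : h u = h v) : u = v := by
  obtain ⟨k, hk, c, hc⟩ := hS
  have hi : Independent k h := independent_of hk (d := x - u) (by simp [hc x hx, hc u hu])
    (by simpa [sub_eq_zero] using hxu)
  exact hi.eq ((hc u hu).trans (hc v hv).symm) huv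

theorem Col.mem_openSegment {S : Finset Plane} (hS : Col S) {h : Functional} {x u v : Plane}
    (hx : x ∈ S) (hu : u ∈ S) (hv : v ∈ S) (hxu : h x < h u) (huv : h u < h v) :
    u ∈ openSegment ℝ v x := by
  obtain ⟨k, hk, c, hc⟩ := hS
  refine mem_openSegment_swap (mem_openSegment_of hk (f := h) ?_ ?_ hxu huv)
  · rw [hc x hx, hc v hv]
  · rw [hc x hx, hc u hu]

/-- The first two points met by a line turning about a point between `x₁` and the other points of a
line may be cut off together with `x₁`. -/
theorem Guillotine.of_first_two {h φ : Functional} (hi : Independent h φ) {c γ : ℝ}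
    {L U : Finset Plane} {x₁ u₁ u₂ : Plane} (hL : ∀ x ∈ L, h x = c) (hU : ∀ y ∈ U, c < h y)
    (hx₁ : x₁ ∈ L) (hγ₁ : φ x₁ < γ) (hγ : ∀ x ∈ L.erase x₁, γ < φ x) (h₁ : First h φ c γ U u₁)
    (h₂ : First h φ c γ (U.erase u₁) u₂) (hcol : ¬ Col {x₁, u₁, u₂})
    (hc : L.card + 3 = 2 * U.card) : Guillotine (L ∪ U) := by
  have hu₂ := Finset.mem_erase.1 h₂.mem
  have hxu : ∀ y ∈ U, x₁ ≠ y := fun y hy e => by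
    have := hU y hy
    rw [← e, hL x₁ hx₁] at this
    exact lt_irrefl _ this
  have hc₁ : (L.erase x₁).card = L.card - 1 := Finset.card_erase_of_mem hx₁
  have hc₂ : ((U.erase u₁).erase u₂).card = U.card - 2 := by
    rw [Finset.card_erase_of_mem h₂.mem, Finset.card_erase_of_mem h₁.mem]; rfl
  refine Guillotine.cut (A := {x₁} ∪ {u₁, u₂}) (.triangle ?_ ?_)
    (Guillotine.of_line_of_above hi (c := c) _ (L.erase x₁) ((U.erase u₁).erase u₂) rfl ?_ ?_ ?_)
    (sep_of_incl (h := h) (φ := φ) (c := c) (γ := γ) (by simp) ?_ ?_ ?_ ?_ ?_) ?_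
  · exact card_triple (hxu _ h₁.mem) (hxu _ hu₂.2) hu₂.1.symm
  · exact hcol
  · exact fun x hx => hL x (Finset.mem_of_mem_erase hx)
  · exact fun y hy => hU y (Finset.mem_of_mem_erase (Finset.mem_of_mem_erase hy))
  · rw [hc₁, hc₂]
    have := Finset.card_pos.2 ⟨x₁, hx₁⟩
    omega
  · simpa using ⟨hL x₁ hx₁, hγ₁⟩
  · exact fun x hx => ⟨hL x (Finset.mem_of_mem_erase hx), hγ x hx⟩
  · simpa using ⟨hU u₁ h₁.mem, hU u₂ hu₂.2⟩
  · exact fun y hy => hU y (Finset.mem_of_mem_erase (Finset.mem_of_mem_erase hy))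
  · intro a ha b hb
    have hb' := Finset.mem_erase.1 hb
    have hb'' := Finset.mem_erase.1 hb'.2
    simp only [Finset.mem_insert, Finset.mem_singleton] at ha
    rcases ha with rfl | rfl
    · exact h₁.lt b hb''.2 hb''.1
    · exact h₂.lt b hb'.2 hb'.1
  · ext z
    simp only [Finset.mem_union, Finset.mem_insert, Finset.mem_singleton, Finset.mem_erase]
    have := h₁.mem
    have := hu₂.2
    by_cases z = u₁ <;> by_cases z = u₂ <;> by_cases z = x₁ <;> simp_all

theorem First.eq {h φ : Functional} {c γ : ℝ} {U : Finset Plane} {u v : Plane}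
    (hu : First h φ c γ U u) (hv : First h φ c γ U v) : u = v := by
  by_contra hne
  rcases hu.lt v hv.mem (Ne.symm hne) with h1 | h1 <;> rcases hv.lt u hu.mem hne with h2 | h2
  · exact lt_asymm h1 h2
  · rw [h2.1] at h1; exact lt_irrefl _ h1
  · rw [h1.1] at h2; exact lt_irrefl _ h2
  · exact lt_asymm h1.2 h2.2

/-- The apex of a fan is met first. -/
theorem Fan.isFirst {h φ : Functional} {c γ : ℝ} {L U E : Finset Plane} {v : Plane}
    (hF : Fan h φ c L U v E) (hL : ∀ x ∈ L, h x = c) (hU : ∀ y ∈ U, c < h y)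
    (hγ : ∀ x ∈ L, γ < φ x) : First h φ c γ U v := by
  refine ⟨hF.mem, fun y hy hyv => Or.inl ?_⟩
  obtain ⟨x, hx, hyx⟩ := hF.cover y hy hyv
  exact (incl_of_mem_openSegment hyx (hL x (hF.subset hx)) (hU v hF.mem)).1 (hγ x (hF.subset hx))

/-- The first two points met, if a fan remains after the removal of `u`. -/
theorem Fan.pair_eq {h φ : Functional} {c γ : ℝ} {L U E : Finset Plane} {x₁ u v u₁ u₂ : Plane}
    (hF : Fan h φ c L (U.erase u) v E) (hL : ∀ x ∈ L, h x = c) (hU : ∀ y ∈ U, c < h y)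
    (hγ : ∀ x ∈ L, γ < φ x) (h₁ : First h φ c γ U u₁) (h₂ : First h φ c γ (U.erase u₁) u₂)
    (hx₁ : h x₁ = c) (hxL : x₁ ∉ L) (hcol : Col {x₁, u₁, u₂}) :
    Col {x₁, u, v} := by
  -- Without `u` the apex is met first, so it is among the first two points of `U`. The other one is
  -- `u`: any further point lies between the apex and a point of `L`, and collinearity would
  -- identify the latter with `x₁`.
  have hv := hF.isFirst hL (fun y hy => hU y (Finset.mem_of_mem_erase hy)) hγ
  have hvU := Finset.mem_erase.1 hv.mem
  by_cases e₁ : u₁ = u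
  · subst e₁
    rwa [hv.eq h₂]
  have hu₁ : u₁ = v := by
    by_contra hne
    rcases h₁.lt v hvU.2 (Ne.symm hne) with h3 | h3 <;>
      rcases hv.lt u₁ (Finset.mem_erase.2 ⟨e₁, h₁.mem⟩) hne with h4 | h4
    · exact lt_asymm h3 h4
    · rw [h4.1] at h3; exact lt_irrefl _ h3
    · rw [h3.1] at h4; exact lt_irrefl _ h4
    · exact lt_asymm h3.2 h4.2
  subst hu₁
  by_cases e₂ : u₂ = u
  · subst e₂
    exact hcol.mono (by intro z hz; simp at hz ⊢; tauto)
  exfalso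
  have hu₂ := Finset.mem_erase.1 h₂.mem
  obtain ⟨x, hx, hxs⟩ := hF.cover u₂ (Finset.mem_erase.2 ⟨e₂, hu₂.2⟩) hu₂.1
  have hxc := hL x (hF.subset hx)
  obtain ⟨-, -, hlt1, hlt2⟩ := incl_of_mem_openSegment (φ := φ) (γ := γ) hxs hxc (hU u₁ hvU.2)
  obtain ⟨k, hk, d, hd⟩ := hcol
  obtain ⟨a, b, ha, hb, hab, hg⟩ := functional_openSegment hxs
  have kx : k x = d := by
    have e := hg k
    rw [hd u₁ (by simp), hd u₂ (by simp)] at e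
    have : b * (k x - d) = 0 := by linear_combination -e - d * hab
    have := (mul_eq_zero.1 this).resolve_left hb.ne'
    linarith
  have hi : Independent k h := independent_of hk (d := u₁ - u₂)
    (by simp [hd u₁, hd u₂]) (by simp; linarith)
  have := hi.eq (x := x) (y := x₁) (kx.trans (hd x₁ (by simp)).symm) (hxc.trans hx₁.symm)
  exact hxL (this ▸ hF.subset hx)

/-- Two first cuts are available: two points of the line with one above, or one point of the line
with two above. The second leaves twice as many points on the line as above it, so it fails only if
its three points are collinear. If the first fails, induction leaves a fan. Together these failures
put the deleted point `u` between the apex and `x₁`, so the fan extends to `x₁`. -/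
theorem guillotine_or_fan {h φ : Functional} (hi : Independent h φ) {c : ℝ} :
    ∀ (m : ℕ) (L U : Finset Plane), U.card = m + 2 → (∀ x ∈ L, h x = c) → (∀ y ∈ U, c < h y) →
      L.card + 3 = 2 * U.card → Guillotine (L ∪ U) ∨ ∃ v E, Fan h φ c L U v E := by
  intro m
  induction m with
  | zero =>
    intro L U hm hL hU hc
    obtain ⟨x, rfl⟩ := Finset.card_eq_one.1 (show L.card = 1 by omega)
    obtain ⟨u, v, huv, rfl⟩ := Finset.card_eq_two.1 hm
    have hx := hL x (by simp)
    have hu := hU u (by simp)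
    have hv := hU v (by simp)
    by_cases hcol : Col {x, u, v}
    · right
      have key : ∀ u v : Plane, c < h u → h u < h v → Col {x, u, v} →
          Fan h φ c {x} {u, v} v {x} := by
        intro u v hu huv hcol
        have hs : u ∈ openSegment ℝ v x := hcol.mem_openSegment (h := h) (by simp) (by simp)
          (by simp) (hx ▸ hu) huv
        exact ⟨by simp, by simp, ⟨by simp, by simp⟩, by simp, ⟨x, by simp⟩,
          by simpa using Or.inl hs, by
            intro y hy hyv
            simp only [Finset.mem_insert, Finset.mem_singleton] at hy
            rcases hy with rfl | rfl
            · exact ⟨x, by simp, hs⟩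
            · exact absurd rfl hyv⟩
      rcases lt_trichotomy (h u) (h v) with h1 | h1 | h1
      · exact ⟨v, _, key u v hu h1 hcol⟩
      · exact absurd (hcol.eq_of_eq (h := h) (x := x) (by simp) (by simp) (by simp)
          (by rw [hx]; exact hu.ne) h1) huv
      · rw [Finset.pair_comm]
        exact ⟨u, _, key v u hv h1 (hcol.mono (by intro z hz; simp at hz ⊢; tauto))⟩
    · left
      refine .triangle ?_ (by exact hcol)
      exact card_triple (fun e => by rw [← e, hx] at hu; exact lt_irrefl _ hu)
        (fun e => by rw [← e, hx] at hv; exact lt_irrefl _ hv) huv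
  | succ m ih =>
    intro L U hm hL hU hc
    obtain ⟨x₁, hx₁, hlt₁⟩ := exists_first_of_line hi hL (Finset.card_pos.1 (by omega))
    have hc₁ : (L.erase x₁).card = L.card - 1 := Finset.card_erase_of_mem hx₁
    obtain ⟨x₂, hx₂, hlt₂⟩ := exists_first_of_line hi (L := L.erase x₁)
      (fun x hx => hL x (Finset.mem_of_mem_erase hx)) (Finset.card_pos.1 (by omega))
    have hc₂ : ((L.erase x₁).erase x₂).card = L.card - 2 := by
      rw [Finset.card_erase_of_mem hx₂]; omega
    have hx₂' := Finset.mem_erase.1 hx₂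
    have hsub : ∀ x ∈ (L.erase x₁).erase x₂, x ∈ L := fun x hx =>
      Finset.mem_of_mem_erase (Finset.mem_of_mem_erase hx)
    obtain ⟨γ, hγ₁, hγ₂⟩ := exists_between_finsets {x₁, x₂} ((L.erase x₁).erase x₂) φ (by
      intro a ha b hb
      simp only [Finset.mem_insert, Finset.mem_singleton] at ha
      rcases ha with rfl | rfl
      · exact hlt₁ b (Finset.mem_of_mem_erase hb)
      · exact hlt₂ b hb)
    obtain ⟨γ', hγ₁', hγ₂'⟩ := exists_between_finsets {x₁} (L.erase x₁) φ (by simpa using hlt₁)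
    obtain ⟨u, hu⟩ := exists_first hi γ hU (Finset.card_pos.1 (by omega))
    have hUu : (U.erase u).card = U.card - 1 := Finset.card_erase_of_mem hu.mem
    have hUu' : ∀ y ∈ U.erase u, c < h y := fun y hy => hU y (Finset.mem_of_mem_erase hy)
    have hux : ∀ x ∈ L, u ≠ x := fun x hx e => by
      have := hU u hu.mem; rw [e, hL x hx] at this; exact lt_irrefl _ this
    rcases ih ((L.erase x₁).erase x₂) (U.erase u) (by omega) (fun x hx => hL x (hsub x hx))
      hUu' (by omega) with hG | ⟨v, E, hF⟩
    · left
      refine Guillotine.cut (A := {x₁, x₂} ∪ {u}) (.triangle ?_ ?_) hG ?_ ?_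
      · rw [Finset.union_comm]
        exact card_triple (hux _ hx₁) (hux _ hx₂'.2) hx₂'.1.symm
      · rw [Finset.union_comm]
        exact not_col_triple hx₂'.1.symm (g := h) (by rw [hL _ hx₁, hL _ hx₂'.2])
          (by rw [hL _ hx₁]; exact (hU u hu.mem).ne')
      · refine sep_of_incl (h := h) (φ := φ) (c := c) (γ := γ) (by simp) ?_ ?_ ?_ ?_ ?_
        · intro a ha
          refine ⟨?_, hγ₁ a ha⟩
          simp only [Finset.mem_insert, Finset.mem_singleton] at ha
          rcases ha with rfl | rfl
          exacts [hL _ hx₁, hL _ hx₂'.2]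
        · exact fun b hb => ⟨hL b (hsub b hb), hγ₂ b hb⟩
        · simpa using hU u hu.mem
        · exact hUu'
        · intro a ha b hb
          rw [Finset.mem_singleton] at ha
          subst ha
          exact hu.lt b (Finset.mem_of_mem_erase hb) (Finset.ne_of_mem_erase hb)
      · ext z
        simp only [Finset.mem_union, Finset.mem_insert, Finset.mem_singleton, Finset.mem_erase]
        have := hu.mem
        have := hx₂'.2
        by_cases z = u <;> by_cases z = x₁ <;> by_cases z = x₂ <;> simp_all
    -- The second attempt: the pivot is now between `x₁` and `x₂`.
    obtain ⟨u₁, hu₁⟩ := exists_first hi γ' hU (Finset.card_pos.1 (by omega))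
    have hUu₁ : (U.erase u₁).card = U.card - 1 := Finset.card_erase_of_mem hu₁.mem
    obtain ⟨u₂, hu₂⟩ := exists_first hi γ' (U := U.erase u₁)
      (fun y hy => hU y (Finset.mem_of_mem_erase hy)) (Finset.card_pos.1 (by omega))
    by_cases hcol : Col {x₁, u₁, u₂}
    swap
    · exact Or.inl (Guillotine.of_first_two hi hL hU hx₁ (hγ₁' x₁ (by simp)) hγ₂' hu₁ hu₂ hcol hc)
    right
    have hvU := Finset.mem_erase.1 hF.mem
    have hcol' : Col {x₁, u, v} := hF.pair_eq (γ := γ') (x₁ := x₁) (fun x hx => hL x (hsub x hx)) hU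
      (fun x hx => hγ₂' x (Finset.mem_of_mem_erase hx)) hu₁ hu₂ (hL x₁ hx₁) (by simp) hcol
    have hxu : h x₁ < h u := by rw [hL x₁ hx₁]; exact hU u hu.mem
    have hxv : h x₁ < h v := by rw [hL x₁ hx₁]; exact hU v hvU.2
    have hs : u ∈ openSegment ℝ v x₁ := by
      rcases lt_trichotomy (h u) (h v) with h1 | h1 | h1
      · exact hcol'.mem_openSegment (h := h) (by simp) (by simp) (by simp) hxu h1
      · exact absurd (hcol'.eq_of_eq (h := h) (x := x₁) (by simp) (by simp) (by simp)
          hxu.ne h1) hvU.1.symm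
      -- If `v` were between `u` and `x₁`, a line turning about a pivot to the right of `x₁` would
      -- meet `v` before `u`.
      · exfalso
        have hv := hcol'.mem_openSegment (h := h) (x := x₁) (u := v) (v := u) (by simp) (by simp)
          (by simp) hxv h1
        have h2 := (incl_of_mem_openSegment (φ := φ) (γ := γ) hv (hL x₁ hx₁)
          (hU u hu.mem)).2.1 (hγ₁ x₁ (by simp))
        rcases hu.lt v hvU.2 hvU.1 with h3 | h3
        · exact lt_asymm h2 h3
        · rw [h3.1] at h2; exact lt_irrefl _ h2
    have hEL : ∀ e ∈ E, e ∈ (L.erase x₁).erase x₂ := fun e he => hF.subset he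
    have hx₁E : x₁ ∉ E := fun hx => by simpa using hEL _ hx
    have hh : h ≠ 0 := hi.left_ne_zero
    have hb : ∀ e ∈ E, x₂ ∈ openSegment ℝ x₁ e := fun e he =>
      mem_openSegment_of hh (f := φ) (by rw [hL _ hx₁, hL _ (hsub _ (hEL e he))])
        (by rw [hL _ hx₁, hL _ hx₂'.2]) (hlt₁ x₂ hx₂) (hlt₂ e (hEL e he))
    refine ⟨v, insert x₁ E, hvU.2, ?_, ⟨?_, ?_⟩, ?_, ⟨x₁, by simp, ?_⟩, ?_, ?_⟩
    · exact Finset.insert_subset hx₁ fun e he => hsub _ (hEL e he)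
    · exact Finset.insert_subset hx₁ fun e he => hsub _ (hEL e he)
    · intro p hp q hq hpq
      rcases Finset.mem_insert.1 hp with hpv | hp <;> rcases Finset.mem_insert.1 hq with hqv | hq
      · exact absurd (hpv.trans hqv.symm) hpq
      · exact ⟨x₂, hx₂'.2, hpv ▸ hb q hq⟩
      · exact ⟨x₂, hx₂'.2, hqv ▸ mem_openSegment_swap (hb p hp)⟩
      · obtain ⟨z, hz, hzs⟩ := hF.indep.2 p hp q hq hpq
        exact ⟨z, hsub z hz, hzs⟩
    · rw [Finset.card_insert_of_notMem hx₁E]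
      have := hF.card
      omega
    · intro z hz
      by_cases e : z = x₁
      · rw [e]
      · exact (hlt₁ z (Finset.mem_erase.2 ⟨e, hz⟩)).le
    · intro x hx
      rcases Finset.mem_insert.1 hx with rfl | hx
      · exact ⟨u, hu.mem, hs⟩
      · obtain ⟨y, hy, hys⟩ := hF.blocked x hx
        exact ⟨y, Finset.mem_of_mem_erase hy, hys⟩
    · intro y hy hyv
      by_cases e : y = u
      · exact ⟨x₁, by simp, e ▸ hs⟩
      · obtain ⟨x, hx, hxs⟩ := hF.cover y (Finset.mem_erase.2 ⟨e, hy⟩) hyv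
        exact ⟨x, Finset.mem_insert_of_mem hx, hxs⟩

/-- The apex of a fan is the highest point. -/
theorem Fan.lt_apex {h φ : Functional} {c : ℝ} {L U E : Finset Plane} {v : Plane}
    (hF : Fan h φ c L U v E) (hL : ∀ x ∈ L, h x = c) (hU : ∀ y ∈ U, c < h y) :
    ∀ y ∈ U, y ≠ v → h y < h v := fun y hy hyv => by
  obtain ⟨x, hx, hxs⟩ := hF.cover y hy hyv
  exact (incl_of_mem_openSegment (φ := φ) (γ := 0) hxs (hL x (hF.subset hx)) (hU v hF.mem)).2.2.2

/-- `U` takes `2|U| - 3` points of the line from one end and `D` the remaining `2|D|`. If this fails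
for both ends there are two fans with the same apex, the highest point of `U`. The last point of the
line belongs to the second fan and, through its blocker, to the first as well; but the first does
not reach that far, because `D` is nonempty. -/
theorem Guillotine.of_two_sides {h φ : Functional} (hi : Independent h φ) {c : ℝ}
    {L U D : Finset Plane} (hL : ∀ x ∈ L, h x = c) (hU : ∀ y ∈ U, c < h y)
    (hD : ∀ y ∈ D, h y < c) (hc : L.card + 3 = 2 * (U.card + D.card)) (hU2 : 2 ≤ U.card)
    (hD1 : 1 ≤ D.card) : Guillotine (L ∪ (U ∪ D)) := by
  have key : ∀ φ : Functional, Independent h φ → Guillotine (L ∪ (U ∪ D)) ∨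
      ∃ A v E, A ⊆ L ∧ A.card + 3 = 2 * U.card ∧ (∀ a ∈ A, ∀ b ∈ L \ A, φ a < φ b) ∧
        Fan h φ c A U v E := by
    intro φ hi
    obtain ⟨A, hA, hAc, hlt⟩ := exists_initial hi (2 * U.card - 3) L hL (by omega)
    rcases guillotine_or_fan hi (U.card - 2) A U (by omega) (fun x hx => hL x (hA hx)) hU
      (by omega) with hG | ⟨v, E, hF⟩
    · left
      refine Guillotine.cut hG (.of_line_of_below hi (L := L \ A)
        (fun x hx => hL x (Finset.mem_sdiff.1 hx).1) hD
        (by rw [Finset.card_sdiff_of_subset hA]; omega))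
        (sep_above_below (h := h) (φ := φ) (c := c) (fun x hx => hL x (hA hx))
          (fun x hx => hL x (Finset.mem_sdiff.1 hx).1) hU hD hlt) ?_
      ext z
      have := @hA z
      simp only [Finset.mem_union, Finset.mem_sdiff]
      tauto
    · exact Or.inr ⟨A, v, E, hA, by omega, hlt, hF⟩
  rcases key φ hi with hG | ⟨A, v, E, hA, hAc, hlt, hF⟩
  · exact hG
  rcases key (-φ) hi.neg_right with hG | ⟨B, w, E', hB, hBc, hlt', hF'⟩
  · exact hG
  exfalso
  have hAL : ∀ x ∈ A, h x = c := fun x hx => hL x (hA hx)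
  have hBL : ∀ x ∈ B, h x = c := fun x hx => hL x (hB hx)
  have hvw : v = w := by
    by_contra hne
    exact lt_asymm (hF.lt_apex hAL hU w hF'.mem (Ne.symm hne))
      (hF'.lt_apex hBL hU v hF.mem hne)
  subst hvw
  obtain ⟨x, hx, hxmin⟩ := hF'.first
  obtain ⟨y, hy, hyx⟩ := hF'.blocked x hx
  have hxB := hF'.subset hx
  have hxc := hBL x hxB
  have hyv := (incl_of_mem_openSegment (φ := φ) (γ := 0) hyx hxc (hU v hF.mem)).2.2.2
  obtain ⟨x', hx', hyx'⟩ := hF.cover y hy fun e => by rw [e] at hyv; exact lt_irrefl _ hyv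
  have hxA := hF.subset hx'
  have hx'c := hAL x' hxA
  have hxx : x = x' := by
    obtain ⟨k, hk, hkv⟩ := exists_functional_eq v y
    have on_line : ∀ x, y ∈ openSegment ℝ v x → k x = k v := fun x hyx => by
      obtain ⟨a, b, ha, hb, hab, hg⟩ := functional_openSegment hyx
      have e := hg k
      rw [← hkv] at e
      have : b * (k x - k v) = 0 := by linear_combination -e - k v * hab
      have := (mul_eq_zero.1 this).resolve_left hb.ne'
      linarith
    have hik : Independent k h := independent_of hk (d := v - y) (by simp [hkv])
      (by simp; linarith)
    exact hik.eq ((on_line x hyx).trans (on_line x' hyx').symm) (hxc.trans hx'c.symm)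
  subst hxx
  obtain ⟨z, hz⟩ : (L \ A).Nonempty := Finset.card_pos.1 (by
    rw [Finset.card_sdiff_of_subset hA]; omega)
  have h1 := hlt x hxA z hz
  by_cases hzB : z ∈ B
  · have := hxmin z hzB
    simp at this
    linarith
  · have := hlt' x hxB z (Finset.mem_sdiff.2 ⟨(Finset.mem_sdiff.1 hz).1, hzB⟩)
    simp at this
    linarith

/-- A line with `2n + 1` points contains too large an independent set; with `2n` points there are
two for each of the `n` others; with `2n - 1` points the other `n + 1` are on one side, where a fan
may occur, or on both. -/
theorem guillotine_or_bad_of_line {h : Functional} (hh : h ≠ 0) {c : ℝ} {X : Finset Plane}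
    {n : ℕ} (hn : 2 ≤ n) (hX : X.card = 3 * n) (hline : 2 * n - 1 ≤ {x ∈ X | h x = c}.card) :
    Guillotine X ∨ Bad X := by
  obtain ⟨φ, hi⟩ := exists_independent hh
  set L := {x ∈ X | h x = c} with hLdef
  set U := {x ∈ X | c < h x} with hUdef
  set D := {x ∈ X | h x < c} with hDdef
  have hL : ∀ x ∈ L, h x = c := fun x hx => (Finset.mem_filter.1 hx).2
  have hU : ∀ x ∈ U, c < h x := fun x hx => (Finset.mem_filter.1 hx).2
  have hD : ∀ x ∈ D, h x < c := fun x hx => (Finset.mem_filter.1 hx).2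
  have hdisj : Disjoint U D := Finset.disjoint_left.2 fun x h1 h2 => lt_asymm (hU x h1) (hD x h2)
  have hdisj' : Disjoint L (U ∪ D) := Finset.disjoint_left.2 fun x h1 h2 => by
    rcases Finset.mem_union.1 h2 with h2 | h2
    · exact absurd (hU x h2) (by rw [hL x h1]; exact lt_irrefl _)
    · exact absurd (hD x h2) (by rw [hL x h1]; exact lt_irrefl _)
  have hXeq : X = L ∪ (U ∪ D) := by
    ext x
    simp only [hLdef, hUdef, hDdef, Finset.mem_union, Finset.mem_filter]
    have := lt_trichotomy (h x) c
    tauto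
  have hcard : L.card + (U.card + D.card) = 3 * n := by
    rw [← hX, hXeq, Finset.card_union_of_disjoint hdisj', Finset.card_union_of_disjoint hdisj]
  by_cases h1 : 2 * n + 1 ≤ L.card
  · right
    obtain ⟨S, -, hS, hSc⟩ := exists_indep_of_line hh (X := X) _ L rfl (Finset.filter_subset _ _) hL
    exact ⟨S, hS, by omega⟩
  by_cases h2 : L.card = 2 * n
  · left; rw [hXeq]; exact .of_line hi hL hU hD (by omega)
  have h3 : L.card + 3 = 2 * (U.card + D.card) := by omega
  by_cases hU0 : U.card = 0
  · rw [Finset.card_eq_zero.1 hU0, Finset.empty_union] at hXeq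
    rcases guillotine_or_fan hi.neg_left (c := -c) (D.card - 2) L D (by omega)
      (fun x hx => by simp [hL x hx]) (fun x hx => by simpa using hD x hx) (by omega) with
      hG | ⟨v, E, hF⟩
    · left; rwa [hXeq]
    · right; rw [hXeq]
      exact hF.bad (fun x hx => by simp [hL x hx]) (fun x hx => by simpa using hD x hx) (by omega)
  by_cases hD0 : D.card = 0
  · rw [Finset.card_eq_zero.1 hD0, Finset.union_empty] at hXeq
    rcases guillotine_or_fan hi (U.card - 2) L U (by omega) hL hU (by omega) with hG | ⟨v, E, hF⟩
    · left; rwa [hXeq]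
    · right; rw [hXeq]; exact hF.bad hL hU (by omega)
  left
  rw [hXeq]
  by_cases hU2 : 2 ≤ U.card
  · exact .of_two_sides hi hL hU hD h3 hU2 (by omega)
  · rw [Finset.union_comm U D]
    exact .of_two_sides hi.neg_left (c := -c) (fun x hx => by simp [hL x hx])
      (fun x hx => by simpa using hD x hx) (fun x hx => by simpa using hU x hx) (by omega)
      (by omega) (by omega)

/-- Sets without large independent sets can be cut into triangles. -/
theorem guillotine_of_not_bad : ∀ (n : ℕ) (X : Finset Plane), X.card = 3 * n → ¬ Bad X →
    Guillotine X := by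
  intro n
  induction n with
  | zero => intro X hX _; rw [Finset.card_eq_zero.1 hX]; exact .empty
  | succ n ih =>
    intro X hX hbad
    rcases Nat.eq_zero_or_pos n with rfl | hn
    -- Three collinear points contain an independent pair.
    · refine .triangle hX fun ⟨g, hg, c, hc⟩ => hbad ?_
      obtain ⟨S, -, hS, hSc⟩ := exists_indep_of_line hg _ X rfl le_rfl hc
      exact ⟨S, hS, by omega⟩
    by_cases hline : ∃ (h : Functional) (c : ℝ), h ≠ 0 ∧
        2 * (n + 1) - 1 ≤ {x ∈ X | h x = c}.card
    · obtain ⟨h, c, hh, hc⟩ := hline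
      exact (guillotine_or_bad_of_line hh (by omega) hX hc).resolve_right hbad
    push Not at hline
    by_cases hcut : ∃ T, CutTriangle X T ∧ ¬ Bad (X \ T)
    · obtain ⟨T, hT, hTb⟩ := hcut
      have := ih (X \ T) (by rw [Finset.card_sdiff_of_subset hT.subset, hT.card]; omega) hTb
      exact .cut (.triangle hT.card hT.not_col) this hT.sep
        (Finset.union_sdiff_of_subset hT.subset).symm
    push Not at hcut
    -- The witnesses are noncollinear: `n + 1` independent points on a line would need `2n + 1`
    -- points of `X` on it, which are too many.
    have htight : CutsTight X := by
      intro T hT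
      obtain ⟨S, hS, hSc⟩ := hcut T hT
      refine ⟨S, hS, ?_, hSc⟩
      rintro ⟨g, hg, c, hc⟩
      have hcard : (X \ T).card = 3 * n := by
        rw [Finset.card_sdiff_of_subset hT.subset, hT.card]; omega
      have h1 := card_le_of_line _ _ S rfl hS (Finset.card_pos.1 (by omega)) hc
      have h2 : {x ∈ X \ T | g x = c}.card ≤ {x ∈ X | g x = c}.card :=
        Finset.card_le_card (Finset.filter_subset_filter _ Finset.sdiff_subset)
      have h3 := hline g c hg
      omega
    refine absurd (htight.bad (by omega) ?_) hbad
    rintro ⟨g, hg, c, hc⟩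
    have := hline g c hg
    rw [Finset.filter_true_of_mem hc] at this
    omega

/-! ### Visibility and triangle partitions -/

theorem not_visible_iff {X : Finset Plane} {p q : Plane} (hp : p ∈ X) (hq : q ∈ X) (hpq : p ≠ q) :
    ¬ Visible X p q ↔ ∃ z ∈ X, z ∈ openSegment ℝ p q := by
  rw [Visible, ← insert_endpoints_openSegment]
  constructor
  · intro h
    by_contra! hno
    apply h
    ext z
    simp only [Set.mem_inter_iff, Finset.mem_coe, Set.mem_insert_iff, Set.mem_singleton_iff]
    have := hno z
    constructor
    · tauto
    · rintro (rfl | rfl) <;> tauto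
  · rintro ⟨z, hz, hzs⟩ h
    have hmem : z ∈ ({p, q} : Set Plane) := h ▸ ⟨hz, by simp [hzs]⟩
    have := ne_of_mem_openSegment hzs hpq
    simp at hmem
    tauto

theorem isIndependentSet_iff {X S : Finset Plane} : IsIndependentSet X S ↔ Indep X S := by
  constructor
  · rintro ⟨h1, h2⟩
    have h1 : S ⊆ X := by exact_mod_cast h1
    exact ⟨h1, fun p hp q hq hpq => (not_visible_iff (h1 hp) (h1 hq) hpq).1 (h2 p hp q hq hpq)⟩
  · rintro ⟨h1, h2⟩
    exact ⟨by exact_mod_cast h1, fun p hp q hq hpq =>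
      (not_visible_iff (h1 hp) (h1 hq) hpq).2 (h2 p hp q hq hpq)⟩

theorem collinear_iff_col {T : Finset Plane} : Collinear ℝ (T : Set Plane) ↔ Col T := by
  rw [collinear_iff_exists_forall_eq_smul_vadd]
  constructor
  · rintro ⟨p₀, v, h⟩
    obtain ⟨g, hg, hgv⟩ := exists_functional_eq p₀ (v +ᵥ p₀)
    refine ⟨g, hg, g p₀, fun p hp => ?_⟩
    obtain ⟨r, rfl⟩ := h p hp
    have : g v = 0 := by simpa using hgv
    simp [this]
  · rintro ⟨g, hg, c, hc⟩
    rcases T.eq_empty_or_nonempty with rfl | ⟨p₀, hp₀⟩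
    · exact ⟨0, 0, by simp⟩
    obtain ⟨φ, hi⟩ := exists_independent hg
    by_cases hne : ∃ p₁ ∈ T, p₁ ≠ p₀
    · obtain ⟨p₁, hp₁, hne⟩ := hne
      have hφ : φ p₁ - φ p₀ ≠ 0 := fun e =>
        hne (hi.eq ((hc p₁ hp₁).trans (hc p₀ hp₀).symm) (sub_eq_zero.1 e))
      refine ⟨p₀, p₁ - p₀, fun p hp => ⟨(φ p - φ p₀) / (φ p₁ - φ p₀), hi.eq ?_ ?_⟩⟩
      · simp [hc p hp, hc p₁ hp₁, hc p₀ hp₀]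
      · simp; field_simp; ring
    · push Not at hne
      exact ⟨p₀, 0, fun p hp => ⟨0, by simpa using hne p hp⟩⟩

theorem Sep.mono {A B A' B' : Finset Plane} (h : Sep A B) (hA : A' ⊆ A) (hB : B' ⊆ B) :
    Sep A' B' := by
  obtain ⟨f, c, h1, h2⟩ := h
  exact ⟨f, c, fun a ha => h1 a (hA ha), fun b hb => h2 b (hB hb)⟩

theorem Sep.disjoint_convexHull {A B : Finset Plane} (h : Sep A B) :
    Disjoint (convexHull ℝ (A : Set Plane)) (convexHull ℝ (B : Set Plane)) := by
  obtain ⟨f, c, h1, h2⟩ := h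
  have hA : convexHull ℝ (A : Set Plane) ⊆ {z | f z < c} :=
    convexHull_min (fun a ha => h1 a ha) (convex_halfSpace_lt f.isLinear c)
  have hB : convexHull ℝ (B : Set Plane) ⊆ {z | c < f z} :=
    convexHull_min (fun a ha => h2 a ha) (convex_halfSpace_gt f.isLinear c)
  refine Set.disjoint_left.2 fun z hz hz' => ?_
  have h3 : f z < c := hA hz
  have h4 : c < f z := hB hz'
  exact lt_asymm h3 h4

/-- The finitely many triangles of a partition. -/
theorem exists_finset_partition {X : Finset Plane} {𝒯 : Set (Set Plane)}
    (h : IsTrianglePartition X 𝒯) : ∃ F : Finset (Finset Plane),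
      𝒯 = (fun T : Finset Plane => (T : Set Plane)) '' F ∧ (∀ T ∈ F, T ⊆ X ∧ T.card = 3) ∧
      ∀ x ∈ X, ∃ T ∈ F, x ∈ T := by
  have hsub : ∀ T ∈ 𝒯, T ⊆ X := fun T hT => h.sUnion_eq ▸ Set.subset_sUnion_of_mem hT
  refine ⟨{T ∈ X.powerset | (T : Set Plane) ∈ 𝒯}, ?_, ?_, ?_⟩
  · ext T
    simp only [Set.mem_image, Finset.mem_coe, Finset.mem_filter, Finset.mem_powerset]
    constructor
    · intro hT
      have hfin : T.Finite := X.finite_toSet.subset (hsub T hT)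
      refine ⟨hfin.toFinset, ⟨?_, by simpa using hT⟩, by simp⟩
      intro x hx
      exact hsub T hT (by simpa using hx)
    · rintro ⟨T', ⟨-, hT'⟩, rfl⟩
      exact hT'
  · intro T hT
    simp only [Finset.mem_filter, Finset.mem_powerset] at hT
    refine ⟨hT.1, ?_⟩
    have := h.encard_eq _ hT.2
    rw [Set.encard_coe_eq_coe_finsetCard] at this
    exact_mod_cast this
  · intro x hx
    have : x ∈ ⋃₀ 𝒯 := by rw [h.sUnion_eq]; exact hx
    obtain ⟨T, hT, hxT⟩ := this
    have hfin : T.Finite := X.finite_toSet.subset (hsub T hT)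
    refine ⟨hfin.toFinset, ?_, by simpa using hxT⟩
    simp only [Finset.mem_filter, Finset.mem_powerset]
    exact ⟨fun x hx => hsub T hT (by simpa using hx), by simpa using hT⟩

theorem card_of_partition {X : Finset Plane} {𝒯 : Set (Set Plane)} (h : IsTrianglePartition X 𝒯) :
    ∃ m : ℕ, 𝒯.encard = m ∧ X.card = 3 * m ∧ ∀ S, Indep X S → S.card ≤ m := by
  obtain ⟨F, rfl, hF, hcov⟩ := exists_finset_partition h
  have hdisj : ∀ T ∈ F, ∀ U ∈ F, ∀ x, x ∈ convexHull ℝ (T : Set Plane) →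
      x ∈ convexHull ℝ (U : Set Plane) → T = U := by
    intro T hT U hU x hxT hxU
    by_contra hne
    exact Set.disjoint_left.1 (h.disjoint _ ⟨T, hT, rfl⟩ _ ⟨U, hU, rfl⟩
      (fun e => hne (Finset.coe_injective e))) hxT hxU
  refine ⟨F.card, ?_, ?_, ?_⟩
  · rw [Finset.coe_injective.encard_image, Set.encard_coe_eq_coe_finsetCard]
  · have hX : X = F.biUnion id := by
      ext x
      simp only [Finset.mem_biUnion, id]
      exact ⟨hcov x, fun ⟨T, hT, hx⟩ => (hF T hT).1 hx⟩
    rw [hX, Finset.card_biUnion]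
    · rw [Finset.sum_congr rfl fun T hT => show (id T).card = 3 from (hF T hT).2]
      simp [mul_comm]
    · intro T hT U hU hne
      exact Finset.disjoint_left.2 fun x hxT hxU => hne (hdisj T hT U hU x
        (subset_convexHull ℝ _ hxT) (subset_convexHull ℝ _ hxU))
  · intro S hS
    choose! τ hτF hτ using hcov
    refine Finset.card_le_card_of_injOn τ (fun s hs => hτF s (hS.1 hs)) ?_
    intro s hs s' hs' e
    by_contra hne
    obtain ⟨z, hz, hzs⟩ := hS.2 s hs s' hs' hne
    have hsT := hτ s (hS.1 hs)
    have hsT' : s' ∈ τ s := by rw [e]; exact hτ s' (hS.1 hs')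
    have hτs := hτF s (hS.1 hs)
    have hzh : z ∈ convexHull ℝ (τ s : Set Plane) :=
      (convex_convexHull ℝ _).openSegment_subset (subset_convexHull ℝ _ hsT)
        (subset_convexHull ℝ _ hsT') hzs
    -- The blocker lies in the closed triangle of `s`, hence in no other, so it is the third vertex,
    -- on a line with the other two.
    have hzT : z ∈ τ s := by
      rw [hdisj _ hτs _ (hτF z hz) z hzh (subset_convexHull ℝ _ (hτ z hz))]
      exact hτ z hz
    have hzne := ne_of_mem_openSegment hzs hne
    have hT : {s, s', z} = τ s := Finset.eq_of_subset_of_card_le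
      (by intro x hx; simp at hx; rcases hx with rfl | rfl | rfl <;> assumption)
      (by rw [card_triple hne hzne.1.symm hzne.2.symm, (hF _ hτs).2])
    refine h.not_collinear _ ⟨τ s, hτs, rfl⟩ (collinear_iff_col.2 ?_)
    rw [← hT]
    obtain ⟨g, hg, hgs⟩ := exists_functional_eq s s'
    exact ⟨g, hg, g s, by simp [hgs, eq_of_mem_openSegment hzs hgs rfl]⟩

theorem Guillotine.exists_partition {X : Finset Plane} (h : Guillotine X) :
    ∃ 𝒯, IsTrianglePartition X 𝒯 := by
  induction h with
  | empty => exact ⟨∅, by simp, by simp, by simp, by simp⟩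
  | triangle hc hcol =>
    rename_i T
    refine ⟨{(T : Set Plane)}, by simp, ?_, ?_, ?_⟩
    · simp [Set.encard_coe_eq_coe_finsetCard, hc]
    · simpa [collinear_iff_col] using hcol
    · simp
  | join hsep _ _ ihA ihB =>
    rename_i A B
    obtain ⟨𝒜, hA⟩ := ihA
    obtain ⟨ℬ, hB⟩ := ihB
    have hAB : ∀ T ∈ 𝒜, ∀ U ∈ ℬ, Disjoint (convexHull ℝ T) (convexHull ℝ U) := fun T hT U hU =>
      hsep.disjoint_convexHull.mono
        (convexHull_mono (hA.sUnion_eq ▸ Set.subset_sUnion_of_mem hT))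
        (convexHull_mono (hB.sUnion_eq ▸ Set.subset_sUnion_of_mem hU))
    refine ⟨𝒜 ∪ ℬ, ?_, ?_, ?_, ?_⟩
    · rw [Set.sUnion_union, hA.sUnion_eq, hB.sUnion_eq]; simp
    · rintro T (hT | hT)
      exacts [hA.encard_eq T hT, hB.encard_eq T hT]
    · rintro T (hT | hT)
      exacts [hA.not_collinear T hT, hB.not_collinear T hT]
    · rintro T (hT | hT) U (hU | hU) hne
      exacts [hA.disjoint T hT U hU hne, hAB T hT U hU, (hAB U hU T hT).symm,
        hB.disjoint T hT U hU hne]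

theorem not_bad_of_partition {X : Finset Plane} {𝒯 : Set (Set Plane)}
    (h : IsTrianglePartition X 𝒯) : ¬ Bad X := by
  obtain ⟨m, -, hX, hS⟩ := card_of_partition h
  rintro ⟨S, hSi, hSc⟩
  have := hS S hSi
  omega

theorem exists_partition_iff {X : Finset Plane} {n : ℕ} (hX : X.card = 3 * n) :
    (∃ 𝒯, IsTrianglePartition X 𝒯) ↔ ¬ Bad X :=
  ⟨fun ⟨_, h⟩ => not_bad_of_partition h, fun h =>
    (guillotine_of_not_bad n X hX h).exists_partition⟩

theorem exists_independent_iff {X : Finset Plane} {n : ℕ} (hX : X.card = 3 * n) :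
    (∃ S, IsIndependentSet X S ∧ S.encard = ((n + 1 : ℕ) : ℕ∞)) ↔ Bad X := by
  constructor
  · rintro ⟨S, hS, hc⟩
    have hfin : S.Finite := X.finite_toSet.subset hS.1
    obtain ⟨S, rfl⟩ := hfin.exists_finset_coe
    rw [Set.encard_coe_eq_coe_finsetCard] at hc
    have hc : S.card = n + 1 := by exact_mod_cast hc
    exact ⟨S, isIndependentSet_iff.1 hS, by omega⟩
  · rintro ⟨S, hS, hc⟩
    obtain ⟨S', hS', hc'⟩ := Finset.exists_subset_card_eq (show n + 1 ≤ S.card by omega)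
    refine ⟨S', isIndependentSet_iff.2 (hS.mono hS'), ?_⟩
    rw [Set.encard_coe_eq_coe_finsetCard, hc']

/-- Both directions of the characterization of the sets with triangle partitions. -/
theorem partition_characterization (n : ℕ) (P : Set Plane) (hP : P.encard = ((3 * n : ℕ) : ℕ∞)) :
    ((¬ ∃ S, IsIndependentSet P S ∧ S.encard = ((n + 1 : ℕ) : ℕ∞)) →
      ∃ 𝒯, IsTrianglePartition P 𝒯 ∧ 𝒯.encard = (n : ℕ∞)) ∧
    ((∃ 𝒯, IsTrianglePartition P 𝒯) →
      ¬ ∃ S, IsIndependentSet P S ∧ S.encard = ((n + 1 : ℕ) : ℕ∞)) := by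
  obtain ⟨X, rfl⟩ := (Set.finite_of_encard_eq_coe hP).exists_finset_coe
  rw [Set.encard_coe_eq_coe_finsetCard] at hP
  have hX : X.card = 3 * n := by exact_mod_cast hP
  rw [exists_independent_iff hX]
  refine ⟨fun h => ?_, fun h => (exists_partition_iff hX).1 h⟩
  obtain ⟨𝒯, h𝒯⟩ := (exists_partition_iff hX).2 h
  obtain ⟨m, hm, hXm, -⟩ := card_of_partition h𝒯
  obtain rfl : m = n := by omega
  exact ⟨𝒯, h𝒯, hm⟩

/-! ### A test for large independent sets -/

/-- Betweenness in the form that the machine can test: signs of polynomials in the coordinates. -/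
theorem mem_openSegment_iff_cross {p q z : Plane} (hpq : p ≠ q) :
    z ∈ openSegment ℝ p q ↔ cross p q z = 0 ∧ 0 < dot p q z ∧ 0 < dot q p z := by
  have hi := cross_dot_independent hpq.symm
  have hd : dot q p z = ofCoeffs (q 0 - p 0) (q 1 - p 1) q - ofCoeffs (q 0 - p 0) (q 1 - p 1) z := by
    simp [dot]; ring
  have hlt : ofCoeffs (q 0 - p 0) (q 1 - p 1) p < ofCoeffs (q 0 - p 0) (q 1 - p 1) q := by
    have hne : ofCoeffs (q 0 - p 0) (q 1 - p 1) p ≠ ofCoeffs (q 0 - p 0) (q 1 - p 1) q := fun e =>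
      hpq (hi.eq (by simp; ring) e)
    refine lt_of_le_of_ne ?_ hne
    simp; nlinarith [sq_nonneg (q 0 - p 0), sq_nonneg (q 1 - p 1)]
  rw [cross_eq, dot_eq, hd, sub_eq_zero, sub_pos, sub_pos]
  constructor
  · intro h
    exact ⟨eq_of_mem_openSegment h rfl (by simp; ring), lt_of_mem_openSegment h hlt⟩
  · rintro ⟨h1, h2, h3⟩
    exact mem_openSegment_of hi.left_ne_zero (by simp; ring) h1 h2 h3

/-- A test for the existence of large independent sets. -/
def BadTest (X : Finset Plane) : Prop :=
  (∃ p ∈ X, ∃ q ∈ X, p ≠ q ∧ 2 * X.card + 3 ≤ 3 * {z ∈ X | cross p q z = 0}.card) ∨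
  ((∀ p ∈ alternate X, ∀ q ∈ alternate X, p ≠ q →
    ∃ z ∈ X, cross p q z = 0 ∧ 0 < dot p q z ∧ 0 < dot q p z) ∧
    X.card + 3 ≤ 3 * (alternate X).card)

/-- A witness is either collinear, and then its line has at least `2n + 1` points of `X`, or tight,
and then it is `alternate X`. -/
theorem badTest_iff {X : Finset Plane} {n : ℕ} (hX : X.card = 3 * n) : BadTest X ↔ Bad X := by
  constructor
  · rintro (⟨p, hp, q, hq, hpq, hc⟩ | ⟨h, hc⟩)
    · have hi := cross_dot_independent hpq.symm
      obtain ⟨S, -, hS, hSc⟩ := exists_indep_of_line hi.left_ne_zero (X := X) _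
        {z ∈ X | cross p q z = 0} rfl (Finset.filter_subset _ _)
        (c := ofCoeffs (-(q 1 - p 1)) (q 0 - p 0) p) (by
          intro z hz
          have := (Finset.mem_filter.1 hz).2
          rw [cross_eq, sub_eq_zero] at this
          exact this)
      exact ⟨S, hS, by omega⟩
    · refine ⟨_, ⟨Finset.filter_subset _ _, fun p hp q hq hpq => ?_⟩, hc⟩
      obtain ⟨z, hz, hz'⟩ := h p hp q hq hpq
      exact ⟨z, hz, (mem_openSegment_iff_cross hpq).2 hz'⟩
  · rintro ⟨S, hS, hc⟩
    by_cases hcol : Col S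
    · left
      have h0 := Finset.card_le_card hS.1
      obtain ⟨p, hp, q, hq, hpq⟩ := Finset.one_lt_card.1 (show 1 < S.card by omega)
      refine ⟨p, hS.1 hp, q, hS.1 hq, hpq, ?_⟩
      obtain ⟨g, hg, c, hgc⟩ := hcol
      have h1 := card_le_of_line _ X S rfl hS ⟨p, hp⟩ hgc
      have h2 : {x ∈ X | g x = c}.card ≤ {z ∈ X | cross p q z = 0}.card := by
        refine Finset.card_le_card fun z hz => ?_
        obtain ⟨hzX, hz⟩ := Finset.mem_filter.1 hz
        refine Finset.mem_filter.2 ⟨hzX, ?_⟩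
        rw [cross_eq, sub_eq_zero]
        obtain ⟨w, hw⟩ := exists_ne_zero hg
        have := proportional (g := g) (k := ofCoeffs (-(q 1 - p 1)) (q 0 - p 0)) hpq
          ((hgc p hp).trans (hgc q hq).symm) (by simp; ring) (p + w) z
        rw [hz, hgc p hp, map_add, hgc p hp, sub_self, zero_mul, add_sub_cancel_left] at this
        linarith [(mul_eq_zero.1 this).resolve_left hw]
      omega
    · right
      have ht : Tight X S := ⟨hS, hcol, hc⟩
      rw [← ht.eq_alternate]
      exact ⟨fun p hp q hq hpq => by
        obtain ⟨z, hz, hzs⟩ := hS.2 p hp q hq hpq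
        exact ⟨z, hz, (mem_openSegment_iff_cross hpq).1 hzs⟩, hc⟩

/-! ### Cuts along lines through two of the points -/

/-- The side of the line from `p` to `q` which contains the part of this line up to `p`. -/
def Side (p q z : Plane) : Prop := 0 < cross p q z ∨ cross p q z = 0 ∧ dot p q z ≤ 0

theorem side_left (p q : Plane) : Side p q p := by right; simp [cross, dot]

theorem not_side_right {p q : Plane} (h : p ≠ q) : ¬ Side p q q := by
  have hi := cross_dot_independent h.symm
  have h0 : cross p q q = 0 := by simp [cross]; ring
  rintro (h1 | ⟨-, h1⟩)
  · exact absurd h0 h1.ne'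
  · have h2 : dot p q q = (q 0 - p 0) ^ 2 + (q 1 - p 1) ^ 2 := by simp [dot]; ring
    rw [h2] at h1
    refine h ?_
    have e0 : q 0 - p 0 = 0 := by nlinarith [sq_nonneg (q 0 - p 0), sq_nonneg (q 1 - p 1)]
    have e1 : q 1 - p 1 = 0 := by nlinarith [sq_nonneg (q 0 - p 0), sq_nonneg (q 1 - p 1)]
    ext i; fin_cases i
    · simp; linarith
    · simp; linarith

/-- `Side` is an open half-plane with a half-line of its boundary attached; a slight turn makes the
separation strict. -/
theorem sep_side {A B : Finset Plane} {p q : Plane} (hA : ∀ a ∈ A, Side p q a)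
    (hB : ∀ b ∈ B, ¬ Side p q b) : Sep A B := by
  refine sep_of_lex (-ofCoeffs (-(q 1 - p 1)) (q 0 - p 0)) (ofCoeffs (q 0 - p 0) (q 1 - p 1))
    fun a ha b hb => ?_
  have h1 := hA a ha
  have h2 := hB b hb
  simp only [Side, cross_eq, dot_eq, not_or, not_and, not_le, not_lt] at h1 h2
  simp only [LinearMap.neg_apply, neg_lt_neg_iff, neg_inj]
  rcases h1 with h1 | ⟨h1, h1'⟩ <;> rcases h2.1.lt_or_eq with h3 | h3
  · left; linarith
  · left; linarith
  · left; linarith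
  · right
    have := h2.2 h3
    constructor <;> linarith

/-- Separated sets are separated by a line through two of the points. -/
theorem Sep.exists_side {A B : Finset Plane} (h : Sep A B) (hA : A.Nonempty) (hB : B.Nonempty) :
    ∃ p ∈ A, ∃ q ∈ B, (∀ a ∈ A, Side p q a) ∧ ∀ b ∈ B, ¬ Side p q b := by
  obtain ⟨f, c, hfA, hfB⟩ := h
  obtain ⟨α, β, hf⟩ := functional_eq_ofCoeffs f
  set φ := ofCoeffs (-β) α with hφ
  have hlt : ∀ a ∈ A, ∀ b ∈ B, 0 < f b - f a := fun a ha b hb => by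
    linarith [hfA a ha, hfB b hb]
  -- The separating line is turned as far as possible: the steepest line from a point of `A` to a
  -- point of `B` has `A` and `B` on different closed sides.
  obtain ⟨⟨p₀, q⟩, hpq, hmax⟩ := (A ×ˢ B).exists_max_image
    (fun x => (φ x.2 - φ x.1) / (f x.2 - f x.1)) (hA.product hB)
  rw [Finset.mem_product] at hpq
  set m := (φ q - φ p₀) / (f q - f p₀) with hm
  have hm₀ : φ q - φ p₀ = m * (f q - f p₀) := by
    have := (hlt p₀ hpq.1 q hpq.2).ne'
    rw [hm]; field_simp
  have hle : ∀ a ∈ A, ∀ b ∈ B, φ b - φ a ≤ m * (f b - f a) := fun a ha b hb => by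
    have := hmax (a, b) (Finset.mk_mem_product ha hb)
    simp only at this
    rwa [div_le_iff₀ (hlt a ha b hb)] at this
  -- The last point of `A` on this line is chosen, so that all of `A` on the line is on the
  -- half-line up to `p`.
  obtain ⟨p, hp, hpmax⟩ := {a ∈ A | φ q - φ a = m * (f q - f a)}.exists_max_image f
    ⟨p₀, by simp [hpq.1, hm₀]⟩
  simp only [Finset.mem_filter, and_imp] at hp hpmax
  have hq := hpq.2
  have hfpq := hlt p hp.1 q hq
  -- `(f, φ)` are coordinates in a similar frame, so `cross` is scaled by `α ^ 2 + β ^ 2`.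
  have hcross : ∀ z, (α ^ 2 + β ^ 2) * cross p q z =
      (f q - f p) * ((φ z - φ p) - m * (f z - f p)) := fun z => by
    have : (α ^ 2 + β ^ 2) * cross p q z =
        (f q - f p) * (φ z - φ p) - (φ q - φ p) * (f z - f p) := by
      simp only [hf, hφ, cross, ofCoeffs_apply]; ring
    rw [this, hp.2]; ring
  have hdot : ∀ z, cross p q z = 0 → (f q - f p) * dot p q z = (f z - f p) * dot p q q := by
    intro z hz
    have hz : (q 0 - p 0) * (z 1 - p 1) = (q 1 - p 1) * (z 0 - p 0) := by
      simp only [cross] at hz; linarith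
    simp only [hf, dot]
    linear_combination (α * (q 1 - p 1) - β * (q 0 - p 0)) * hz
  have hpos : 0 < α ^ 2 + β ^ 2 := by
    by_contra! h0
    have h1 : α = 0 := by nlinarith [sq_nonneg α, sq_nonneg β]
    have h2 : β = 0 := by nlinarith [sq_nonneg α, sq_nonneg β]
    simp [hf, h1, h2] at hfpq
  have hqq : 0 < dot p q q := by
    have : ¬ dot p q q ≤ 0 := fun h => not_side_right (p := p) (q := q)
      (fun e => by rw [e] at hfpq; simp at hfpq) (Or.inr ⟨by simp [cross]; ring, h⟩)
    linarith
  refine ⟨p, hp.1, q, hq, fun a ha => ?_, fun b hb => ?_⟩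
  · have h1 := hle a ha q hq
    have h2 : 0 ≤ (φ a - φ p) - m * (f a - f p) := by linarith [hp.2]
    have h3 : 0 ≤ cross p q a := by
      have := hcross a ▸ mul_nonneg hfpq.le h2
      exact nonneg_of_mul_nonneg_right this hpos
    rcases h3.lt_or_eq with h3 | h3
    · exact Or.inl h3
    · refine Or.inr ⟨h3.symm, ?_⟩
      have h4 := hcross a
      rw [← h3, mul_zero] at h4
      have h5 := (mul_eq_zero.1 h4.symm).resolve_left hfpq.ne'
      have h6 := hpmax a ha (by linarith [hp.2])
      have h7 := hdot a h3.symm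
      by_contra! h8
      nlinarith [mul_pos hfpq h8]
  · have h1 := hle p hp.1 b hb
    have h2 : (φ b - φ p) - m * (f b - f p) ≤ 0 := by linarith
    have h3 : cross p q b ≤ 0 := by
      have := hcross b ▸ mul_nonpos_of_nonneg_of_nonpos hfpq.le h2
      exact nonpos_of_mul_nonpos_right this hpos
    rintro (h4 | ⟨h4, h5⟩)
    · linarith
    · have h6 := hdot b h4
      have := mul_pos (hlt p hp.1 b hb) hqq
      nlinarith

theorem Guillotine.three_dvd {X : Finset Plane} (h : Guillotine X) : ∃ m, X.card = 3 * m := by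
  obtain ⟨𝒯, h𝒯⟩ := h.exists_partition
  obtain ⟨m, -, hm, -⟩ := card_of_partition h𝒯
  exact ⟨m, hm⟩

theorem Guillotine.not_bad {X : Finset Plane} (h : Guillotine X) : ¬ Bad X := by
  obtain ⟨𝒯, h𝒯⟩ := h.exists_partition
  exact not_bad_of_partition h𝒯

/-- A join may have an empty side; such joins are skipped. -/
theorem Guillotine.exists_cut {X : Finset Plane} (h : Guillotine X) (hX : 3 < X.card) :
    ∃ A B, A.Nonempty ∧ B.Nonempty ∧ X = A ∪ B ∧ Sep A B ∧ Guillotine A ∧ Guillotine B := by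
  induction h with
  | empty => simp at hX
  | triangle hc _ => omega
  | join hsep hA hB ihA ihB =>
    rename_i A B
    rcases A.eq_empty_or_nonempty with rfl | hA'
    · rw [Finset.empty_union] at hX ⊢
      exact ihB hX
    rcases B.eq_empty_or_nonempty with rfl | hB'
    · rw [Finset.union_empty] at hX ⊢
      exact ihA hX
    exact ⟨A, B, hA', hB', rfl, hsep, hA, hB⟩

/-- A set of more than three points without large independent sets can be cut into two such sets by
a line through two of the points. -/
theorem exists_side_of_not_bad {X : Finset Plane} {n : ℕ} (hX : X.card = 3 * n) (hb : ¬ Bad X)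
    (h3 : X.card ≠ 3) (h0 : X.Nonempty) :
    ∃ p ∈ X, ∃ q ∈ X, p ≠ q ∧ (∃ m, {z ∈ X | Side p q z}.card = 3 * m) ∧
      ¬ Bad {z ∈ X | Side p q z} ∧ ¬ Bad {z ∈ X | ¬ Side p q z} := by
  have := Finset.card_pos.2 h0
  obtain ⟨A, B, hA, hB, rfl, hsep, hGA, hGB⟩ :=
    (guillotine_of_not_bad n X hX hb).exists_cut (by omega)
  obtain ⟨p, hp, q, hq, hpA, hqB⟩ := hsep.exists_side hA hB
  have eA : {z ∈ A ∪ B | Side p q z} = A := by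
    ext z
    simp only [Finset.mem_filter, Finset.mem_union]
    have := hpA z
    have := hqB z
    tauto
  have eB : {z ∈ A ∪ B | ¬ Side p q z} = B := by
    ext z
    simp only [Finset.mem_filter, Finset.mem_union]
    have := hpA z
    have := hqB z
    tauto
  refine ⟨p, Finset.mem_union_left _ hp, q, Finset.mem_union_right _ hq, ?_, ?_, ?_, ?_⟩
  · exact fun e => Finset.disjoint_left.1 hsep.disjoint hp (e ▸ hq)
  · rw [eA]; exact hGA.three_dvd
  · rw [eA]; exact hGA.not_bad
  · rw [eB]; exact hGB.not_bad

open RealRAM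

/-! ### Programs for bounded counting -/

/-- The number of points. -/
def size (σ : Store) : ℕ := σ.nat 0 0

/-- Memories which agree except for the natural-number array `11` and the cells from `d` on of the
natural-number array `10`; these hold intermediate results. -/
structure Agree (d : ℕ) (σ τ : Store) : Prop where
  real : τ.real = σ.real
  nat : ∀ a, a ≠ 10 → a ≠ 11 → τ.nat a = σ.nat a
  stack : ∀ k, k < d → τ.nat 10 k = σ.nat 10 k

theorem Agree.refl (d : ℕ) (σ : Store) : Agree d σ σ := ⟨rfl, fun _ _ _ => rfl, fun _ _ => rfl⟩

theorem Agree.trans {d : ℕ} {σ τ υ : Store} (h : Agree d σ τ) (h' : Agree d τ υ) : Agree d σ υ :=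
  ⟨h'.real.trans h.real, fun a h1 h2 => (h'.nat a h1 h2).trans (h.nat a h1 h2),
    fun k hk => (h'.stack k hk).trans (h.stack k hk)⟩

theorem Agree.mono {d e : ℕ} {σ τ : Store} (h : Agree e σ τ) (hde : d ≤ e) : Agree d σ τ :=
  ⟨h.real, h.nat, fun k hk => h.stack k (hk.trans_le hde)⟩

theorem Agree.size_eq {d : ℕ} {σ τ : Store} (h : Agree d σ τ) : size τ = size σ := by
  rw [size, size, h.nat 0 (by norm_num) (by norm_num)]

@[simp] theorem setNat_nat_self (σ : Store) (a i v : ℕ) : (σ.setNat a i v).nat a i = v := by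
  simp [Store.setNat]

theorem setNat_nat_of_ne (σ : Store) {a b : ℕ} (i v : ℕ) (h : b ≠ a) :
    (σ.setNat a i v).nat b = σ.nat b := by
  simp [Store.setNat, h]

theorem setNat_nat_of_ne' (σ : Store) (a : ℕ) {i j : ℕ} (v : ℕ) (h : j ≠ i) :
    (σ.setNat a i v).nat a j = σ.nat a j := by
  simp [Store.setNat, h]

theorem agree_setNat_stack {d k : ℕ} (σ : Store) (v : ℕ) (h : d ≤ k) :
    Agree d σ (σ.setNat 10 k v) :=
  ⟨rfl, fun a h1 _ => setNat_nat_of_ne _ _ _ h1, fun j hj => setNat_nat_of_ne' _ _ _ (by omega)⟩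

theorem agree_setNat_result (d : ℕ) (σ : Store) (i v : ℕ) : Agree d σ (σ.setNat 11 i v) :=
  ⟨rfl, fun a _ h2 => setNat_nat_of_ne _ _ _ h2, fun j _ => by
    rw [setNat_nat_of_ne _ _ _ (by norm_num)]⟩

theorem Agree.setNat {d : ℕ} {σ τ : Store} (h : Agree d σ τ) (a i v : ℕ) :
    Agree d (σ.setNat a i v) (τ.setNat a i v) := by
  refine ⟨h.real, fun b h1 h2 => ?_, fun k hk => ?_⟩
  · by_cases e : b = a
    · subst e; simp [Store.setNat, h.nat b h1 h2]
    · rw [setNat_nat_of_ne _ _ _ e, setNat_nat_of_ne _ _ _ e, h.nat b h1 h2]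
  · by_cases e : 10 = a
    · subst e
      by_cases e' : k = i
      · subst e'; simp
      · rw [setNat_nat_of_ne' _ _ _ e', setNat_nat_of_ne' _ _ _ e', h.stack k hk]
    · rw [setNat_nat_of_ne _ _ _ e, setNat_nat_of_ne _ _ _ e, h.stack k hk]

/-- The value depends on the first `d` cells of the stack only. -/
def Stable {α : Type*} (d : ℕ) (f : Store → α) : Prop := ∀ σ τ, Agree d σ τ → f τ = f σ

/-- Loop for the variable in cell `d` of the stack. -/
def forLoop (d : ℕ) (body : Program) : Program :=
  .seq (.writeNat 10 (.const d) (.const 0))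
    (.while (.natLT (.read 10 (.const d)) (.read 0 (.const 0)))
      (.seq body (.writeNat 10 (.const d) (.add (.read 10 (.const d)) (.const 1)))))

/-- Besides preserving `I`, the body must keep the number of points and the loop variable. Each pass
adds `11` steps to the body, for the test and the increment; the initial assignment and the last
test take `8`. -/
theorem runs_forLoop {d N B : ℕ} {body : Program} (I : ℕ → Store → Prop)
    (hb : ∀ v σ, v < N → size σ = N → σ.nat 10 d = v → I v σ →
      ∃ t τ, Runs body σ t τ ∧ t ≤ B ∧ size τ = N ∧ τ.nat 10 d = v ∧
        I (v + 1) (τ.setNat 10 d (v + 1)))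
    (σ : Store) (hσ : size σ = N) (h0 : I 0 (σ.setNat 10 d 0)) :
    ∃ t τ, Runs (forLoop d body) σ t τ ∧ t ≤ 8 + N * (B + 11) ∧ I N τ := by
  have loop : ∀ (m v : ℕ) (σ : Store), v + m = N → size σ = N → σ.nat 10 d = v → I v σ →
      ∃ t τ, Runs (.while (.natLT (.read 10 (.const d)) (.read 0 (.const 0)))
        (.seq body (.writeNat 10 (.const d) (.add (.read 10 (.const d)) (.const 1))))) σ t τ ∧
        t ≤ 5 + m * (B + 11) ∧ I N τ := by
    intro m
    induction m with
    | zero =>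
      intro v σ hv hσ hd hI
      obtain rfl : v = N := by omega
      refine ⟨_, σ, .while_false ?_, by simp [Test.cost, NatExpr.cost], hI⟩
      simp only [Test.holds, NatExpr.value]
      have : σ.nat 0 0 = v := hσ
      omega
    | succ m ih =>
      intro v σ hv hσ hd hI
      obtain ⟨t, τ, hr, ht, hs, hd', hI'⟩ := hb v σ (by omega) hσ hd hI
      obtain ⟨t', τ', hr', ht', hI''⟩ := ih (v + 1) (τ.setNat 10 d (v + 1)) (by omega)
        (by rw [size, setNat_nat_of_ne _ _ _ (by norm_num)]; exact hs) (by simp) hI'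
      refine ⟨_, τ', .while_true (t := t') ?_ (.seq hr (.writeNat _ _ _ _)) ?_, ?_, hI''⟩
      · simp only [Test.holds, NatExpr.value]
        have : σ.nat 0 0 = N := hσ
        omega
      · simpa only [NatExpr.value, hd'] using hr'
      · simp only [Test.cost, NatExpr.cost]
        have : (m + 1) * (B + 11) = m * (B + 11) + (B + 11) := by ring
        omega
  obtain ⟨t, τ, hr, ht, hI⟩ := loop N 0 (σ.setNat 10 d 0) (by omega)
    (by rw [size, setNat_nat_of_ne _ _ _ (by norm_num)]; exact hσ) (by simp) h0
  refine ⟨_, τ, .seq (.writeNat _ _ _ _) (by simpa only [NatExpr.value] using hr), ?_, hI⟩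
  simp only [NatExpr.cost]
  omega

/-- The property can be decided by a program in polynomial time. -/
def Dcd (d : ℕ) (Φ : Store → Prop) : Prop :=
  Stable d Φ ∧ ∃ (π : Program) (q : Polynomial ℕ), ∀ σ, ∃ t τ, Runs π σ t τ ∧
    t ≤ q.eval (size σ) ∧ Agree d σ τ ∧ (0 < τ.nat 11 0 ↔ Φ σ)

/-- The property can be decided by a single test. -/
def IsTest (Φ : Store → Prop) : Prop := ∃ b : Test, ∀ σ, b.holds σ ↔ Φ σ

theorem Dcd.of_isTest {d : ℕ} {Φ : Store → Prop} (hs : Stable d Φ) (h : IsTest Φ) : Dcd d Φ := by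
  obtain ⟨b, hb⟩ := h
  refine ⟨hs, .ite b (.writeNat 11 (.const 0) (.const 1)) (.writeNat 11 (.const 0) (.const 0)),
    .C (b.cost + 3), fun σ => ?_⟩
  by_cases h : b.holds σ
  · refine ⟨_, _, .ite_true h (.writeNat _ _ _ _), by simp [NatExpr.cost],
      agree_setNat_result _ _ _ _, ?_⟩
    simp [NatExpr.value, (hb σ).1 h]
  · refine ⟨_, _, .ite_false h (.writeNat _ _ _ _), by simp [NatExpr.cost],
      agree_setNat_result _ _ _ _, ?_⟩
    simpa [NatExpr.value, hb σ] using h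

theorem Dcd.congr {d : ℕ} {Φ Ψ : Store → Prop} (h : Dcd d Φ) (e : ∀ σ, Φ σ ↔ Ψ σ) : Dcd d Ψ := by
  have : Φ = Ψ := funext fun σ => propext (e σ)
  rwa [← this]

theorem Dcd.true (d : ℕ) : Dcd d fun _ => True :=
  .of_isTest (fun _ _ _ => rfl) ⟨.natLT (.const 0) (.const 1), fun σ => by
    simp [Test.holds, NatExpr.value]⟩

theorem Dcd.false (d : ℕ) : Dcd d fun _ => False :=
  .of_isTest (fun _ _ _ => rfl) ⟨.natLT (.const 0) (.const 0), fun σ => by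
    simp [Test.holds, NatExpr.value]⟩

/-- A branch on the answer in array `11`; with the constant predicates it yields all the
connectives. -/
theorem Dcd.cases {d : ℕ} {Φ Ψ Χ : Store → Prop} (hΦ : Dcd d Φ) (hΨ : Dcd d Ψ) (hΧ : Dcd d Χ) :
    Dcd d fun σ => (Φ σ ∧ Ψ σ) ∨ (¬ Φ σ ∧ Χ σ) := by
  obtain ⟨sΦ, π, q, hπ⟩ := hΦ
  obtain ⟨sΨ, π₁, q₁, hπ₁⟩ := hΨ
  obtain ⟨sΧ, π₂, q₂, hπ₂⟩ := hΧ
  refine ⟨fun σ τ h => by simp only [sΦ σ τ h, sΨ σ τ h, sΧ σ τ h],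
    .seq π (.ite (.natLT (.const 0) (.read 11 (.const 0))) π₁ π₂), q + q₁ + q₂ + .C 4, fun σ => ?_⟩
  obtain ⟨t, τ, hr, ht, ha, hτ⟩ := hπ σ
  by_cases h : Φ σ
  · obtain ⟨t₁, τ₁, hr₁, ht₁, ha₁, hτ₁⟩ := hπ₁ τ
    rw [ha.size_eq] at ht₁
    refine ⟨_, τ₁, .seq hr (.ite_true (by simpa [Test.holds, NatExpr.value] using hτ.2 h) hr₁),
      ?_, ha.trans ha₁, ?_⟩
    · simp [Test.cost, NatExpr.cost]; omega
    · rw [hτ₁, sΨ σ τ ha]; tauto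
  · obtain ⟨t₁, τ₁, hr₁, ht₁, ha₁, hτ₁⟩ := hπ₂ τ
    rw [ha.size_eq] at ht₁
    refine ⟨_, τ₁, .seq hr (.ite_false (by
      simpa [Test.holds, NatExpr.value] using fun h' => h (hτ.1 (Nat.pos_of_ne_zero h'))) hr₁),
      ?_, ha.trans ha₁, ?_⟩
    · simp [Test.cost, NatExpr.cost]; omega
    · rw [hτ₁, sΧ σ τ ha]; tauto

theorem Dcd.not {d : ℕ} {Φ : Store → Prop} (h : Dcd d Φ) : Dcd d fun σ => ¬ Φ σ :=
  (h.cases (.false d) (.true d)).congr fun σ => by tauto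

theorem Dcd.and {d : ℕ} {Φ Ψ : Store → Prop} (h : Dcd d Φ) (h' : Dcd d Ψ) :
    Dcd d fun σ => Φ σ ∧ Ψ σ := (h.cases h' (.false d)).congr fun σ => by tauto

theorem Dcd.or {d : ℕ} {Φ Ψ : Store → Prop} (h : Dcd d Φ) (h' : Dcd d Ψ) :
    Dcd d fun σ => Φ σ ∨ Ψ σ := (h.cases (.true d) h').congr fun σ => by tauto

theorem Dcd.imp {d : ℕ} {Φ Ψ : Store → Prop} (h : Dcd d Φ) (h' : Dcd d Ψ) :
    Dcd d fun σ => Φ σ → Ψ σ := (h.cases h' (.true d)).congr fun σ => by tauto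

/-- The number of the `i < N` with the property `Φ`. -/
noncomputable def count (N : ℕ) (Φ : ℕ → Prop) : ℕ := ((Finset.range N).filter Φ).card

theorem count_succ (N : ℕ) (Φ : ℕ → Prop) :
    count (N + 1) Φ = count N Φ + if Φ N then 1 else 0 := by
  rw [count, count, Finset.range_add_one, Finset.filter_insert]
  split_ifs with h
  · rw [Finset.card_insert_of_notMem (by simp)]
  · rfl

theorem count_pos {N : ℕ} {Φ : ℕ → Prop} : 0 < count N Φ ↔ ∃ i < N, Φ i := by
  simp [count, Finset.card_pos, Finset.Nonempty]

/-- The program counts, and puts the result into cell `d` of the stack. -/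
theorem exists_count {d : ℕ} {Φ : Store → ℕ → Prop} (hs : ∀ v, Stable d fun σ => Φ σ v)
    (h : Dcd (d + 2) fun σ => Φ σ (σ.nat 10 d)) : ∃ (π : Program) (q : Polynomial ℕ), ∀ σ,
      ∃ t τ, Runs π σ t τ ∧ t ≤ q.eval (size σ) ∧ Agree d σ τ ∧
        τ.nat 10 d = count (size σ) (Φ σ) := by
  obtain ⟨-, π, q, hπ⟩ := h
  -- Cell `d` is the loop variable and cell `d + 1` the counter, so the body has the stack from `d +
  -- 2` on; the result is finally moved to cell `d`.
  refine ⟨.seq (.writeNat 10 (.const (d + 1)) (.const 0)) (.seq (forLoop d (.seq π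
    (.ite (.natLT (.const 0) (.read 11 (.const 0)))
      (.writeNat 10 (.const (d + 1)) (.add (.read 10 (.const (d + 1))) (.const 1))) .skip)))
    (.writeNat 10 (.const d) (.read 10 (.const (d + 1))))),
    .C 15 + .X * (q + .C 21), fun σ => ?_⟩
  obtain ⟨t, τ, hr, ht, hI⟩ := runs_forLoop (d := d) (N := size σ) (B := q.eval (size σ) + 10)
    (body := .seq π (.ite (.natLT (.const 0) (.read 11 (.const 0)))
      (.writeNat 10 (.const (d + 1)) (.add (.read 10 (.const (d + 1))) (.const 1))) .skip))
    (fun v τ => Agree d σ τ ∧ τ.nat 10 (d + 1) = count v (Φ σ)) (by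
      rintro v τ hv hτ hd ⟨ha, hc⟩
      obtain ⟨t, τ', hr, ht, ha', hτ'⟩ := hπ τ
      rw [hτ] at ht
      have e1 : τ'.nat 10 d = v := by rw [ha'.stack d (by omega), hd]
      have e2 : τ'.nat 10 (d + 1) = count v (Φ σ) := by rw [ha'.stack (d + 1) (by omega), hc]
      have e3 : Φ τ (τ.nat 10 d) ↔ Φ σ v := by rw [hd]; exact iff_of_eq (hs v σ τ ha)
      have ha'' : Agree d σ τ' := ha.trans (ha'.mono (by omega))
      replace hτ' : 0 < τ'.nat 11 0 ↔ Φ σ v := hτ'.trans e3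
      by_cases hΦ : Φ σ v
      · refine ⟨_, _, .seq hr (.ite_true (by simpa [Test.holds, NatExpr.value] using hτ'.2 hΦ)
          (.writeNat _ _ _ _)), ?_, ?_, ?_, ?_, ?_⟩
        · simp [Test.cost, NatExpr.cost]; omega
        · rw [size, setNat_nat_of_ne _ _ _ (by norm_num)]; exact ha''.size_eq
        · simp only [NatExpr.value]; rw [setNat_nat_of_ne' _ _ _ (by omega), e1]
        · exact (ha''.trans (agree_setNat_stack _ _ (by simp [NatExpr.value]))).trans
            (agree_setNat_stack _ _ le_rfl)
        · rw [setNat_nat_of_ne' _ _ _ (by omega)]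
          simp [NatExpr.value, e2, count_succ, hΦ]
      · refine ⟨_, _, .seq hr (.ite_false (by
          simpa [Test.holds, NatExpr.value] using fun h' => hΦ (hτ'.1 (Nat.pos_of_ne_zero h')))
          (.skip _)), ?_, ha''.size_eq, e1, ha''.trans (agree_setNat_stack _ _ le_rfl), ?_⟩
        · simp [Test.cost, NatExpr.cost]; omega
        · rw [setNat_nat_of_ne' _ _ _ (by omega)]
          simp [e2, count_succ, hΦ])
    (σ.setNat 10 (d + 1) 0) (by rw [size, setNat_nat_of_ne _ _ _ (by norm_num)]; rfl)
    ⟨(agree_setNat_stack _ _ (by omega)).trans (agree_setNat_stack _ _ le_rfl), by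
      rw [setNat_nat_of_ne' _ _ _ (by omega)]; simp [count]⟩
  refine ⟨_, _, .seq (.writeNat _ _ _ _) (.seq hr (.writeNat _ _ _ _)), ?_, ?_, ?_⟩
  · simp [NatExpr.cost]
    have : size σ * (q.eval (size σ) + 10 + 11) = size σ * (q.eval (size σ) + 21) := by ring
    omega
  · exact hI.1.trans (agree_setNat_stack _ _ (by simp [NatExpr.value]))
  · simp [NatExpr.value, hI.2]

/-- A let-binding: the count is kept in cell `d` while `Ψ` is decided in the cells above. -/
theorem Dcd.count {d : ℕ} {Φ : Store → ℕ → Prop} {Ψ : Store → ℕ → Prop}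
    (hs : ∀ v, Stable d fun σ => Φ σ v) (h : Dcd (d + 2) fun σ => Φ σ (σ.nat 10 d))
    (hs' : ∀ v, Stable d fun σ => Ψ σ v) (h' : Dcd (d + 1) fun σ => Ψ σ (σ.nat 10 d)) :
    Dcd d fun σ => Ψ σ (count (size σ) (Φ σ)) := by
  obtain ⟨π, q, hπ⟩ := exists_count hs h
  obtain ⟨-, π', q', hπ'⟩ := h'
  refine ⟨fun σ τ ha => ?_, .seq π π', q + q', fun σ => ?_⟩
  · have e : Φ τ = Φ σ := funext fun v => hs v σ τ ha
    simp only [ha.size_eq, e]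
    exact hs' _ σ τ ha
  · obtain ⟨t, τ, hr, ht, ha, hτ⟩ := hπ σ
    obtain ⟨t', τ', hr', ht', ha', hτ'⟩ := hπ' τ
    rw [ha.size_eq] at ht'
    refine ⟨_, τ', .seq hr hr', ?_, ha.trans (ha'.mono (by omega)), ?_⟩
    · simp; omega
    · dsimp only at hτ' ⊢
      rw [hτ', hτ]; exact iff_of_eq (hs' _ σ τ ha)

theorem Dcd.exists {d : ℕ} {Φ : Store → ℕ → Prop} (hs : ∀ v, Stable d fun σ => Φ σ v)
    (h : Dcd (d + 2) fun σ => Φ σ (σ.nat 10 d)) : Dcd d fun σ => ∃ v < size σ, Φ σ v := by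
  refine (Dcd.count (Ψ := fun _ v => 0 < v) hs h (fun _ _ _ _ => rfl) (.of_isTest ?_ ?_)).congr
    fun σ => count_pos
  · intro σ τ ha
    simp only [ha.stack d (by omega)]
  · exact ⟨.natLT (.const 0) (.read 10 (.const d)), fun σ => Iff.rfl⟩

theorem Dcd.forall {d : ℕ} {Φ : Store → ℕ → Prop} (hs : ∀ v, Stable d fun σ => Φ σ v)
    (h : Dcd (d + 2) fun σ => Φ σ (σ.nat 10 d)) : Dcd d fun σ => ∀ v < size σ, Φ σ v :=
  (Dcd.exists (Φ := fun σ v => ¬ Φ σ v)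
    (fun v σ τ ha => by simp only [hs v σ τ ha]) h.not).not.congr fun σ => by push Not; rfl

/-! ### Programs that change the memory -/

/-- The number of points and the stack remain the same. -/
def Tame (F : Store → Store) : Prop := ∀ σ, size (F σ) = size σ ∧ (F σ).nat 10 = σ.nat 10

/-- The memory can be changed in this way by a program in polynomial time. -/
def Does (d : ℕ) (F : Store → Store) : Prop :=
  (∀ σ τ, Agree d σ τ → Agree d (F σ) (F τ)) ∧ Tame F ∧
    ∃ (π : Program) (q : Polynomial ℕ), ∀ σ, ∃ t τ, Runs π σ t τ ∧
      t ≤ q.eval (size σ) ∧ Agree d (F σ) τ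

theorem Does.comp {d : ℕ} {F G : Store → Store} (hG : Does d G) (hF : Does d F) :
    Does d fun σ => G (F σ) := by
  obtain ⟨sF, nF, π, q, hπ⟩ := hF
  obtain ⟨sG, nG, π', q', hπ'⟩ := hG
  refine ⟨fun σ τ ha => sG _ _ (sF _ _ ha), fun σ =>
    ⟨(nG _).1.trans (nF σ).1, (nG _).2.trans (nF σ).2⟩, .seq π π', q + q',
    fun σ => ?_⟩
  obtain ⟨t, τ, hr, ht, ha⟩ := hπ σ
  obtain ⟨t', τ', hr', ht', ha'⟩ := hπ' τ
  rw [ha.size_eq, (nF σ).1] at ht'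
  exact ⟨_, τ', .seq hr hr', by simp; omega, (sG _ _ ha).trans ha'⟩

theorem Does.ite {d : ℕ} {Φ : Store → Prop} {F : Store → Store} (hΦ : Dcd d Φ) (hF : Does d F) :
    Does d fun σ => if Φ σ then F σ else σ := by
  obtain ⟨sΦ, π, q, hπ⟩ := hΦ
  obtain ⟨sF, nF, π', q', hπ'⟩ := hF
  refine ⟨fun σ τ ha => ?_, fun σ => ?_,
    .seq π (.ite (.natLT (.const 0) (.read 11 (.const 0))) π' .skip), q + q' + .C 5, fun σ => ?_⟩
  · simp only [sΦ σ τ ha]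
    split_ifs
    exacts [sF _ _ ha, ha]
  · dsimp only
    split_ifs
    exacts [nF σ, ⟨rfl, rfl⟩]
  · obtain ⟨t, τ, hr, ht, ha, hτ⟩ := hπ σ
    by_cases h : Φ σ
    · obtain ⟨t', τ', hr', ht', ha'⟩ := hπ' τ
      rw [ha.size_eq] at ht'
      refine ⟨_, τ', .seq hr (.ite_true (by simpa [Test.holds, NatExpr.value] using hτ.2 h) hr'),
        ?_, ?_⟩
      · simp [Test.cost, NatExpr.cost]; omega
      · dsimp only
        rw [if_pos h]; exact (sF _ _ ha).trans ha'
    · refine ⟨_, τ, .seq hr (.ite_false (by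
        simpa [Test.holds, NatExpr.value] using fun h' => h (hτ.1 (Nat.pos_of_ne_zero h')))
        (.skip _)), ?_, ?_⟩
      · simp [Test.cost, NatExpr.cost]; omega
      · dsimp only
        rw [if_neg h]; exact ha

/-- Assignment to a cell of an array of natural numbers. -/
theorem Does.write {d : ℕ} {a : ℕ} (h0 : a ≠ 0) (h10 : a ≠ 10) {f g : Store → ℕ} (hf : Stable d f)
    (hg : Stable d g) (ef : ∃ e : NatExpr, ∀ σ, e.value σ = f σ)
    (eg : ∃ e : NatExpr, ∀ σ, e.value σ = g σ) : Does d fun σ => σ.setNat a (f σ) (g σ) := by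
  obtain ⟨e, he⟩ := ef
  obtain ⟨e', he'⟩ := eg
  refine ⟨fun σ τ ha => ?_, fun σ => ?_, .writeNat a e e', .C (e.cost + e'.cost + 1), fun σ => ?_⟩
  · simp only [hf σ τ ha, hg σ τ ha]; exact ha.setNat _ _ _
  · exact ⟨by rw [size, setNat_nat_of_ne _ _ _ h0.symm]; rfl, setNat_nat_of_ne _ _ _ h10.symm⟩
  · refine ⟨_, _, .writeNat _ _ _ _, by simp, ?_⟩
    rw [he, he']; exact .refl _ _

theorem Does.count {d : ℕ} {Φ : Store → ℕ → Prop} {G : ℕ → Store → Store}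
    (hs : ∀ v, Stable d fun σ => Φ σ v) (h : Dcd (d + 2) fun σ => Φ σ (σ.nat 10 d))
    (hG : ∀ v σ τ, Agree d σ τ → Agree d (G v σ) (G v τ))
    (h' : Does (d + 1) fun σ => G (σ.nat 10 d) σ) (hn : ∀ v, Tame (G v)) :
    Does d fun σ => G (count (size σ) (Φ σ)) σ := by
  obtain ⟨π, q, hπ⟩ := exists_count hs h
  obtain ⟨sG, nG, π', q', hπ'⟩ := h'
  refine ⟨fun σ τ ha => ?_, fun σ => hn _ _, .seq π π', q + q', fun σ => ?_⟩
  · have e : Φ τ = Φ σ := funext fun v => hs v σ τ ha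
    simp only [ha.size_eq, e]
    exact hG _ _ _ ha
  · obtain ⟨t, τ, hr, ht, ha, hτ⟩ := hπ σ
    obtain ⟨t', τ', hr', ht', ha'⟩ := hπ' τ
    rw [ha.size_eq] at ht'
    refine ⟨_, τ', .seq hr hr', by simp; omega, ?_⟩
    dsimp only at ha' ⊢
    rw [hτ] at ha'
    exact (hG _ _ _ ha).trans (ha'.mono (by omega))

/-- The result of performing `G 0`, …, `G (N - 1)`. -/
def iter {α : Type*} (G : ℕ → α → α) : ℕ → α → α
  | 0, s => s
  | N + 1, s => G N (iter G N s)

/-- The invariant is agreement with the ideal memory `iter G v σ` up to scratch cells. Tameness of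
`G` keeps the loop variable intact. -/
theorem Does.loop {d : ℕ} {G : ℕ → Store → Store}
    (hG : ∀ v σ τ, Agree d σ τ → Agree d (G v σ) (G v τ)) (hn : ∀ v, Tame (G v))
    (h : Does (d + 1) fun σ => G (σ.nat 10 d) σ) :
    Does d fun σ => iter G (size σ) σ := by
  obtain ⟨-, -, π, q, hπ⟩ := h
  have htame : ∀ N, Tame (iter G N) := by
    intro N
    induction N with
    | zero => exact fun _ => ⟨rfl, rfl⟩
    | succ N ih => exact fun σ => ⟨(hn _ _).1.trans (ih σ).1, (hn _ _).2.trans (ih σ).2⟩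
  have hag : ∀ N σ τ, Agree d σ τ → Agree d (iter G N σ) (iter G N τ) := by
    intro N
    induction N with
    | zero => exact fun _ _ => id
    | succ N ih => exact fun σ τ ha => hG _ _ _ (ih σ τ ha)
  refine ⟨fun σ τ ha => by dsimp only; rw [ha.size_eq]; exact hag _ _ _ ha, fun σ => htame _ _, forLoop d π,
    .C 8 + .X * (q + .C 11), fun σ => ?_⟩
  obtain ⟨t, τ, hr, ht, hI⟩ := runs_forLoop (d := d) (N := size σ) (B := q.eval (size σ))
    (body := π) (fun v τ => Agree d (iter G v σ) τ) (by
      rintro v τ hv hτ hd ha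
      obtain ⟨t, τ', hr, ht, ha'⟩ := hπ τ
      rw [hτ] at ht
      dsimp only at ha'
      rw [hd] at ha'
      have ha'' : Agree d (iter G (v + 1) σ) τ' := (hG v _ _ ha).trans (ha'.mono (by omega))
      refine ⟨t, τ', hr, ht, by rw [ha''.size_eq, (htame _ _).1], ?_, 
        ha''.trans (agree_setNat_stack _ _ le_rfl)⟩
      rw [ha'.stack d (by omega), (hn _ _).2, hd])
    σ rfl (agree_setNat_stack _ _ le_rfl)
  exact ⟨t, τ, hr, by simpa using ht, hI⟩

open RealRAM

/-! ### Programs for the geometric tests -/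

/-- The value is computed by an expression. -/
def IsNat (f : Store → ℕ) : Prop := ∃ e : NatExpr, ∀ σ, e.value σ = f σ

/-- The value is computed by an expression. -/
def IsReal (f : Store → ℝ) : Prop := ∃ e : RealExpr, ∀ σ, e.value σ = f σ

theorem IsNat.const (k : ℕ) : IsNat fun _ => k := ⟨.const k, fun _ => rfl⟩

theorem IsNat.read {f : Store → ℕ} (h : IsNat f) (a : ℕ) : IsNat fun σ => σ.nat a (f σ) := by
  obtain ⟨e, he⟩ := h
  exact ⟨.read a e, fun σ => by rw [NatExpr.value, he]⟩

theorem IsNat.var (k : ℕ) : IsNat fun σ => σ.nat 10 k := (IsNat.const k).read 10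

theorem IsNat.add {f g : Store → ℕ} (hf : IsNat f) (hg : IsNat g) : IsNat fun σ => f σ + g σ := by
  obtain ⟨e, he⟩ := hf
  obtain ⟨e', he'⟩ := hg
  exact ⟨.add e e', fun σ => by rw [NatExpr.value, he, he']⟩

theorem IsTest.not {Φ : Store → Prop} (h : IsTest Φ) : IsTest fun σ => ¬ Φ σ := by
  obtain ⟨b, hb⟩ := h
  exact ⟨.not b, fun σ => by rw [Test.holds, hb]⟩

theorem IsTest.and {Φ Ψ : Store → Prop} (h : IsTest Φ) (h' : IsTest Ψ) :
    IsTest fun σ => Φ σ ∧ Ψ σ := by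
  obtain ⟨b, hb⟩ := h
  obtain ⟨b', hb'⟩ := h'
  exact ⟨.and b b', fun σ => by rw [Test.holds, hb, hb']⟩

theorem IsTest.congr {Φ Ψ : Store → Prop} (h : IsTest Φ) (e : ∀ σ, Φ σ ↔ Ψ σ) : IsTest Ψ := by
  obtain ⟨b, hb⟩ := h
  exact ⟨b, fun σ => (hb σ).trans (e σ)⟩

theorem IsTest.or {Φ Ψ : Store → Prop} (h : IsTest Φ) (h' : IsTest Ψ) :
    IsTest fun σ => Φ σ ∨ Ψ σ := (h.not.and h'.not).not.congr fun σ => by tauto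

theorem IsNat.lt {f g : Store → ℕ} (hf : IsNat f) (hg : IsNat g) : IsTest fun σ => f σ < g σ := by
  obtain ⟨e, he⟩ := hf
  obtain ⟨e', he'⟩ := hg
  exact ⟨.natLT e e', fun σ => by rw [Test.holds, he, he']⟩

theorem IsNat.le {f g : Store → ℕ} (hf : IsNat f) (hg : IsNat g) : IsTest fun σ => f σ ≤ g σ :=
  (hg.lt hf).not.congr fun _ => not_lt

theorem IsNat.eq {f g : Store → ℕ} (hf : IsNat f) (hg : IsNat g) : IsTest fun σ => f σ = g σ :=
  ((hf.le hg).and (hg.le hf)).congr fun _ => le_antisymm_iff.symm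

theorem IsReal.lt {f g : Store → ℝ} (hf : IsReal f) (hg : IsReal g) :
    IsTest fun σ => f σ < g σ := by
  obtain ⟨e, he⟩ := hf
  obtain ⟨e', he'⟩ := hg
  exact ⟨.realLT e e', fun σ => by rw [Test.holds, he, he']⟩

theorem IsReal.le {f g : Store → ℝ} (hf : IsReal f) (hg : IsReal g) : IsTest fun σ => f σ ≤ g σ :=
  (hg.lt hf).not.congr fun _ => not_lt

theorem IsReal.eq {f g : Store → ℝ} (hf : IsReal f) (hg : IsReal g) : IsTest fun σ => f σ = g σ :=
  ((hf.le hg).and (hg.le hf)).congr fun _ => le_antisymm_iff.symm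

theorem IsReal.zero : IsReal fun _ => 0 := ⟨.const 0, fun σ => by simp [RealExpr.value]⟩

/-- The points in the memory. -/
def point (σ : Store) (i : ℕ) : Plane := !₂[σ.real 0 i, σ.real 1 i]

theorem isReal_cross {f g h : Store → ℕ} (hf : IsNat f) (hg : IsNat g) (hh : IsNat h) :
    IsReal fun σ => cross (point σ (f σ)) (point σ (g σ)) (point σ (h σ)) := by
  obtain ⟨s, hs⟩ := hf
  obtain ⟨z, hz⟩ := hg
  obtain ⟨y, hy⟩ := hh
  refine ⟨.sub (.mul (.sub (.read 0 z) (.read 0 s)) (.sub (.read 1 y) (.read 1 s)))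
    (.mul (.sub (.read 1 z) (.read 1 s)) (.sub (.read 0 y) (.read 0 s))), fun σ => ?_⟩
  simp [RealExpr.value, hs, hz, hy, cross, point]

theorem isReal_dot {f g h : Store → ℕ} (hf : IsNat f) (hg : IsNat g) (hh : IsNat h) :
    IsReal fun σ => dot (point σ (f σ)) (point σ (g σ)) (point σ (h σ)) := by
  obtain ⟨s, hs⟩ := hf
  obtain ⟨z, hz⟩ := hg
  obtain ⟨y, hy⟩ := hh
  refine ⟨.add (.mul (.sub (.read 0 z) (.read 0 s)) (.sub (.read 0 y) (.read 0 s)))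
    (.mul (.sub (.read 1 z) (.read 1 s)) (.sub (.read 1 y) (.read 1 s))), fun σ => ?_⟩
  simp [RealExpr.value, hs, hz, hy, dot, point]

theorem Agree.point_eq {d : ℕ} {σ τ : Store} (h : Agree d σ τ) : point τ = point σ := by
  funext i; rw [point, point, h.real]

theorem Stable.mono {α : Type*} {d e : ℕ} {f : Store → α} (h : Stable d f) (hde : d ≤ e) :
    Stable e f := fun σ τ ha => h σ τ (ha.mono hde)

/-- Membership of the `i`-th point in `alternate`, for the points with the property `M`. -/
def AlternateIndex (N : ℕ) (P : ℕ → Plane) (M : ℕ → Prop) (i : ℕ) : Prop :=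
  M i ∧ ∃ z < N, (M z ∧ z ≠ i) ∧
    ((∀ y < N, M y → 0 ≤ cross (P i) (P z) (P y)) ∨
      ∀ y < N, M y → cross (P i) (P z) (P y) ≤ 0) ∧
    -- Evenness as a bounded search, as the machine has no division.
    ∃ k < N, k + k = count N fun y => M y ∧ cross (P i) (P z) (P y) = 0 ∧ dot (P i) (P z) (P y) < 0

/-- The test for large independent sets, for the points with the property `M`. -/
def BadIndex (N : ℕ) (P : ℕ → Plane) (M : ℕ → Prop) : Prop :=
  (∃ p < N, ∃ q < N, (M p ∧ M q ∧ p ≠ q) ∧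
    2 * count N M + 3 ≤ 3 * count N fun z => M z ∧ cross (P p) (P q) (P z) = 0) ∨
  ((∀ p < N, ∀ q < N, AlternateIndex N P M p ∧ AlternateIndex N P M q ∧ p ≠ q →
    ∃ z < N, M z ∧ cross (P p) (P q) (P z) = 0 ∧ 0 < dot (P p) (P q) (P z) ∧
      0 < dot (P q) (P p) (P z)) ∧
    count N M + 3 ≤ 3 * count N (AlternateIndex N P M))

theorem dcd_mask {d k : ℕ} {M : Store → ℕ → Prop} (hs : Stable d M)
    (hM : ∀ k, IsTest fun σ => M σ (σ.nat 10 k)) (hk : k < d) :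
    Dcd d fun σ => M σ (σ.nat 10 k) :=
  .of_isTest (fun σ τ ha => by simp only [hs σ τ ha, ha.stack k hk]) (hM k)

/-- Each bounded quantifier takes two cells of the stack and each bound count one; this gives the
cell numbers here and in `dcd_badIndex`. -/
theorem dcd_alternateIndex {d k : ℕ} {M : Store → ℕ → Prop} (hs : Stable d M)
    (hM : ∀ k, IsTest fun σ => M σ (σ.nat 10 k)) (hk : k < d) :
    Dcd d fun σ => AlternateIndex (size σ) (point σ) (M σ) (σ.nat 10 k) := by
  have hs2 : Stable (d + 2) M := hs.mono (by omega)
  have hs4 : Stable (d + 4) M := hs.mono (by omega)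
  refine (dcd_mask hs hM hk).and (Dcd.exists (Φ := fun σ z => (M σ z ∧ z ≠ σ.nat 10 k) ∧
    ((∀ y < size σ, M σ y → 0 ≤ cross (point σ (σ.nat 10 k)) (point σ z) (point σ y)) ∨
      ∀ y < size σ, M σ y → cross (point σ (σ.nat 10 k)) (point σ z) (point σ y) ≤ 0) ∧
    ∃ j < size σ, j + j = count (size σ) fun y => M σ y ∧
      cross (point σ (σ.nat 10 k)) (point σ z) (point σ y) = 0 ∧
      dot (point σ (σ.nat 10 k)) (point σ z) (point σ y) < 0) ?_ ?_)
  · intro v σ τ ha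
    simp only [ha.size_eq, ha.point_eq, hs σ τ ha, ha.stack k hk]
  have hcross : IsReal fun σ => cross (point σ (σ.nat 10 k)) (point σ (σ.nat 10 d))
      (point σ (σ.nat 10 (d + 2))) := isReal_cross (.var _) (.var _) (.var _)
  refine ((dcd_mask hs2 hM (by omega)).and (.of_isTest (fun σ τ ha => by
    simp only [ha.stack d (by omega), ha.stack k (by omega)])
    ((IsNat.var d).eq (IsNat.var k)).not)).and (.and (.or ?_ ?_) ?_)
  · refine Dcd.forall (Φ := fun σ y => M σ y → 0 ≤ cross (point σ (σ.nat 10 k))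
      (point σ (σ.nat 10 d)) (point σ y)) ?_ ?_
    · intro v σ τ ha
      simp only [ha.point_eq, hs2 σ τ ha, ha.stack k (by omega), ha.stack d (by omega)]
    · refine (dcd_mask hs4 hM (by omega)).imp (.of_isTest ?_ (IsReal.zero.le hcross))
      intro σ τ ha
      simp only [ha.point_eq, ha.stack k (by omega), ha.stack d (by omega),
        ha.stack (d + 2) (by omega)]
  · refine Dcd.forall (Φ := fun σ y => M σ y → cross (point σ (σ.nat 10 k))
      (point σ (σ.nat 10 d)) (point σ y) ≤ 0) ?_ ?_
    · intro v σ τ ha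
      simp only [ha.point_eq, hs2 σ τ ha, ha.stack k (by omega), ha.stack d (by omega)]
    · refine (dcd_mask hs4 hM (by omega)).imp (.of_isTest ?_ (hcross.le IsReal.zero))
      intro σ τ ha
      simp only [ha.point_eq, ha.stack k (by omega), ha.stack d (by omega),
        ha.stack (d + 2) (by omega)]
  · refine Dcd.count (Ψ := fun σ c => ∃ j < size σ, j + j = c) (Φ := fun σ y => M σ y ∧
      cross (point σ (σ.nat 10 k)) (point σ (σ.nat 10 d)) (point σ y) = 0 ∧
      dot (point σ (σ.nat 10 k)) (point σ (σ.nat 10 d)) (point σ y) < 0) ?_ ?_ ?_ ?_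
    · intro v σ τ ha
      simp only [ha.point_eq, hs2 σ τ ha, ha.stack k (by omega), ha.stack d (by omega)]
    · refine (dcd_mask hs4 hM (by omega)).and (.of_isTest ?_ ((hcross.eq IsReal.zero).and
        ((isReal_dot (.var k) (.var d) (.var (d + 2))).lt IsReal.zero)))
      intro σ τ ha
      simp only [ha.point_eq, ha.stack k (by omega), ha.stack d (by omega),
        ha.stack (d + 2) (by omega)]
    · intro v σ τ ha
      simp only [ha.size_eq]
    · refine Dcd.exists (Φ := fun σ j => j + j = σ.nat 10 (d + 2)) ?_ (.of_isTest ?_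
        (((IsNat.var _).add (.var _)).eq (.var _)))
      · intro v σ τ ha
        simp only [ha.stack (d + 2) (by omega)]
      · intro σ τ ha
        simp only [ha.stack (d + 2) (by omega), ha.stack (d + 2 + 1) (by omega)]

theorem dcd_badIndex {d : ℕ} {M : Store → ℕ → Prop} (hs : Stable d M)
    (hM : ∀ k, IsTest fun σ => M σ (σ.nat 10 k)) :
    Dcd d fun σ => BadIndex (size σ) (point σ) (M σ) := by
  have hs2 : Stable (d + 2) M := hs.mono (by omega)
  have hs3 : Stable (d + 1 + 2) M := hs.mono (by omega)
  have hs4 : Stable (d + 4) M := hs.mono (by omega)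
  have hs5 : Stable (d + 4 + 1 + 2) M := hs.mono (by omega)
  have hs6 : Stable (d + 6) M := hs.mono (by omega)
  refine .or ?_ (.and ?_ ?_)
  · refine Dcd.exists (Φ := fun σ p => ∃ q < size σ, (M σ p ∧ M σ q ∧ p ≠ q) ∧
      2 * count (size σ) (M σ) + 3 ≤ 3 * count (size σ) fun z => M σ z ∧
        cross (point σ p) (point σ q) (point σ z) = 0) ?_ ?_
    · intro v σ τ ha
      simp only [ha.size_eq, ha.point_eq, hs σ τ ha]
    refine Dcd.exists (Φ := fun σ q => (M σ (σ.nat 10 d) ∧ M σ q ∧ σ.nat 10 d ≠ q) ∧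
      2 * count (size σ) (M σ) + 3 ≤ 3 * count (size σ) fun z => M σ z ∧
        cross (point σ (σ.nat 10 d)) (point σ q) (point σ z) = 0) ?_ ?_
    · intro v σ τ ha
      simp only [ha.size_eq, ha.point_eq, hs2 σ τ ha, ha.stack d (by omega)]
    refine ((dcd_mask hs4 hM (by omega)).and ((dcd_mask hs4 hM (by omega)).and (.of_isTest ?_
      ((IsNat.var d).eq (IsNat.var (d + 2))).not))).and ?_
    · intro σ τ ha
      simp only [ha.stack d (by omega), ha.stack (d + 2) (by omega)]
    refine Dcd.count (Φ := fun σ z => M σ z) (Ψ := fun σ c => 2 * c + 3 ≤ 3 * count (size σ)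
      fun z => M σ z ∧ cross (point σ (σ.nat 10 d)) (point σ (σ.nat 10 (d + 2))) (point σ z) = 0)
      ?_ (dcd_mask (hs.mono (by omega)) hM (by omega)) ?_ ?_
    · intro v σ τ ha
      simp only [hs4 σ τ ha]
    · intro v σ τ ha
      simp only [ha.size_eq, ha.point_eq, hs4 σ τ ha, ha.stack d (by omega),
        ha.stack (d + 2) (by omega)]
    refine Dcd.count (Φ := fun σ z => M σ z ∧ cross (point σ (σ.nat 10 d))
      (point σ (σ.nat 10 (d + 2))) (point σ z) = 0)
      (Ψ := fun σ c => 2 * σ.nat 10 (d + 2 + 2) + 3 ≤ 3 * c) ?_ ?_ ?_ ?_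
    · intro v σ τ ha
      simp only [ha.point_eq, hs.mono (show d ≤ d + 2 + 2 + 1 by omega) σ τ ha,
        ha.stack d (by omega), ha.stack (d + 2) (by omega)]
    · refine (dcd_mask hs5 hM (by omega)).and (.of_isTest ?_
        ((isReal_cross (.var d) (.var (d + 2)) (.var (d + 2 + 2 + 1))).eq IsReal.zero))
      intro σ τ ha
      simp only [ha.point_eq, ha.stack d (by omega), ha.stack (d + 2) (by omega),
        ha.stack (d + 2 + 2 + 1) (by omega)]
    · intro v σ τ ha
      simp only [ha.stack (d + 2 + 2) (by omega)]
    · refine .of_isTest ?_ (((((IsNat.var (d + 2 + 2)).add (.var (d + 2 + 2))).add (.const 3)).le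
        (((IsNat.var (d + 2 + 2 + 1)).add (.var (d + 2 + 2 + 1))).add
          (.var (d + 2 + 2 + 1)))).congr fun σ => by
            simp only [show d + 4 + 1 = d + 2 + 2 + 1 from rfl]; omega)
      intro σ τ ha
      simp only [ha.stack (d + 2 + 2) (by omega), ha.stack (d + 2 + 2 + 1) (by omega)]
  · refine Dcd.forall (Φ := fun σ p => ∀ q < size σ, AlternateIndex (size σ) (point σ) (M σ) p ∧
      AlternateIndex (size σ) (point σ) (M σ) q ∧ p ≠ q → ∃ z < size σ, M σ z ∧
        cross (point σ p) (point σ q) (point σ z) = 0 ∧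
        0 < dot (point σ p) (point σ q) (point σ z) ∧
        0 < dot (point σ q) (point σ p) (point σ z)) ?_ ?_
    · intro v σ τ ha
      simp only [ha.size_eq, ha.point_eq, hs σ τ ha]
    refine Dcd.forall (Φ := fun σ q => AlternateIndex (size σ) (point σ) (M σ) (σ.nat 10 d) ∧
      AlternateIndex (size σ) (point σ) (M σ) q ∧ σ.nat 10 d ≠ q → ∃ z < size σ, M σ z ∧
        cross (point σ (σ.nat 10 d)) (point σ q) (point σ z) = 0 ∧
        0 < dot (point σ (σ.nat 10 d)) (point σ q) (point σ z) ∧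
        0 < dot (point σ q) (point σ (σ.nat 10 d)) (point σ z)) ?_ ?_
    · intro v σ τ ha
      simp only [ha.size_eq, ha.point_eq, hs2 σ τ ha, ha.stack d (by omega)]
    refine ((dcd_alternateIndex hs4 hM (by omega)).and ((dcd_alternateIndex hs4 hM
      (by omega)).and (.of_isTest ?_ ((IsNat.var d).eq (IsNat.var (d + 2))).not))).imp ?_
    · intro σ τ ha
      simp only [ha.stack d (by omega), ha.stack (d + 2) (by omega)]
    refine Dcd.exists (Φ := fun σ z => M σ z ∧
        cross (point σ (σ.nat 10 d)) (point σ (σ.nat 10 (d + 2))) (point σ z) = 0 ∧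
        0 < dot (point σ (σ.nat 10 d)) (point σ (σ.nat 10 (d + 2))) (point σ z) ∧
        0 < dot (point σ (σ.nat 10 (d + 2))) (point σ (σ.nat 10 d)) (point σ z)) ?_ ?_
    · intro v σ τ ha
      simp only [ha.point_eq, hs4 σ τ ha, ha.stack d (by omega), ha.stack (d + 2) (by omega)]
    refine (dcd_mask hs6 hM (by omega)).and (.of_isTest ?_
      (((isReal_cross (.var d) (.var (d + 2)) (.var (d + 2 + 2))).eq IsReal.zero).and
      ((IsReal.zero.lt (isReal_dot (.var d) (.var (d + 2)) (.var (d + 2 + 2)))).and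
        (IsReal.zero.lt (isReal_dot (.var (d + 2)) (.var d) (.var (d + 2 + 2)))))))
    intro σ τ ha
    simp only [ha.point_eq, ha.stack d (by omega), ha.stack (d + 2) (by omega),
        ha.stack (d + 2 + 2) (by omega)]
  · refine Dcd.count (Φ := fun σ z => M σ z) (Ψ := fun σ c => c + 3 ≤ 3 * count (size σ)
      fun z => AlternateIndex (size σ) (point σ) (M σ) z)
      ?_ (dcd_mask (hs.mono (by omega)) hM (by omega)) ?_ ?_
    · intro v σ τ ha
      simp only [hs σ τ ha]
    · intro v σ τ ha
      simp only [ha.size_eq, ha.point_eq, hs σ τ ha]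
    refine Dcd.count (Φ := fun σ z => AlternateIndex (size σ) (point σ) (M σ) z)
      (Ψ := fun σ c => σ.nat 10 d + 3 ≤ 3 * c) ?_ (dcd_alternateIndex hs3 hM (by omega)) ?_ ?_
    · intro v σ τ ha
      simp only [ha.size_eq, ha.point_eq, hs.mono (show d ≤ d + 1 by omega) σ τ ha]
    · intro v σ τ ha
      simp only [ha.stack d (by omega)]
    · refine .of_isTest ?_ (((IsNat.var d).add (.const 3)).le (((IsNat.var (d + 1)).add
        (.var (d + 1))).add (.var (d + 1))) |>.congr fun σ => by omega)
      intro σ τ ha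
      simp only [ha.stack d (by omega), ha.stack (d + 1) (by omega)]

open RealRAM

/-! ### The program -/

/-- Points with labels `0`, …, `top`. -/
structure Labelling where
  size : ℕ
  pts : ℕ → Plane
  lab : ℕ → ℕ
  top : ℕ

/-- The labels are stored in the natural-number array `3`. -/
def labelling (σ : Store) : Labelling := ⟨size σ, point σ, σ.nat 3, σ.nat 4 0⟩

namespace Labelling

/-- The points with label `c` on one side of the line through two points. -/
def Left (s : Labelling) (c p q i : ℕ) : Prop := s.lab i = c ∧ Side (s.pts p) (s.pts q) (s.pts i)

/-- The points with label `c` on the other side of the line through two points. -/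
def Right (s : Labelling) (c p q i : ℕ) : Prop :=
  s.lab i = c ∧ ¬ Side (s.pts p) (s.pts q) (s.pts i)

/-- A line through two of the points with label `c` cuts them into two sets with triangle
partitions. -/
def CanCut (s : Labelling) (c p q : ℕ) : Prop :=
  (s.lab p = c ∧ s.lab q = c ∧ p ≠ q) ∧ (∃ k < s.size, k + k + k = count s.size (s.Left c p q)) ∧
    ¬ BadIndex s.size s.pts (s.Left c p q) ∧ ¬ BadIndex s.size s.pts (s.Right c p q)

/-- Give the points on one side of a line a new label, if possible. -/
noncomputable def cut (c p q : ℕ) (s : Labelling) : Labelling :=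
  if s.CanCut c p q then
    { s with lab := fun i => if i < s.size ∧ s.Right c p q i then s.top + 1 else s.lab i
             top := s.top + 1 }
  else s

/-- All cuts. -/
noncomputable def round (s : Labelling) : Labelling :=
  iter (fun c s => iter (fun p s => iter (fun q s => cut c p q s) s.size s) s.size s) s.size s

end Labelling

theorem Agree.labelling_eq {d : ℕ} {σ τ : Store} (h : Agree d σ τ) :
    labelling τ = labelling σ := by
  rw [labelling, labelling, h.size_eq, h.point_eq, h.nat 3 (by norm_num) (by norm_num),
    h.nat 4 (by norm_num) (by norm_num)]

/-- Changes of the memory which ignore the stack. -/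
def Nice (F : Store → Store) : Prop :=
  Tame F ∧ ∀ d σ τ, Agree d σ τ → Agree d (F σ) (F τ)

theorem Nice.iter {G : ℕ → Store → Store} (h : ∀ v, Nice (G v)) (N : ℕ) :
    Nice (iter G N) := by
  induction N with
  | zero => exact ⟨fun _ => ⟨rfl, rfl⟩, fun _ _ _ => id⟩
  | succ N ih =>
    exact ⟨fun σ => ⟨((h N).1 _).1.trans (ih.1 σ).1, ((h N).1 _).2.trans (ih.1 σ).2⟩,
      fun d σ τ ha => (h N).2 d _ _ (ih.2 d σ τ ha)⟩

theorem Nice.iter_size {G : ℕ → Store → Store} (h : ∀ v, Nice (G v)) :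
    Nice fun σ => TrianglePartition.iter G (size σ) σ :=
  ⟨fun σ => (Nice.iter h _).1 σ, fun d σ τ ha => by
    dsimp only; rw [ha.size_eq]; exact (Nice.iter h _).2 d σ τ ha⟩

theorem Does.congr {d : ℕ} {F G : Store → Store} (h : Does d F) (e : ∀ σ, F σ = G σ) :
    Does d G := by
  rwa [← funext e]

/-- A loop body reads its parameters from the stack. Tame changes preserve the stack, so the
parameters can be frozen at their initial values. -/
theorem iter_stack {G : (ℕ → ℕ) → ℕ → Store → Store} (hG : ∀ ρ v, Nice (G ρ v)) (N : ℕ)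
    (σ : Store) : iter (fun v τ => G (τ.nat 10) v τ) N σ = iter (G (σ.nat 10)) N σ := by
  induction N with
  | zero => rfl
  | succ N ih => rw [iter, iter, ih, ((Nice.iter (hG _) N).1 σ).2]

theorem Does.loop_stack {d : ℕ} {G : (ℕ → ℕ) → ℕ → Store → Store} (hG : ∀ ρ v, Nice (G ρ v))
    (hρ : ∀ ρ ρ' : ℕ → ℕ, (∀ k < d, ρ' k = ρ k) → G ρ' = G ρ)
    (h : Does (d + 1) fun σ => G (σ.nat 10) (σ.nat 10 d) σ) :
    Does d fun σ => iter (G (σ.nat 10)) (size σ) σ := by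
  refine (Does.loop (G := fun v τ => G (τ.nat 10) v τ) ?_ ?_ h).congr fun σ => iter_stack hG _ σ
  · intro v σ τ ha
    rw [hρ (σ.nat 10) (τ.nat 10) ha.stack]
    exact (hG _ v).2 d σ τ ha
  · exact fun v σ => (hG _ v).1 σ

theorem Nice.ite {Φ : Store → Prop} {F : Store → Store} (hΦ : Stable 0 Φ) (hF : Nice F) :
    Nice fun σ => if Φ σ then F σ else σ := by
  refine ⟨fun σ => ?_, fun d σ τ ha => ?_⟩
  · dsimp only
    split_ifs
    exacts [hF.1 σ, ⟨rfl, rfl⟩]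
  · simp only [hΦ σ τ (ha.mono (by omega))]
    split_ifs
    exacts [hF.2 d _ _ ha, ha]

theorem Nice.write {a : ℕ} (h0 : a ≠ 0) (h10 : a ≠ 10) {f g : Store → ℕ} (hf : Stable 0 f)
    (hg : Stable 0 g) : Nice fun σ => σ.setNat a (f σ) (g σ) := by
  refine ⟨fun σ => ⟨?_, setNat_nat_of_ne _ _ _ h10.symm⟩, fun d σ τ ha => ?_⟩
  · rw [size, setNat_nat_of_ne _ _ _ h0.symm]; rfl
  · simp only [hf σ τ (ha.mono (by omega)), hg σ τ (ha.mono (by omega))]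
    exact ha.setNat _ _ _

theorem Nice.comp {F G : Store → Store} (hG : Nice G) (hF : Nice F) : Nice fun σ => G (F σ) :=
  ⟨fun σ => ⟨(hG.1 _).1.trans (hF.1 σ).1, (hG.1 _).2.trans (hF.1 σ).2⟩,
    fun d σ τ ha => hG.2 d _ _ (hF.2 d σ τ ha)⟩

/-- Give the `i`-th point the new label, if it is on the other side of the line. -/
noncomputable def relabelPoint (c p q i : ℕ) (σ : Store) : Store :=
  if (labelling σ).Right c p q i then σ.setNat 3 i (σ.nat 4 0) else σ

/-- Make a new label, and give it to the points on the other side of the line. -/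
noncomputable def relabel (c p q : ℕ) (σ : Store) : Store :=
  iter (relabelPoint c p q) (size σ) σ

/-- Cut the set of the points with label `c`, if possible. -/
noncomputable def cutStore (c p q : ℕ) (σ : Store) : Store :=
  if (labelling σ).CanCut c p q then relabel c p q (σ.setNat 4 0 (σ.nat 4 0 + 1)) else σ

theorem nice_relabelPoint (c p q i : ℕ) : Nice (relabelPoint c p q i) := by
  refine .ite (fun σ τ ha => ?_) (.write (by norm_num) (by norm_num) (fun σ τ ha => rfl)
    fun σ τ ha => ?_)
  · simp only [ha.labelling_eq]
  · simp only [ha.nat 4 (by norm_num) (by norm_num)]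

theorem nice_cutStore (c p q : ℕ) : Nice (cutStore c p q) := by
  refine .ite (fun σ τ ha => ?_) (.comp (.iter_size (nice_relabelPoint c p q))
    (.write (by norm_num) (by norm_num) (fun σ τ ha => rfl) fun σ τ ha => ?_))
  · simp only [ha.labelling_eq]
  · simp only [ha.nat 4 (by norm_num) (by norm_num)]

theorem isTest_side {p q i : Store → ℕ} (hp : IsNat p) (hq : IsNat q) (hi : IsNat i) :
    IsTest fun σ => Side (point σ (p σ)) (point σ (q σ)) (point σ (i σ)) :=
  (IsReal.zero.lt (isReal_cross hp hq hi)).or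
    (((isReal_cross hp hq hi).eq IsReal.zero).and ((isReal_dot hp hq hi).le IsReal.zero))

theorem isTest_left (c p q k : ℕ) : IsTest fun σ =>
    (labelling σ).Left (σ.nat 10 c) (σ.nat 10 p) (σ.nat 10 q) (σ.nat 10 k) :=
  (((IsNat.var k).read 3).eq (.var c)).and (isTest_side (.var p) (.var q) (.var k))

theorem isTest_right (c p q k : ℕ) : IsTest fun σ =>
    (labelling σ).Right (σ.nat 10 c) (σ.nat 10 p) (σ.nat 10 q) (σ.nat 10 k) :=
  (((IsNat.var k).read 3).eq (.var c)).and (isTest_side (.var p) (.var q) (.var k)).not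

/-- Cells `1`, `2`, `3` hold the label and the two points of the cut; cell `0` counts the rounds. -/
theorem dcd_canCut : Dcd 4 fun σ => (labelling σ).CanCut (σ.nat 10 1) (σ.nat 10 2) (σ.nat 10 3) := by
  have hL : Stable 4 fun σ => (labelling σ).Left (σ.nat 10 1) (σ.nat 10 2) (σ.nat 10 3) :=
    fun σ τ ha => by simp only [ha.labelling_eq, ha.stack 1 (by omega), ha.stack 2 (by omega),
      ha.stack 3 (by omega)]
  have hR : Stable 4 fun σ => (labelling σ).Right (σ.nat 10 1) (σ.nat 10 2) (σ.nat 10 3) :=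
    fun σ τ ha => by simp only [ha.labelling_eq, ha.stack 1 (by omega), ha.stack 2 (by omega),
      ha.stack 3 (by omega)]
  refine .and (.of_isTest ?_ ((((IsNat.var 2).read 3).eq (.var 1)).and
    ((((IsNat.var 3).read 3).eq (.var 1)).and ((IsNat.var 2).eq (.var 3)).not))) (.and ?_
    (.and (dcd_badIndex hL (isTest_left 1 2 3)).not (dcd_badIndex hR (isTest_right 1 2 3)).not))
  · intro σ τ ha
    simp only [ha.labelling_eq, ha.stack 1 (by omega), ha.stack 2 (by omega),
      ha.stack 3 (by omega)]
  · refine Dcd.count (Φ := fun σ i =>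
      (labelling σ).Left (σ.nat 10 1) (σ.nat 10 2) (σ.nat 10 3) i)
      (Ψ := fun σ m => ∃ k < size σ, k + k + k = m) ?_
      (dcd_mask (hL.mono (by omega)) (isTest_left 1 2 3) (by omega)) ?_ ?_
    · intro v σ τ ha
      simp only [hL σ τ ha]
    · intro v σ τ ha
      simp only [ha.size_eq]
    · refine Dcd.exists (Φ := fun σ k => k + k + k = σ.nat 10 4) ?_ (.of_isTest ?_
        ((((IsNat.var 5).add (.var 5)).add (.var 5)).eq (.var 4)))
      · intro v σ τ ha
        simp only [ha.stack 4 (by omega)]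
      · intro σ τ ha
        simp only [ha.stack 4 (by omega), ha.stack 5 (by omega)]

theorem does_cutStore : Does 4 fun σ => cutStore (σ.nat 10 1) (σ.nat 10 2) (σ.nat 10 3) σ := by
  have hpt : Does 5 fun σ => relabelPoint (σ.nat 10 1) (σ.nat 10 2) (σ.nat 10 3) (σ.nat 10 4) σ := by
    refine .ite (.of_isTest ?_ (isTest_right 1 2 3 4)) (.write (by norm_num) (by norm_num) ?_ ?_
      (IsNat.var 4) ((IsNat.const 0).read 4))
    · intro σ τ ha
      simp only [ha.labelling_eq, ha.stack 1 (by omega), ha.stack 2 (by omega),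
        ha.stack 3 (by omega), ha.stack 4 (by omega)]
    · intro σ τ ha
      simp only [ha.stack 4 (by omega)]
    · intro σ τ ha
      simp only [ha.nat 4 (by norm_num) (by norm_num)]
  have hrel : Does 4 fun σ => relabel (σ.nat 10 1) (σ.nat 10 2) (σ.nat 10 3) σ := by
    refine Does.loop_stack (G := fun ρ => relabelPoint (ρ 1) (ρ 2) (ρ 3))
      (fun ρ v => nice_relabelPoint _ _ _ _) ?_ hpt
    intro ρ ρ' h
    simp only [h 1 (by omega), h 2 (by omega), h 3 (by omega)]
  refine .ite dcd_canCut ((hrel.comp (.write (a := 4) (by norm_num) (by norm_num)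
    (f := fun _ => 0) (g := fun σ => σ.nat 4 0 + 1) (fun _ _ _ => rfl) ?_ (IsNat.const 0)
    (((IsNat.const 0).read 4).add (.const 1)))).congr fun σ => ?_)
  · intro σ τ ha
    simp only [ha.nat 4 (by norm_num) (by norm_num)]
  · simp only [setNat_nat_of_ne _ _ _ (show 10 ≠ 4 by norm_num)]

/-- All cuts. -/
noncomputable def roundStore (σ : Store) : Store :=
  iter (fun c σ => iter (fun p σ => iter (fun q σ => cutStore c p q σ) (size σ) σ) (size σ) σ)
    (size σ) σ

theorem nice_roundStore : Nice roundStore :=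
  .iter_size fun c => .iter_size fun p => .iter_size fun q => nice_cutStore c p q

theorem does_roundStore : Does 1 roundStore := by
  have h3 : Does 3 fun σ => iter (cutStore (σ.nat 10 1) (σ.nat 10 2)) (size σ) σ := by
    refine Does.loop_stack (G := fun ρ q => cutStore (ρ 1) (ρ 2) q)
      (fun ρ v => nice_cutStore _ _ _) ?_ does_cutStore
    intro ρ ρ' h
    simp only [h 1 (by omega), h 2 (by omega)]
  have h2 : Does 2 fun σ => iter (fun p τ => iter (cutStore (σ.nat 10 1) p) (size τ) τ)
      (size σ) σ := by
    refine Does.loop_stack (G := fun ρ p τ => iter (cutStore (ρ 1) p) (size τ) τ)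
      (fun ρ p => .iter_size fun q => nice_cutStore _ _ _) ?_ h3
    intro ρ ρ' h
    simp only [h 1 (by omega)]
  exact Does.loop_stack (G := fun ρ c σ => iter (fun p τ => iter (cutStore c p) (size τ) τ)
    (size σ) σ) (fun ρ c => .iter_size fun p => .iter_size fun q => nice_cutStore _ _ _)
    (fun _ _ _ => rfl) h2

/-- Store `1` in cell `0` of the array `1`, if there is a triangle partition. -/
noncomputable def flagStore (σ : Store) : Store :=
  if ¬ BadIndex (size σ) (point σ) (fun _ => True) then σ.setNat 1 0 1 else σ

theorem does_flagStore : Does 0 flagStore := by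
  have ht : Stable 0 fun (_ : Store) (_ : ℕ) => True := fun _ _ _ => rfl
  refine (Does.ite (dcd_badIndex ht fun k => ?_).not (.write (a := 1) (by norm_num) (by norm_num)
    (fun _ _ _ => rfl) (fun _ _ _ => rfl) (IsNat.const 0) (IsNat.const 1))).congr
    fun σ => by rw [flagStore]; split_ifs <;> rfl
  exact ((IsNat.const 0).lt (.const 1)).congr (by simp)

/-- The order by labels. -/
def Before (lab : ℕ → ℕ) (i j : ℕ) : Prop := lab j < lab i ∨ lab j = lab i ∧ j < i

/-- Sort the points by their labels. -/
noncomputable def outStore (σ : Store) : Store :=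
  iter (fun i τ => τ.setNat 2 (count (size τ) (Before (τ.nat 3) i)) i) (size σ) σ

theorem does_outStore : Does 0 outStore := by
  have hN : ∀ i : ℕ, Nice fun τ => τ.setNat 2 (count (size τ) (Before (τ.nat 3) i)) i := fun i =>
    .write (by norm_num) (by norm_num) (fun σ τ ha => by
      simp only [ha.size_eq, ha.nat 3 (by norm_num) (by norm_num)]) fun _ _ _ => rfl
  refine Does.loop_stack (G := fun _ i τ => τ.setNat 2 (count (size τ) (Before (τ.nat 3) i)) i)
    (fun _ => hN) (fun _ _ _ => rfl) ?_
  refine Does.count (Φ := fun σ j => Before (σ.nat 3) (σ.nat 10 0) j)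
    (G := fun c σ => σ.setNat 2 c (σ.nat 10 0)) ?_ (.of_isTest ?_ ?_) ?_ ?_ ?_
  · intro v σ τ ha
    simp only [ha.nat 3 (by norm_num) (by norm_num), ha.stack 0 (by omega)]
  · intro σ τ ha
    simp only [ha.nat 3 (by norm_num) (by norm_num), ha.stack 0 (by omega),
      ha.stack 1 (by omega)]
  · exact (((IsNat.var 1).read 3).lt ((IsNat.var 0).read 3)).or
      ((((IsNat.var 1).read 3).eq ((IsNat.var 0).read 3)).and ((IsNat.var 1).lt (.var 0)))
  · intro v σ τ ha
    rw [ha.stack 0 (by omega)]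
    exact ha.setNat _ _ _
  · refine .write (by norm_num) (by norm_num) ?_ ?_ (IsNat.var 1) (IsNat.var 0)
    · intro σ τ ha
      simp only [ha.stack 1 (by omega)]
    · intro σ τ ha
      simp only [ha.stack 0 (by omega)]
  · exact fun v σ => ⟨by rw [size, setNat_nat_of_ne _ _ _ (by norm_num)]; rfl,
      setNat_nat_of_ne _ _ _ (by norm_num)⟩

/-- The effect of the program. -/
noncomputable def partitionStore (σ : Store) : Store :=
  outStore (flagStore (iter (fun _ τ => roundStore τ) (size σ) σ))

theorem does_partitionStore : Does 0 partitionStore :=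
  does_outStore.comp (does_flagStore.comp (Does.loop_stack (G := fun _ _ => roundStore)
    (fun _ _ => nice_roundStore) (fun _ _ _ => rfl) does_roundStore))

/-! ### The effect of the program on the labels -/

theorem iter_map {α β : Type*} (f : α → β) {G : ℕ → α → α} {H : ℕ → β → β}
    (h : ∀ v s, f (G v s) = H v (f s)) (N : ℕ) (s : α) : f (iter G N s) = iter H N (f s) := by
  induction N with
  | zero => rfl
  | succ N ih => rw [iter, iter, h, ih]

/-- The test for a point reads no label but its own, so earlier relabellings do not disturb it. -/
theorem labelling_relabel (c p q : ℕ) (σ : Store) : labelling (relabel c p q σ) =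
    { labelling σ with lab := fun i => if i < size σ ∧ (labelling σ).Right c p q i then σ.nat 4 0
                                       else σ.nat 3 i } := by
  have key : ∀ N, size (iter (relabelPoint c p q) N σ) = size σ ∧
      (iter (relabelPoint c p q) N σ).real = σ.real ∧
      (iter (relabelPoint c p q) N σ).nat 4 0 = σ.nat 4 0 ∧
      (iter (relabelPoint c p q) N σ).nat 3 =
        fun i => if i < N ∧ (labelling σ).Right c p q i then σ.nat 4 0 else σ.nat 3 i := by
    intro N
    induction N with
    | zero => simp [iter]
    | succ N ih =>
      obtain ⟨h1, h2, h3, h4⟩ := ih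
      rw [iter]
      set τ := iter (relabelPoint c p q) N σ
      have hp : point τ = point σ := by funext i; rw [point, point, h2]
      have hR : (labelling τ).Right c p q N ↔ (labelling σ).Right c p q N := by
        simp [Labelling.Right, labelling, hp, h4]
      rw [relabelPoint]
      by_cases hN : (labelling σ).Right c p q N
      · rw [if_pos (hR.2 hN)]
        refine ⟨by rw [size, setNat_nat_of_ne _ _ _ (by norm_num)]; exact h1, h2,
          by rw [setNat_nat_of_ne _ _ _ (by norm_num)]; exact h3, ?_⟩
        funext i
        by_cases e : i = N
        · subst e; simp [h3, hN]
        · rw [setNat_nat_of_ne' _ _ _ e, h4]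
          have : i < N + 1 ↔ i < N := by omega
          simp [this]
      · rw [if_neg (fun h => hN (hR.1 h))]
        refine ⟨h1, h2, h3, ?_⟩
        rw [h4]
        funext i
        by_cases e : i = N
        · subst e; simp [hN]
        · have : i < N + 1 ↔ i < N := by omega
          simp [this]
  obtain ⟨h1, h2, h3, h4⟩ := key (size σ)
  have hp : point (relabel c p q σ) = point σ := by funext i; rw [point, point, relabel, h2]
  rw [labelling, hp, relabel, h1, h3, h4]
  rfl

theorem labelling_cutStore (c p q : ℕ) (σ : Store) :
    labelling (cutStore c p q σ) = (labelling σ).cut c p q := by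
  rw [cutStore, Labelling.cut]
  split_ifs
  · rw [labelling_relabel]
    have h1 : size (σ.setNat 4 0 (σ.nat 4 0 + 1)) = size σ := by
      rw [size, setNat_nat_of_ne _ _ _ (by norm_num)]; rfl
    have h2 : (σ.setNat 4 0 (σ.nat 4 0 + 1)).nat 3 = σ.nat 3 := setNat_nat_of_ne _ _ _ (by norm_num)
    have h3 : labelling (σ.setNat 4 0 (σ.nat 4 0 + 1)) =
        { labelling σ with top := σ.nat 4 0 + 1 } := by
      rw [labelling, h1, h2, setNat_nat_self]; rfl
    rw [h3, h1, h2, setNat_nat_self]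
    rfl
  · rfl

theorem labelling_roundStore (σ : Store) : labelling (roundStore σ) = (labelling σ).round := by
  refine iter_map labelling (fun c τ => ?_) _ _
  refine iter_map labelling (fun p τ => ?_) _ _
  exact iter_map labelling (fun q τ => labelling_cutStore c p q τ) _ _

open RealRAM

/-! ### Sets of points given by indices -/

/-- The points `P i` with `i < N` and the property `M`. -/
noncomputable def points (N : ℕ) (P : ℕ → Plane) (M : ℕ → Prop) : Finset Plane :=
  ((Finset.range N).filter M).image P

section

variable {N : ℕ} {P : ℕ → Plane} {M : ℕ → Prop}

theorem mem_points {x : Plane} : x ∈ points N P M ↔ ∃ i < N, M i ∧ P i = x := by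
  simp [points, and_assoc]

theorem apply_mem_points (hP : Set.InjOn P (Set.Iio N)) {i : ℕ} (hi : i < N) :
    P i ∈ points N P M ↔ M i := by
  rw [mem_points]
  constructor
  · rintro ⟨j, hj, hM, e⟩
    rwa [← hP hj hi e]
  · exact fun hM => ⟨i, hi, hM, rfl⟩

theorem card_points (hP : Set.InjOn P (Set.Iio N)) : (points N P M).card = count N M := by
  rw [points, Finset.card_image_of_injOn, count]
  exact hP.mono fun i hi => by simpa using (Finset.mem_filter.1 hi).1

theorem filter_points (Q : Plane → Prop) [DecidablePred Q] :
    {x ∈ points N P M | Q x} = points N P fun i => M i ∧ Q (P i) := by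
  ext x
  simp only [Finset.mem_filter, mem_points]
  constructor
  · rintro ⟨⟨i, hi, hM, rfl⟩, hQ⟩
    exact ⟨i, hi, ⟨hM, hQ⟩, rfl⟩
  · rintro ⟨i, hi, ⟨hM, hQ⟩, rfl⟩
    exact ⟨⟨i, hi, hM, rfl⟩, hQ⟩

theorem exists_points {Q : Plane → Prop} :
    (∃ x ∈ points N P M, Q x) ↔ ∃ i < N, M i ∧ Q (P i) := by
  simp only [mem_points]
  constructor
  · rintro ⟨x, ⟨i, hi, hM, rfl⟩, hQ⟩
    exact ⟨i, hi, hM, hQ⟩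
  · rintro ⟨i, hi, hM, hQ⟩
    exact ⟨_, ⟨i, hi, hM, rfl⟩, hQ⟩

theorem forall_points {Q : Plane → Prop} :
    (∀ x ∈ points N P M, Q x) ↔ ∀ i < N, M i → Q (P i) := by
  simp only [mem_points]
  constructor
  · exact fun h i hi hM => h _ ⟨i, hi, hM, rfl⟩
  · rintro h x ⟨i, hi, hM, rfl⟩
    exact h i hi hM

theorem count_le (N : ℕ) (M : ℕ → Prop) : count N M ≤ N :=
  (Finset.card_filter_le _ _).trans (by simp)

theorem alternateIndex_iff (hP : Set.InjOn P (Set.Iio N)) {i : ℕ} (hi : i < N) :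
    AlternateIndex N P M i ↔ P i ∈ alternate (points N P M) := by
  rw [alternate, Finset.mem_filter, apply_mem_points hP hi, exists_points, AlternateIndex]
  refine and_congr_right fun _ => exists_congr fun z => ?_
  rw [forall_points, forall_points, filter_points, card_points hP]
  -- The bound `k < N` is no restriction, since `N` is positive.
  have hk : ∀ m ≤ N, (∃ k < N, k + k = m) ↔ Even m := fun m hm => by
    constructor
    · rintro ⟨k, -, rfl⟩
      exact ⟨k, rfl⟩
    · rintro ⟨k, rfl⟩
      exact ⟨k, by omega, rfl⟩
  rw [hk _ (count_le _ _)]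
  constructor
  · rintro ⟨hz, ⟨hM, hne⟩, h⟩
    exact ⟨hz, hM, fun e => hne (hP hz hi e), h⟩
  · rintro ⟨hz, hM, hne, h⟩
    exact ⟨hz, ⟨hM, fun e => hne (e ▸ rfl)⟩, h⟩

theorem alternate_points (hP : Set.InjOn P (Set.Iio N)) :
    alternate (points N P M) = points N P (AlternateIndex N P M) := by
  ext x
  rw [mem_points]
  constructor
  · intro hx
    obtain ⟨i, hi, hM, rfl⟩ := mem_points.1 (Finset.mem_filter.1 hx).1
    exact ⟨i, hi, (alternateIndex_iff hP hi).2 hx, rfl⟩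
  · rintro ⟨i, hi, hA, rfl⟩
    exact (alternateIndex_iff hP hi).1 hA

/-- Divisibility by three enters through `badTest_iff`; this is why a cut has to check the size of
one side. -/
theorem badIndex_iff (hP : Set.InjOn P (Set.Iio N)) {m : ℕ} (hm : count N M = 3 * m) :
    BadIndex N P M ↔ Bad (points N P M) := by
  rw [← badTest_iff ((card_points hP).trans hm), BadTest, alternate_points hP, card_points hP,
    card_points hP, BadIndex]
  refine or_congr ?_ (and_congr_left fun _ => ?_)
  · rw [exists_points]
    constructor
    · rintro ⟨p, hp, q, hq, ⟨hMp, hMq, hne⟩, h⟩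
      refine ⟨p, hp, hMp, exists_points.2 ⟨q, hq, hMq, fun e => hne (hP hp hq e), ?_⟩⟩
      rwa [filter_points, card_points hP]
    · rintro ⟨p, hp, hMp, h⟩
      obtain ⟨q, hq, hMq, hne, h⟩ := exists_points.1 h
      rw [filter_points, card_points hP] at h
      exact ⟨p, hp, q, hq, ⟨hMp, hMq, fun e => hne (e ▸ rfl)⟩, h⟩
  · rw [forall_points]
    constructor
    · intro h p hp hAp
      rw [forall_points]
      intro q hq hAq hne
      exact exists_points.2 (h p hp q hq ⟨hAp, hAq, fun e => hne (e ▸ rfl)⟩)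
    · rintro h p hp q hq ⟨hAp, hAq, hne⟩
      exact exists_points.1 (forall_points.1 (h p hp hAp) q hq hAq fun e => hne (hP hp hq e))

end

/-! ### Iteration with progress -/

/-- Every change raises `μ`, so changes cannot cancel: a pass that ends where it began has changed
nothing at any step. -/
theorem iter_progress {α : Type*} {G : ℕ → α → α} {N : ℕ} {I : α → Prop} {μ : α → ℕ}
    (h : ∀ v < N, ∀ s, I s → I (G v s) ∧ (G v s = s ∨ μ s < μ (G v s))) {s : α} (hs : I s) :
    I (iter G N s) ∧ (iter G N s = s ∨ μ s < μ (iter G N s)) ∧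
      (iter G N s = s → ∀ v < N, G v s = s) := by
  induction N with
  | zero => exact ⟨hs, Or.inl rfl, fun _ v hv => absurd hv (Nat.not_lt_zero v)⟩
  | succ N ih =>
    obtain ⟨h1, h2, h3⟩ := ih fun v hv => h v (by omega)
    obtain ⟨h4, h5⟩ := h N (by omega) _ h1
    rw [iter]
    refine ⟨h4, ?_, fun e v hv => ?_⟩
    · rcases h2 with e | h2
      · rw [e] at h5 ⊢; exact h5
      · rcases h5 with e | h5
        · rw [e]; exact Or.inr h2
        · exact Or.inr (h2.trans h5)
    · have h6 : iter G N s = s := by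
        rcases h2 with h2 | h2
        · exact h2
        · exfalso
          rcases h5 with e' | h5
          · rw [e'] at e; rw [e] at h2; exact lt_irrefl _ h2
          · rw [e] at h5; exact lt_asymm h2 h5
      rcases Nat.lt_succ_iff_lt_or_eq.1 hv with hv | rfl
      · exact h3 h6 v hv
      · rwa [h6] at e

theorem iter_eq {α β : Type*} {G : ℕ → α → α} (f : α → β) (h : ∀ v s, f (G v s) = f s) (N : ℕ)
    (s : α) : f (iter G N s) = f s := by
  induction N with
  | zero => rfl
  | succ N ih => rw [iter, h, ih]

/-! ### Labellings which can be refined to triangle partitions -/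

/-- The points with label `c`. -/
noncomputable def Labelling.piece (s : Labelling) (c : ℕ) : Finset Plane :=
  points s.size s.pts fun i => s.lab i = c

/-- The pieces are nonempty, are separated by lines, and have triangle partitions. -/
structure Labelling.Good (s : Labelling) : Prop where
  injOn : Set.InjOn s.pts (Set.Iio s.size)
  le_top : ∀ i < s.size, s.lab i ≤ s.top
  card : ∀ c ≤ s.top, ∃ m, (s.piece c).card = 3 * m
  nonempty : ∀ c ≤ s.top, (s.piece c).Nonempty
  not_bad : ∀ c ≤ s.top, ¬ Bad (s.piece c)
  sep : ∀ c ≤ s.top, ∀ c' ≤ s.top, c ≠ c' → Sep (s.piece c) (s.piece c')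

namespace Labelling

theorem points_left (s : Labelling) (c p q : ℕ) :
    points s.size s.pts (s.Left c p q) = {z ∈ s.piece c | Side (s.pts p) (s.pts q) z} := by
  rw [piece, filter_points]; rfl

theorem points_right (s : Labelling) (c p q : ℕ) :
    points s.size s.pts (s.Right c p q) = {z ∈ s.piece c | ¬ Side (s.pts p) (s.pts q) z} := by
  rw [piece, filter_points]; rfl

theorem Good.count_piece {s : Labelling} (h : s.Good) (c : ℕ) :
    count s.size (fun i => s.lab i = c) = (s.piece c).card := (card_points h.injOn).symm

theorem Good.count_lt_succ {s : Labelling} (h : s.Good) (c : ℕ) :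
    count s.size (fun i => s.lab i < c + 1) =
      count s.size (fun i => s.lab i < c) + (s.piece c).card := by
  rw [← h.count_piece, count, count, count, ← Finset.card_union_of_disjoint]
  · congr 1
    ext i
    simp only [Finset.mem_filter, Finset.mem_union, Nat.lt_succ_iff_lt_or_eq]
    tauto
  · refine Finset.disjoint_left.2 fun i h1 h2 => ?_
    simp only [Finset.mem_filter] at h1 h2
    omega

/-- A nonempty piece of size divisible by three has at least three points; this bounds the number of
labels, and so of successful cuts. -/
theorem Good.count_lt {s : Labelling} (h : s.Good) (c : ℕ) (hc : c ≤ s.top + 1) :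
    3 * c ≤ count s.size fun i => s.lab i < c := by
  induction c with
  | zero => simp
  | succ c ih =>
    have h1 := ih (by omega)
    obtain ⟨m, hm⟩ := h.card c (by omega)
    have h2 := Finset.card_pos.2 (h.nonempty c (by omega))
    rw [h.count_lt_succ]
    omega

theorem Good.top_lt {s : Labelling} (h : s.Good) : 3 * (s.top + 1) ≤ s.size :=
  (h.count_lt _ le_rfl).trans (count_le _ _)

/-- The cutting line separates the new piece from the one it came from; the separation from all
others is inherited. -/
theorem Good.cut {s : Labelling} (h : s.Good) {c p q : ℕ} (hp : p < s.size) (hq : q < s.size) :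
    (s.cut c p q).Good ∧ (s.cut c p q).size = s.size ∧ (s.cut c p q).pts = s.pts ∧
      (s.cut c p q = s ∨ s.top < (s.cut c p q).top) ∧ (s.cut c p q = s → ¬ s.CanCut c p q) := by
  by_cases hcut : s.CanCut c p q
  swap
  · rw [Labelling.cut, if_neg hcut]
    exact ⟨h, rfl, rfl, Or.inl rfl, fun _ => hcut⟩
  rw [Labelling.cut, if_pos hcut]
  obtain ⟨⟨hpc, hqc, hpq⟩, ⟨k, hk, hkc⟩, hbL, hbR⟩ := hcut
  set t : Labelling := { s with
    lab := fun i => if i < s.size ∧ s.Right c p q i then s.top + 1 else s.lab i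
    top := s.top + 1 } with ht
  have hc : c ≤ s.top := hpc ▸ h.le_top p hp
  have hne : s.pts p ≠ s.pts q := fun e => hpq (h.injOn hp hq e)
  have hpieceL : t.piece c = {z ∈ s.piece c | Side (s.pts p) (s.pts q) z} := by
    rw [← points_left]
    ext x
    simp only [piece, mem_points, ht]
    refine exists_congr fun i => and_congr_right fun hi => and_congr_left fun _ => ?_
    by_cases hR : s.Right c p q i
    · simp only [hi, hR, and_self, if_true]
      exact ⟨fun e => by omega, fun hL => absurd hL.2 hR.2⟩
    · simp only [hR, and_false, if_false]
      constructor
      · intro e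
        exact ⟨e, by_contra fun hS => hR ⟨e, hS⟩⟩
      · exact fun hL => hL.1
  have hpieceR : t.piece (s.top + 1) = {z ∈ s.piece c | ¬ Side (s.pts p) (s.pts q) z} := by
    rw [← points_right]
    ext x
    simp only [piece, mem_points, ht]
    refine exists_congr fun i => and_congr_right fun hi => and_congr_left fun _ => ?_
    by_cases hR : s.Right c p q i
    · simp [hi, hR]
    · simp only [hR, and_false, if_false, iff_false]
      have := h.le_top i hi
      omega
  have hpiece : ∀ c' ≤ s.top, c' ≠ c → t.piece c' = s.piece c' := by
    intro c' hc' hne'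
    ext x
    simp only [piece, mem_points, ht]
    refine exists_congr fun i => and_congr_right fun hi => and_congr_left fun _ => ?_
    by_cases hR : s.Right c p q i
    · simp only [hi, hR, and_self, if_true]
      have := hR.1
      omega
    · simp [hR]
  have hsub : ∀ c' ≤ s.top, t.piece c' ⊆ s.piece c' := by
    intro c' hc'
    by_cases e : c' = c
    · subst e; rw [hpieceL]; exact Finset.filter_subset _ _
    · rw [hpiece c' hc' e]
  have hLcard : {z ∈ s.piece c | Side (s.pts p) (s.pts q) z}.card = 3 * k := by
    rw [← points_left, card_points h.injOn]; omega
  obtain ⟨m, hm⟩ := h.card c hc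
  have hRcard : {z ∈ s.piece c | ¬ Side (s.pts p) (s.pts q) z}.card = 3 * (m - k) := by
    have := Finset.card_filter_add_card_filter_not (s := s.piece c)
      (fun z => Side (s.pts p) (s.pts q) z)
    omega
  have hsepcut : Sep (t.piece c) (t.piece (s.top + 1)) := by
    rw [hpieceL, hpieceR]
    exact sep_side (fun a ha => (Finset.mem_filter.1 ha).2) fun b hb => (Finset.mem_filter.1 hb).2
  have hsepnew : ∀ c' ≤ s.top, Sep (t.piece c') (t.piece (s.top + 1)) := by
    intro c' hc'
    by_cases e : c' = c
    · subst e; exact hsepcut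
    · refine (h.sep c' hc' c hc e).mono (hsub c' hc') ?_
      rw [hpieceR]; exact Finset.filter_subset _ _
  refine ⟨⟨h.injOn, ?_, ?_, ?_, ?_, ?_⟩, rfl, rfl, Or.inr (Nat.lt_succ_self _), fun e => ?_⟩
  · intro i hi
    simp only [ht]
    split_ifs
    · exact le_rfl
    · exact (h.le_top i hi).trans (Nat.le_succ _)
  · intro c' hc'
    rcases Nat.le_succ_iff.1 hc' with hc' | rfl
    · by_cases e : c' = c
      · subst e; rw [hpieceL]; exact ⟨_, hLcard⟩
      · rw [hpiece c' hc' e]; exact h.card c' hc'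
    · rw [hpieceR]; exact ⟨_, hRcard⟩
  · intro c' hc'
    rcases Nat.le_succ_iff.1 hc' with hc' | rfl
    · by_cases e : c' = c
      · subst e
        rw [hpieceL]
        exact ⟨s.pts p, Finset.mem_filter.2
          ⟨(apply_mem_points h.injOn hp).2 hpc, side_left _ _⟩⟩
      · rw [hpiece c' hc' e]; exact h.nonempty c' hc'
    · rw [hpieceR]
      exact ⟨s.pts q, Finset.mem_filter.2
        ⟨(apply_mem_points h.injOn hq).2 hqc, not_side_right hne⟩⟩
  · intro c' hc'
    rcases Nat.le_succ_iff.1 hc' with hc' | rfl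
    · by_cases e : c' = c
      · subst e
        rwa [hpieceL, ← points_left, ← badIndex_iff h.injOn (m := k) (by omega)]
      · rw [hpiece c' hc' e]; exact h.not_bad c' hc'
    · rwa [hpieceR, ← points_right, ← badIndex_iff h.injOn (m := m - k)]
      rw [← card_points h.injOn, points_right, hRcard]
  · intro c' hc' c'' hc'' hne'
    rcases Nat.le_succ_iff.1 hc' with hc' | rfl <;> rcases Nat.le_succ_iff.1 hc'' with hc'' | rfl
    · exact (h.sep c' hc' c'' hc'' hne').mono (hsub c' hc') (hsub c'' hc'')
    · exact hsepnew c' hc'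
    · exact (hsepnew c'' hc'').symm
    · exact absurd rfl hne'
  · have := congrArg Labelling.top e
    simp only [ht] at this
    omega

theorem Good.round {s : Labelling} (h : s.Good) :
    (s.round.Good ∧ s.round.size = s.size ∧ s.round.pts = s.pts) ∧
      (s.round = s ∨ s.top < s.round.top) ∧
      (s.round = s → ∀ c < s.size, ∀ p < s.size, ∀ q < s.size, ¬ s.CanCut c p q) := by
  have hI : ∀ c, ∀ p < s.size, ∀ q < s.size, ∀ t : Labelling,
      (t.Good ∧ t.size = s.size ∧ t.pts = s.pts) →
      ((t.cut c p q).Good ∧ (t.cut c p q).size = s.size ∧ (t.cut c p q).pts = s.pts) ∧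
      (t.cut c p q = t ∨ t.top < (t.cut c p q).top) := by
    rintro c p hp q hq t ⟨ht, hs, hpt⟩
    obtain ⟨h1, h2, h3, h4, -⟩ := ht.cut (c := c) (p := p) (q := q) (by omega) (by omega)
    exact ⟨⟨h1, h2.trans hs, h3.trans hpt⟩, h4⟩
  -- The same invariant and the same measure are passed through the three nested loops.
  have hq : ∀ c, ∀ p < s.size, ∀ t : Labelling, (t.Good ∧ t.size = s.size ∧ t.pts = s.pts) →
      _ := fun c p hp t ht => iter_progress (I := fun t : Labelling =>
        t.Good ∧ t.size = s.size ∧ t.pts = s.pts) (μ := top) (hI c p hp) ht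
  have hp : ∀ c, ∀ t : Labelling, (t.Good ∧ t.size = s.size ∧ t.pts = s.pts) →
      _ := fun c t ht => iter_progress (I := fun t : Labelling =>
        t.Good ∧ t.size = s.size ∧ t.pts = s.pts) (μ := top) (N := s.size)
        (G := fun p t => iter (fun q t => t.cut c p q) t.size t)
        (fun p hp t ht => by
          have := hq c p hp t ht
          rw [ht.2.1]
          exact ⟨this.1, this.2.1⟩) ht
  have hc := iter_progress (I := fun t : Labelling =>
        t.Good ∧ t.size = s.size ∧ t.pts = s.pts) (μ := top) (N := s.size)
        (G := fun c t => iter (fun p t => iter (fun q t => t.cut c p q) t.size t) t.size t)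
        (fun c _ t ht => by
          have := hp c t ht
          rw [ht.2.1]
          exact ⟨this.1, this.2.1⟩) (s := s) ⟨h, rfl, rfl⟩
  refine ⟨hc.1, hc.2.1, fun e c hcN p hpN q hqN => ?_⟩
  have h1 := (hp c s ⟨h, rfl, rfl⟩).2.2 (hc.2.2 e c hcN) p hpN
  have h2 := (hq c p hpN s ⟨h, rfl, rfl⟩).2.2 h1 q hqN
  exact (h.cut hpN hqN).2.2.2.2 h2

/-- An idle round means that no cut is possible, but `exists_side_of_not_bad` supplies a cut of
every larger piece. -/
theorem Good.card_eq_three {s : Labelling} (h : s.Good) (hs : s.round = s) {c : ℕ}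
    (hc : c ≤ s.top) : (s.piece c).card = 3 := by
  by_contra h3
  obtain ⟨m, hm⟩ := h.card c hc
  obtain ⟨p, hp, q, hq, hpq, ⟨k, hk⟩, hL, hR⟩ :=
    exists_side_of_not_bad hm (h.not_bad c hc) h3 (h.nonempty c hc)
  obtain ⟨p, hpN, hpc, rfl⟩ := mem_points.1 hp
  obtain ⟨q, hqN, hqc, rfl⟩ := mem_points.1 hq
  have htop := h.top_lt
  have hcL : count s.size (s.Left c p q) = 3 * k := by
    rw [← card_points h.injOn, points_left, hk]
  have hcR : count s.size (s.Right c p q) = 3 * (m - k) := by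
    rw [← card_points h.injOn, points_right]
    have := Finset.card_filter_add_card_filter_not (s := s.piece c)
      (fun z => Side (s.pts p) (s.pts q) z)
    omega
  refine h.round.2.2 hs c (by omega) p hpN q hqN
    ⟨⟨hpc, hqc, fun e => hpq (e ▸ rfl)⟩, ⟨k, ?_, by omega⟩, ?_, ?_⟩
  · have := count_le s.size (s.Left c p q)
    omega
  · rwa [badIndex_iff h.injOn hcL, points_left]
  · rwa [badIndex_iff h.injOn hcR, points_right]

/-- Every round raises `top` until one is idle, and from then on nothing changes. As `top` stays
below `s.size`, that many rounds suffice. -/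
theorem Good.rounds {s : Labelling} (h : s.Good) :
    ∃ t : Labelling, t = iter (fun _ t => t.round) s.size s ∧ t.Good ∧ t.size = s.size ∧
      t.pts = s.pts ∧ ∀ c ≤ t.top, (t.piece c).card = 3 := by
  have key : ∀ N, ((iter (fun _ t => Labelling.round t) N s).Good ∧
      (iter (fun _ t => Labelling.round t) N s).size = s.size ∧
      (iter (fun _ t => Labelling.round t) N s).pts = s.pts) ∧
      ((iter (fun _ t => Labelling.round t) N s).round = iter (fun _ t => Labelling.round t) N s ∨
        N ≤ (iter (fun _ t => Labelling.round t) N s).top) := by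
    intro N
    induction N with
    | zero => exact ⟨⟨h, rfl, rfl⟩, Or.inr (Nat.zero_le _)⟩
    | succ N ih =>
      obtain ⟨⟨h1, h2, h3⟩, h4⟩ := ih
      rw [iter]
      obtain ⟨⟨h5, h6, h7⟩, h8, -⟩ := h1.round
      refine ⟨⟨h5, h6.trans h2, h7.trans h3⟩, ?_⟩
      rcases h8 with h8 | h8
      · left; rw [h8, h8]
      · rcases h4 with h4 | h4
        · rw [h4] at h8; exact absurd h8 (lt_irrefl _)
        · right; omega
  obtain ⟨⟨h1, h2, h3⟩, h4⟩ := key s.size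
  refine ⟨_, rfl, h1, h2, h3, fun c hc => h1.card_eq_three (h4.resolve_right ?_) hc⟩
  have := h1.top_lt
  omega

end Labelling

open RealRAM

/-! ### The output -/

theorem count_mono {N : ℕ} {Φ Ψ : ℕ → Prop} (h : ∀ i < N, Φ i → Ψ i) : count N Φ ≤ count N Ψ :=
  Finset.card_le_card fun i hi => by
    simp only [Finset.mem_filter, Finset.mem_range] at hi ⊢
    exact ⟨hi.1, h i hi.1 hi.2⟩

theorem count_lt_count {N : ℕ} {Φ Ψ : ℕ → Prop} (h : ∀ i < N, Φ i → Ψ i) {j : ℕ} (hj : j < N)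
    (hΦ : ¬ Φ j) (hΨ : Ψ j) : count N Φ < count N Ψ :=
  Finset.card_lt_card ((Finset.ssubset_iff_of_subset fun i hi => by
    simp only [Finset.mem_filter, Finset.mem_range] at hi ⊢
    exact ⟨hi.1, h i hi.1 hi.2⟩).2 ⟨j, by simp [hj, hΨ], by simp [hΦ]⟩)

/-- The place of `i` in the order by labels. -/
noncomputable def place (N : ℕ) (lab : ℕ → ℕ) (i : ℕ) : ℕ := count N (Before lab i)

theorem place_lt_place {N : ℕ} {lab : ℕ → ℕ} {i j : ℕ} (hi : i < N) (h : Before lab j i) :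
    place N lab i < place N lab j := by
  refine count_lt_count (fun k _ hk => ?_) hi ?_ h
  · simp only [Before] at h hk ⊢; omega
  · simp only [Before]; omega

theorem place_injOn (N : ℕ) (lab : ℕ → ℕ) : Set.InjOn (place N lab) (Set.Iio N) := by
  intro i hi j hj e
  by_contra hne
  have : Before lab j i ∨ Before lab i j := by simp only [Before]; omega
  rcases this with h | h
  · have := place_lt_place hi h; omega
  · have := place_lt_place hj h; omega

theorem place_lt {N : ℕ} {lab : ℕ → ℕ} {i : ℕ} (hi : i < N) : place N lab i < N := by
  have h1 : place N lab i < count N fun _ => True :=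
    count_lt_count (fun _ _ _ => trivial) hi (by simp [Before]) trivial
  exact h1.trans_le (count_le _ _)

theorem exists_place_eq {N : ℕ} {lab : ℕ → ℕ} {x : ℕ} (hx : x < N) :
    ∃ i < N, place N lab i = x := by
  have h := Finset.surjOn_of_injOn_of_card_le (s := Finset.range N) (t := Finset.range N)
    (place N lab) (fun i hi => by simpa using place_lt (by simpa using hi))
    ((place_injOn N lab).mono fun i hi => by simpa using hi) le_rfl
  obtain ⟨i, hi, e⟩ := h (by simpa using hx : x ∈ (Finset.range N : Set ℕ))
  exact ⟨i, by simpa using hi, e⟩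

theorem outStore_spec (σ : Store) : (∀ i < size σ,
    (outStore σ).nat 2 (place (size σ) (σ.nat 3) i) = i) ∧ (outStore σ).nat 1 = σ.nat 1 := by
  have key : ∀ N ≤ size σ, ∀ τ, τ = iter (fun (i : ℕ) (τ : Store) =>
      τ.setNat 2 (count (size τ) (Before (τ.nat 3) i)) i) N σ → size τ = size σ ∧
      τ.nat 3 = σ.nat 3 ∧ τ.nat 1 = σ.nat 1 ∧
      ∀ i < N, τ.nat 2 (place (size σ) (σ.nat 3) i) = i := by
    intro N
    induction N with
    | zero => rintro - τ rfl; simp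
    | succ N ih =>
      rintro hN υ rfl
      obtain ⟨h1, h2, h3, h4⟩ := ih (by omega) _ rfl
      rw [iter]
      set τ := iter (fun (i : ℕ) (τ : Store) =>
        τ.setNat 2 (count (size τ) (Before (τ.nat 3) i)) i) N σ
      rw [h1, h2]
      refine ⟨by rw [size, setNat_nat_of_ne _ _ _ (by norm_num)]; exact h1,
        by rw [setNat_nat_of_ne _ _ _ (by norm_num), h2],
        by rw [setNat_nat_of_ne _ _ _ (by norm_num), h3], fun i hi => ?_⟩
      by_cases e : i = N
      · subst e; exact setNat_nat_self _ _ _ _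
      -- Different points have different places, so nothing is overwritten.
      · rw [setNat_nat_of_ne', h4 i (by omega)]
        intro e'
        exact e (place_injOn _ _ (show i < size σ by omega) (show N < size σ by omega) e')
  obtain ⟨-, -, h3, h4⟩ := key _ le_rfl _ rfl
  exact ⟨h4, h3⟩

theorem Labelling.Good.count_lt_eq {s : Labelling} (h : s.Good)
    (h3 : ∀ c ≤ s.top, (s.piece c).card = 3) (c : ℕ) (hc : c ≤ s.top + 1) :
    count s.size (fun i => s.lab i < c) = 3 * c := by
  induction c with
  | zero => simp [count]
  | succ c ih =>
    have h1 := ih (by omega)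
    rw [h.count_lt_succ, h1, h3 c (by omega)]
    ring

/-- Each smaller label accounts for exactly three earlier points, and the point's own label for
fewer than three. -/
theorem Labelling.Good.place_div {s : Labelling} (h : s.Good)
    (h3 : ∀ c ≤ s.top, (s.piece c).card = 3) {i : ℕ} (hi : i < s.size) :
    3 * s.lab i ≤ place s.size s.lab i ∧ place s.size s.lab i < 3 * s.lab i + 3 := by
  have htop := h.le_top i hi
  constructor
  · rw [← h.count_lt_eq h3 (s.lab i) (by omega)]
    exact count_mono fun j _ hj => Or.inl hj
  · have e := h.count_lt_eq h3 (s.lab i + 1) (by omega)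
    rw [show 3 * s.lab i + 3 = 3 * (s.lab i + 1) by ring, ← e]
    refine count_lt_count (fun j _ hj => ?_) hi (by simp [Before]) (Nat.lt_succ_self _)
    rcases hj with hj | hj <;> omega

theorem not_col_of_not_bad {X : Finset Plane} (hX : X.card = 3) (h : ¬ Bad X) : ¬ Col X := by
  rintro ⟨g, hg, c, hc⟩
  obtain ⟨S, -, hS, hSc⟩ := exists_indep_of_line hg (X := X) _ X rfl le_rfl hc
  exact h ⟨S, hS, by omega⟩

/-- Sorted by labels, the points fall into consecutive blocks of three, and the block `k` is the
piece with label `k`. -/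
theorem Labelling.Good.outputs {n : ℕ} {p : Fin (3 * n) → Plane} {s : Labelling} (h : s.Good)
    (h3 : ∀ c ≤ s.top, (s.piece c).card = 3) (hs : s.size = 3 * n)
    (hp : ∀ i, s.pts (i : Fin (3 * n)) = p i) {τ : Store}
    (hτ : ∀ i < 3 * n, τ.nat 2 (place (3 * n) s.lab i) = i) :
    OutputsTrianglePartition p τ := by
  have hn : s.top + 1 = n := by
    have h1 := h.count_lt_eq h3 (s.top + 1) le_rfl
    have h2 : count s.size (fun i => s.lab i < s.top + 1) = count s.size fun _ => True :=
      le_antisymm (count_mono fun _ _ _ => trivial)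
        (count_mono fun i hi _ => Nat.lt_succ_iff.2 (h.le_top i hi))
    rw [h2] at h1
    simp [count] at h1
    omega
  have hout : ∀ x < 3 * n, τ.nat 2 x < 3 * n ∧ 3 * s.lab (τ.nat 2 x) ≤ x ∧
      x < 3 * s.lab (τ.nat 2 x) + 3 := by
    intro x hx
    obtain ⟨i, hi, rfl⟩ := exists_place_eq (lab := s.lab) hx
    rw [hτ i hi]
    have := h.place_div h3 (i := i) (by omega)
    rw [hs] at this
    exact ⟨hi, this⟩
  let v : Fin n → Fin 3 → Fin (3 * n) := fun k j => ⟨τ.nat 2 (3 * k + j), (hout _ (by omega)).1⟩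
  have hpiece : ∀ k : Fin n, (Set.range fun j => p (v k j)) = (s.piece k : Set Plane) := by
    intro k
    ext x
    simp only [Set.mem_range, Finset.mem_coe, Labelling.piece, mem_points]
    constructor
    · rintro ⟨j, rfl⟩
      obtain ⟨h1, h2, h3'⟩ := hout (3 * k + j) (by omega)
      exact ⟨τ.nat 2 (3 * k + j), by omega, by omega, hp (v k j)⟩
    · rintro ⟨i, hi, hlab, rfl⟩
      have h1 := h.place_div h3 hi
      rw [hs, hlab] at h1
      refine ⟨⟨place (3 * n) s.lab i - 3 * k, by omega⟩, ?_⟩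
      rw [← hp]
      congr 1
      change τ.nat 2 (3 * (k : ℕ) + (place (3 * n) s.lab i - 3 * k)) = i
      rw [Nat.add_sub_cancel' h1.1, hτ i (by omega)]
  refine ⟨v, fun k j => rfl, ?_⟩
  simp only [hpiece]
  refine ⟨?_, ?_, ?_, ?_⟩
  · ext x
    simp only [Set.sUnion_range, Set.mem_iUnion, Finset.mem_coe, Labelling.piece, mem_points,
      Set.mem_range]
    constructor
    · rintro ⟨k, i, hi, -, rfl⟩
      exact ⟨⟨i, by omega⟩, (hp _).symm⟩
    · rintro ⟨i, rfl⟩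
      have := h.le_top i (by omega)
      exact ⟨⟨s.lab i, by omega⟩, i, by omega, rfl, hp i⟩
  · rintro _ ⟨k, rfl⟩
    simp only [Set.encard_coe_eq_coe_finsetCard, h3 k (by omega)]
    rfl
  · rintro _ ⟨k, rfl⟩
    simp only [collinear_iff_col]
    exact not_col_of_not_bad (h3 k (by omega)) (h.not_bad k (by omega))
  · rintro _ ⟨k, rfl⟩ _ ⟨l, rfl⟩ hne
    refine (h.sep k (by omega) l (by omega) fun e => hne ?_).disjoint_convexHull
    simp only [e]

/-! ### Correctness of the program -/

theorem Labelling.round_eq (t : Labelling) :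
    (t.round.size, t.round.pts) = (t.size, t.pts) := by
  refine iter_eq (fun t : Labelling => (t.size, t.pts)) (fun c t => ?_) _ _
  refine iter_eq (fun t : Labelling => (t.size, t.pts)) (fun p t => ?_) _ _
  refine iter_eq (fun t : Labelling => (t.size, t.pts)) (fun q t => ?_) _ _
  rw [Labelling.cut]
  split_ifs <;> rfl


theorem iter_roundStore_nat_one (N : ℕ) (σ : Store) :
    (iter (fun _ τ => roundStore τ) N σ).nat 1 = σ.nat 1 := by
  have hcut : ∀ c p q σ, (cutStore c p q σ).nat 1 = σ.nat 1 := by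
    intro c p q σ
    rw [cutStore]
    split_ifs
    · refine (iter_eq (fun τ : Store => τ.nat 1) (fun i τ => ?_) _ _).trans
        (setNat_nat_of_ne _ _ _ (by norm_num))
      rw [relabelPoint]
      split_ifs
      · exact setNat_nat_of_ne _ _ _ (by norm_num)
      · rfl
    · rfl
  refine iter_eq (fun τ : Store => τ.nat 1) (fun _ τ => ?_) _ _
  refine iter_eq (fun τ : Store => τ.nat 1) (fun c τ => ?_) _ _
  refine iter_eq (fun τ : Store => τ.nat 1) (fun p τ => ?_) _ _
  exact iter_eq (fun τ : Store => τ.nat 1) (fun q τ => hcut c p q τ) _ _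

theorem size_inputStore {N : ℕ} (p : Fin N → Plane) : size (inputStore p) = N := by
  simp [size, inputStore]

theorem point_inputStore {N : ℕ} (p : Fin N → Plane) (i : Fin N) :
    point (inputStore p) i = p i := by
  ext j
  fin_cases j <;> simp [point, inputStore]

/-- If the set is bad, the flag stays `0` and the labels are irrelevant. Otherwise the initial
labelling, with all labels `0`, is good, and the rounds refine it to triangles. -/
theorem partitionStore_spec {n : ℕ} {p : Fin (3 * n) → Plane} (hp : Function.Injective p) {τ : Store}
    (hτ : Agree 0 (partitionStore (inputStore p)) τ) :
    ((∃ 𝒯, IsTrianglePartition (Set.range p) 𝒯) → τ.nat 1 0 = 1 ∧ OutputsTrianglePartition p τ) ∧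
      ((¬ ∃ 𝒯, IsTrianglePartition (Set.range p) 𝒯) → τ.nat 1 0 = 0) := by
  set σ := inputStore p with hσ
  set s := labelling σ with hs
  have hsize : s.size = 3 * n := size_inputStore p
  have hpts : ∀ i : Fin (3 * n), s.pts i = p i := point_inputStore p
  have hinj : Set.InjOn s.pts (Set.Iio s.size) := by
    intro i hi j hj e
    have hi : i < 3 * n := hsize ▸ hi
    have hj : j < 3 * n := hsize ▸ hj
    have := hp ((hpts ⟨i, hi⟩).symm.trans (e.trans (hpts ⟨j, hj⟩)))
    simpa using this
  set X := points s.size s.pts fun _ => True with hX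
  have hXr : (X : Set Plane) = Set.range p := by
    ext x
    simp only [hX, Finset.mem_coe, mem_points, Set.mem_range, true_and, hsize]
    constructor
    · rintro ⟨i, hi, rfl⟩
      exact ⟨⟨i, hi⟩, (hpts _).symm⟩
    · rintro ⟨i, rfl⟩
      exact ⟨i, i.2, hpts i⟩
  have hcount : count s.size (fun _ => True) = 3 * n := by simp [count, hsize]
  have hXc : X.card = 3 * n := (card_points hinj).trans hcount
  set υ := iter (fun _ τ => roundStore τ) (size σ) σ with hυ
  have hυlab : labelling υ = iter (fun _ t => t.round) s.size s :=
    iter_map labelling (fun _ τ => labelling_roundStore τ) _ _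
  have hround : ∀ N, (iter (fun (_ : ℕ) (t : Labelling) => t.round) N s).size = s.size ∧
      (iter (fun (_ : ℕ) (t : Labelling) => t.round) N s).pts = s.pts := fun N =>
    Prod.mk.inj (iter_eq (fun t : Labelling => (t.size, t.pts)) (fun _ => Labelling.round_eq) N s)
  have hυs : size υ = 3 * n := by
    have := congrArg Labelling.size hυlab
    rw [(hround _).1, hsize] at this
    exact this
  have hυp : point υ = s.pts := by
    have := congrArg Labelling.pts hυlab
    rw [(hround _).2] at this
    exact this
  have hυ1 : υ.nat 1 0 = 0 := by
    rw [hυ, iter_roundStore_nat_one]; simp [hσ, inputStore]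
  have hbad : BadIndex (size υ) (point υ) (fun _ => True) ↔ Bad X := by
    rw [hυs, hυp, ← hsize]
    exact badIndex_iff hinj hcount
  rw [← hXr, exists_partition_iff hXc, not_not]
  have hout := outStore_spec (flagStore υ)
  have h1 : τ.nat 1 = (flagStore υ).nat 1 := by
    rw [hτ.nat 1 (by norm_num) (by norm_num)]; exact hout.2
  rw [h1]
  by_cases hb : Bad X
  · refine ⟨fun h => absurd hb h, fun _ => ?_⟩
    rw [flagStore, if_neg (by rw [hbad]; exact not_not.2 hb), hυ1]
  refine ⟨fun _ => ⟨?_, ?_⟩, fun h => absurd h hb⟩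
  · rw [flagStore, if_pos (by rwa [hbad]), setNat_nat_self]
  -- For `n = 0` the piece with label `0` is empty, so the initial labelling is not good.
  rcases Nat.eq_zero_or_pos n with rfl | hn
  · refine ⟨fun k => k.elim0, fun k => k.elim0, ?_⟩
    have e : Set.range p = ∅ := Set.range_eq_empty_iff.2 ⟨fun i => by have := i.2; omega⟩
    rw [e, Set.range_eq_empty]
    exact ⟨by simp, by simp, by simp, by simp⟩
  have hlab0 : ∀ i, s.lab i = 0 := fun i => by simp [hs, labelling, hσ, inputStore]
  have htop0 : s.top = 0 := by simp [hs, labelling, hσ, inputStore]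
  have hp0 : s.piece 0 = X := by simp [Labelling.piece, hX, hlab0]
  have hgood : s.Good := by
    refine ⟨hinj, fun i _ => by rw [hlab0]; exact Nat.zero_le _, ?_, ?_, ?_, ?_⟩ <;> intro c hc <;>
      obtain rfl : c = 0 := by omega
    · rw [hp0]; exact ⟨n, hXc⟩
    · rw [hp0]; exact Finset.card_pos.1 (by omega)
    · rwa [hp0]
    · intro c' hc' hne; omega
  obtain ⟨t, ht, htg, hts, htp, ht3⟩ := hgood.rounds
  rw [← hυlab] at ht
  have hfl : size (flagStore υ) = 3 * n ∧ (flagStore υ).nat 3 = t.lab := by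
    have : t.lab = υ.nat 3 := by rw [ht]; rfl
    rw [flagStore, if_pos (by rwa [hbad]), size, setNat_nat_of_ne _ _ _ (by norm_num),
      setNat_nat_of_ne _ _ _ (by norm_num)]
    exact ⟨hυs, this.symm⟩
  rw [hfl.1, hfl.2] at hout
  refine htg.outputs ht3 (hts.trans hsize) (fun i => by rw [htp, hpts]) fun i hi => ?_
  rw [hτ.nat 2 (by norm_num) (by norm_num)]
  exact hout.1 i hi

theorem exists_program : ∃ (c : Program) (q : Polynomial ℕ),
    ConstructsTrianglePartitions c fun n => q.eval n := by
  obtain ⟨-, -, π, q, hπ⟩ := does_partitionStore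
  -- The time bound is in terms of the number of points, which is `3 * n`.
  refine ⟨π, q.comp (.C 3 * .X), fun n p hp => ?_⟩
  obtain ⟨t, τ, hr, ht, ha⟩ := hπ (inputStore p)
  refine ⟨t, τ, hr, ?_, partitionStore_spec hp ha⟩
  rw [size_inputStore] at ht
  simpa using ht

end TrianglePartition

theorem mainTheorem1 :
    (∀ (n : ℕ) (P : Set Plane), P.encard = ((3 * n : ℕ) : ℕ∞) →
      ((¬ ∃ S, IsIndependentSet P S ∧ S.encard = ((n + 1 : ℕ) : ℕ∞)) →
        ∃ 𝒯, IsTrianglePartition P 𝒯 ∧ 𝒯.encard = (n : ℕ∞)) ∧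
      ((∃ 𝒯, IsTrianglePartition P 𝒯) →
        ¬ ∃ S, IsIndependentSet P S ∧ S.encard = ((n + 1 : ℕ) : ℕ∞))) ∧
    ∃ (c : RealRAM.Program) (q : Polynomial ℕ),
      RealRAM.ConstructsTrianglePartitions c (fun n => q.eval n) :=
  ⟨TrianglePartition.partition_characterization, TrianglePartition.exists_program⟩
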